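/- **Mosco convergence.** *Setting.* Let $B$ be a smooth surface, $D\subset B$ finite, $B_{\rm reg}=B\setminus D$ with a smooth Riemannian metric $g_B$, and let $B_0\Subset B_{\rm reg}$ be open and precompact. For $t\in(0,t_0]$ let $\Pi_t:X_t\to B_{\rm reg}$ be a smooth surjective submersion from a smooth $4$-manifold with Riemannian metric $g(t)$, and put $X_{t,0}=\Pi_t^{-1}(B_0)$, $\mu_t=\mu_{g(t)}$, $\mu_B=\mu_{g_B}$. *Semi-flat $C^1$ control.* Assume that for each $t$ there is a reference metric $g_t^\Pi=g_B\oplus g_{F,t}$ on $X_{t,0}$ of the following form: every point of $B_0$ has a neighbourhood $U\subset B_0$ with a smooth trivialization $\Pi_t^{-1}(U)\cong U\times\mathbb R^2/\mathbb Z^2$ in which $g_t^\Pi=g_B+\sum_{a,c} h_{ac}(b)\,d\theta^a d\theta^c$, with $h$ smooth, symmetric and positive definite; so the fibres $F_{b,t}$ $(b\in B_0)$ are flat $2$-tori with metric $g_{F,t}$. Assume that there are $s(t)>0$ and $\varepsilon_t\ge0$, both tending to $0$ as $t\downarrow0$, and a constant $C$ independent of $t$, such that for all $t\in(0,t_0]$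 and $b\in B_0$ $$\|g(t)-g_t^\Pi\|_{C^1(X_{t,0},g_t^\Pi)}\le\varepsilon_t,\qquad |\nabla_{g_B}\log \mathrm{Area}(F_{b,t},g_{F,t})|_{g_B}\le C\varepsilon_t,\qquad \mathrm{diam}(F_{b,t},g_{F,t})\le s(t).$$ Here $\|S\|_{C^1(X_{t,0},h)}=\sup_{X_{t,0}}(|S|_h+|\nabla^h S|_h)$. (The condition on the area is automatic if $g_{F,t}$ does not depend on $b$ in the trivializations.) *Vertical gap.* Assume that there is $c_{\rm gap}>0$ with $\lambda_1(F_{b,t},g_{F,t})\ge c_{\rm gap}\,s(t)^{-2}$ for all $b\in B_0$ and $t\in(0,t_0]$. *Forms.* Let $E_B[v]=\int_{B_0}|\nabla v|_{g_B}^2\,d\mu_B$ with domain $H^1_0(B_0)$ and $E_t[u]=\int_{X_{t,0}}|\nabla u|_{g(t)}^2\,d\mu_t$ with domain $H^1_0(X_{t,0})$ (the closures of $C_c^\infty$ in $H^1$), both extended by $+\infty$ to all of $L^2$. *Conclusion.* Let $\vartheta_{b,t}$ be the Haar probability measure of $F_{b,t}$. Then for every $t$ there are measurable $A_t:B_0\to(0,\infty)$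 and $\rho_t:X_{t,0}\to(0,\infty)$ with $$\int_{X_{t,0}}f\,d\mu_t=\int_{B_0}A_t(b)\Big(\int_{F_{b,t}}f\,\rho_t\,d\vartheta_{b,t}\Big)d\mu_B(b)\quad(f\ge 0\text{ measurable}),\qquad \int_{F_{b,t}}\rho_t\,d\vartheta_{b,t}=1\quad(b\in B_0).$$ For any such $A_t,\rho_t$ let $(I_tv)(x)=A_t(\Pi_tx)^{-1/2}v(\Pi_tx)$ and $(P_tu)(b)=A_t(b)^{1/2}\int_{F_{b,t}}u\,\rho_t\,d\vartheta_{b,t}$. Then $E_t$ Mosco-converges to $E_B$ through $(P_t,I_t)$ as $t\downarrow 0$: 1. (Liminf) If $u_t\in H^1_0(X_{t,0})$, $\sup_t\|u_t\|_{L^2(\mu_t)}<\infty$, $v\in L^2(B_0)$ and $P_tu_t\to v$ in $L^2(B_0)$, then $\liminf_{t\downarrow0}E_t[u_t]\ge E_B[v]$; in particular $v\in H^1_0(B_0)$ if this lower limit is finite. 2. (Recovery) For every $v\in H^1_0(B_0)$ the functions $u_t:=I_tv$ satisfy $P_tu_t=v$ for all $t$, $u_t\in H^1_0(X_{t,0})$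 for all $t$ with $\varepsilon_t<1$ (hence for all small $t$), and $\limsup_{t\downarrow0}E_t[u_t]\le E_B[v]$. -/

import Mathlib

open Set Filter Topology MeasureTheory Manifold Bundle
open scoped ContDiff ENNReal

noncomputable section

namespace Collapse

/-! ## Riemannian manifolds: metric, gradient, measure -/

/-- The model space `ℝⁿ` with its Euclidean norm. -/
abbrev Eu (n : ℕ) : Type := EuclideanSpace ℝ (Fin n)

/-- The `i`-th coordinate vector of `ℝⁿ`. -/
def basisVec {n : ℕ} (i : Fin n) : Eu n := EuclideanSpace.single i (1 : ℝ)

/-- The tangent space at `x` of a manifold modelled on `ℝⁿ`. -/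
abbrev Tan (n : ℕ) {X : Type*} [TopologicalSpace X] [ChartedSpace (Eu n) X] (x : X) : Type :=
  TangentSpace 𝓘(ℝ, Eu n) x

/-- Smooth Riemannian metrics on a smooth `n`-manifold. -/
abbrev Metric (n : ℕ) (X : Type*) [TopologicalSpace X] [ChartedSpace (Eu n) X]
    [IsManifold 𝓘(ℝ, Eu n) ∞ X] : Type _ :=
  ContMDiffRiemannianMetric 𝓘(ℝ, Eu n) ∞ (Eu n) (fun x : X => Tan n x)

/-- Fields of bilinear forms on the tangent spaces (no regularity is required). -/
abbrev BilinField (n : ℕ) (X : Type*) [TopologicalSpace X] [ChartedSpace (Eu n) X] : Type _ :=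
  ∀ x : X, Tan n x →L[ℝ] Tan n x →L[ℝ] ℝ

section Riemannian

variable {n : ℕ} {X : Type*} [TopologicalSpace X] [ChartedSpace (Eu n) X]

/-- The differential of a real function at `x`, as a linear form on the tangent space. -/
def differential (φ : X → ℝ) (x : X) : Tan n x →L[ℝ] ℝ :=
  mfderiv 𝓘(ℝ, Eu n) 𝓘(ℝ, ℝ) φ x

/-- The image of the `i`-th coordinate vector under a map `F` from (an open subset of) `ℝⁿ`. -/
def coordVec (F : Eu n → X) (y : Eu n) (i : Fin n) : Tan n (F y) :=
  mfderiv 𝓘(ℝ, Eu n) 𝓘(ℝ, Eu n) F y (basisVec i)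

/-- The matrix of the pull-back of a field of bilinear forms under a local parametrization `F`. -/
def coordMatrix (T : BilinField n X) (F : Eu n → X) (y : Eu n) : Matrix (Fin n) (Fin n) ℝ :=
  Matrix.of fun i j => T (F y) (coordVec F y i) (coordVec F y j)

/-- `F` is a smooth local parametrization (an immersion between manifolds of the same dimension)
on the open set `V` of `ℝⁿ`. -/
structure IsLocalParam (F : Eu n → X) (V : Set (Eu n)) : Prop where
  isOpen : IsOpen V
  smooth : ContMDiffOn 𝓘(ℝ, Eu n) 𝓘(ℝ, Eu n) ∞ F V
  injective : ∀ y ∈ V, Function.Injective (mfderiv 𝓘(ℝ, Eu n) 𝓘(ℝ, Eu n) F y)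

variable [IsManifold 𝓘(ℝ, Eu n) ∞ X]

/-- Every linear form on a tangent space is represented by a vector. -/
theorem exists_riesz (g : Metric n X) (x : X) (l : Tan n x →L[ℝ] ℝ) :
    ∃ v : Tan n x, ∀ w : Tan n x, g.inner x v w = l w := by
  let L : Eu n →ₗ[ℝ] (Eu n →ₗ[ℝ] ℝ) :=
    { toFun := fun v => ((g.inner x v : Tan n x →L[ℝ] ℝ) : Tan n x →ₗ[ℝ] ℝ)
      map_add' := fun v w => by
        ext z
        exact congrArg (fun q : Tan n x →L[ℝ] ℝ => q z) (map_add (g.inner x) v w)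
      map_smul' := fun c v => by
        ext z
        exact congrArg (fun q : Tan n x →L[ℝ] ℝ => q z) (map_smul (g.inner x) c v) }
  have hinj : Function.Injective L := by
    rw [← LinearMap.ker_eq_bot, LinearMap.ker_eq_bot']
    intro v hv
    by_contra hne
    have h1 : 0 < g.inner x v v := g.pos x v hne
    have h2 : g.inner x v v = 0 := LinearMap.congr_fun hv v
    exact h1.ne' h2
  have hsurj : Function.Surjective L :=
    (LinearMap.injective_iff_surjective_of_finrank_eq_finrank
      (Subspace.dual_finrank_eq (K := ℝ) (V := Eu n)).symm).1 hinj
  obtain ⟨v, hv⟩ := hsurj (l : Tan n x →ₗ[ℝ] ℝ)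
  exact ⟨v, fun w => LinearMap.congr_fun hv w⟩

/-- The Riemannian gradient: `g(∇φ, w) = dφ(w)` for all `w`. -/
def gradient (g : Metric n X) (φ : X → ℝ) (x : X) : Tan n x :=
  (exists_riesz g x (differential φ x)).choose

/-- The squared length `|∇φ|_g²`. -/
def gradSq (g : Metric n X) (φ : X → ℝ) (x : X) : ℝ :=
  g.inner x (gradient g φ x) (gradient g φ x)

variable [MeasurableSpace X]

/-- The Riemannian measure on the domain of the preferred chart at `x`: the image of
`√det(g_ij) dy` under the inverse chart. -/
def chartMeasure (g : Metric n X) (x : X) : Measure X :=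
  Measure.map (chartAt (Eu n) x).symm
    ((volume.restrict (chartAt (Eu n) x).target).withDensity fun y =>
      ENNReal.ofReal (Real.sqrt (coordMatrix g.inner (chartAt (Eu n) x).symm y).det))

/-- The Riemannian measure `μ_g`. By the change of variables formula the chart measures agree on
overlaps, so (on a second countable manifold) their least upper bound is the measure that restricts
to each of them on the domain of the chart. -/
def riemannianMeasure (g : Metric n X) : Measure X := ⨆ x : X, chartMeasure g x

/-! ## `H¹₀` and the Dirichlet form -/

/-- `C_c^∞(Ω)`. -/
def IsTestFunction (Ω : Set X) (φ : X → ℝ) : Prop :=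
  ContMDiff 𝓘(ℝ, Eu n) 𝓘(ℝ, ℝ) ∞ φ ∧ HasCompactSupport φ ∧ tsupport φ ⊆ Ω

/-- `∫_Ω |∇φ|_g² dμ_g` for a smooth function. -/
def smoothEnergy (g : Metric n X) (Ω : Set X) (φ : X → ℝ) : ℝ≥0∞ :=
  ∫⁻ x in Ω, ENNReal.ofReal (gradSq g φ x) ∂(riemannianMeasure g)

/-- The `L²(Ω, μ_g)` norm. -/
def l2Norm (g : Metric n X) (Ω : Set X) (u : X → ℝ) : ℝ≥0∞ :=
  eLpNorm u 2 ((riemannianMeasure g).restrict Ω)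

/-- `u ∈ L²(Ω, μ_g)`. -/
def InL2 (g : Metric n X) (Ω : Set X) (u : X → ℝ) : Prop :=
  MemLp u 2 ((riemannianMeasure g).restrict Ω)

/-- The sequence `φ` in `C_c^∞(Ω)` converges to `u ∈ L²(Ω)` in `L²(Ω)` and is Cauchy for the
Dirichlet seminorm, i.e. it is Cauchy in `H¹(Ω)` with limit `u`. -/
structure H1Approximates (g : Metric n X) (Ω : Set X) (φ : ℕ → X → ℝ) (u : X → ℝ) : Prop where
  inL2 : InL2 g Ω u
  test : ∀ k, IsTestFunction (n := n) Ω (φ k)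
  tendsto : Tendsto (fun k => l2Norm g Ω (φ k - u)) atTop (𝓝 0)
  cauchy : Tendsto (fun p : ℕ × ℕ => smoothEnergy g Ω (φ p.1 - φ p.2)) atTop (𝓝 0)

/-- `H¹₀(Ω)`: the closure of `C_c^∞(Ω)` in the `H¹(Ω)` norm. -/
def H10 (g : Metric n X) (Ω : Set X) : Set (X → ℝ) :=
  {u | ∃ φ : ℕ → X → ℝ, H1Approximates g Ω φ u}

/-- The Dirichlet form `E[u] = ∫_Ω |∇u|_g² dμ_g` with domain `H¹₀(Ω)`, as an extended functional
(`+∞` off its domain). For `u ∈ H¹₀(Ω)`, `∇u` is the `L²` limit of `∇φ_k` for any sequence `φ_k` of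
test functions approximating `u` in `H¹`, so `E[u]` is the limit of the energies of the `φ_k`; it
does not depend on the sequence, since the form is closable. -/
def dirichletForm (g : Metric n X) (Ω : Set X) (u : X → ℝ) : ℝ≥0∞ :=
  ⨅ (φ : ℕ → X → ℝ) (_ : H1Approximates g Ω φ u),
    liminf (fun k => smoothEnergy g Ω (φ k)) atTop

end Riemannian

/-! ## The `C¹` norm of a symmetric 2-tensor with respect to a metric, in coordinates -/

section Tensor

variable {n : ℕ}

/-- The partial derivative `∂_k f`. -/
def partialD (k : Fin n) (f : Eu n → ℝ) (y : Eu n) : ℝ := fderiv ℝ f y (basisVec k)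

/-- The Christoffel symbol `Γ^l_{ij}` of the metric with coordinate matrix `G`. -/
def christoffel (G : Eu n → Matrix (Fin n) (Fin n) ℝ) (l i j : Fin n) (y : Eu n) : ℝ :=
  (1 / 2 : ℝ) * ∑ m, (G y)⁻¹ l m *
    (partialD i (fun z => G z j m) y + partialD j (fun z => G z i m) y
      - partialD m (fun z => G z i j) y)

/-- The covariant derivative `∇_k S_{ij}` of a 2-tensor for the Levi-Civita connection of `G`. -/
def covDeriv (G S : Eu n → Matrix (Fin n) (Fin n) ℝ) (k i j : Fin n) (y : Eu n) : ℝ :=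
  partialD k (fun z => S z i j) y
    - ∑ l, christoffel G l k i y * S y l j - ∑ l, christoffel G l k j y * S y i l

/-- `|S|_G` at `y`. -/
def tensorNorm (G S : Eu n → Matrix (Fin n) (Fin n) ℝ) (y : Eu n) : ℝ :=
  Real.sqrt (∑ i, ∑ j, ∑ a, ∑ b, (G y)⁻¹ i a * (G y)⁻¹ j b * S y i j * S y a b)

/-- `|∇S|_G` at `y`. -/
def covDerivNorm (G S : Eu n → Matrix (Fin n) (Fin n) ℝ) (y : Eu n) : ℝ :=
  Real.sqrt (∑ k, ∑ i, ∑ j, ∑ c, ∑ a, ∑ b,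
    (G y)⁻¹ k c * (G y)⁻¹ i a * (G y)⁻¹ j b * covDeriv G S k i j y * covDeriv G S c a b y)

/-- `‖S‖_{C¹(Ω, h)} ≤ δ`: at every point of `Ω` one has `|S|_h + |∇^h S|_h ≤ δ`, computed in
arbitrary local coordinates around the point (the value does not depend on the coordinates). -/
def C1NormLE {X : Type*} [TopologicalSpace X] [ChartedSpace (Eu n) X]
    (h S : BilinField n X) (Ω : Set X) (δ : ℝ) : Prop :=
  ∀ (F : Eu n → X) (V : Set (Eu n)), IsLocalParam F V → ∀ y ∈ V, F y ∈ Ω →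
    tensorNorm (coordMatrix h F) (coordMatrix S F) y
      + covDerivNorm (coordMatrix h F) (coordMatrix S F) y ≤ δ

end Tensor

/-! ## Flat 2-tori `ℝ²/ℤ²` with a constant metric `h` -/

/-- The vector in `ℝ²` with the given integer coordinates. -/
def latticeVec (k : Fin 2 → ℤ) : Eu 2 := WithLp.toLp 2 fun a => (k a : ℝ)

/-- `h(α, β)` for a constant metric `h` on `ℝ²`. -/
def flatInner (h : Matrix (Fin 2) (Fin 2) ℝ) (α β : Eu 2) : ℝ := ∑ a, ∑ b, h a b * α a * β b

/-- The area of `(ℝ²/ℤ², h)`. -/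
def torusArea (h : Matrix (Fin 2) (Fin 2) ℝ) : ℝ := Real.sqrt h.det

/-- The diameter of `(ℝ²/ℤ², h)`; by homogeneity it is the largest distance to the origin. -/
def torusDiam (h : Matrix (Fin 2) (Fin 2) ℝ) : ℝ :=
  ⨆ θ : Eu 2, ⨅ k : Fin 2 → ℤ, Real.sqrt (flatInner h (θ + latticeVec k) (θ + latticeVec k))

/-- The Laplacian `Δ_h f = h^{ab} ∂_a ∂_b f` of the constant metric `h`. -/
def flatLaplacian (h : Matrix (Fin 2) (Fin 2) ℝ) (f : Eu 2 → ℝ) (θ : Eu 2) : ℝ :=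
  ∑ a, ∑ b, h⁻¹ a b * partialD a (partialD b f) θ

/-- The first nonzero eigenvalue of `-Δ_h` on `ℝ²/ℤ²`. -/
def torusLambda1 (h : Matrix (Fin 2) (Fin 2) ℝ) : ℝ :=
  sInf {l : ℝ | 0 < l ∧ ∃ f : Eu 2 → ℝ, ContDiff ℝ ∞ f ∧
    (∀ θ k, f (θ + latticeVec k) = f θ) ∧ f ≠ 0 ∧ ∀ θ, -flatLaplacian h f θ = l * f θ}

/-- The fundamental square `[0,1)²`. -/
def unitSquare : Set (Eu 2) := {θ | ∀ a, θ a ∈ Set.Ico (0 : ℝ) 1}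

/-! ## Fibrations by flat 2-tori and product reference metrics -/

section Fibration

variable {M : Type*} [TopologicalSpace M] [ChartedSpace (Eu 2) M] [IsManifold 𝓘(ℝ, Eu 2) ∞ M]
  {X : Type*} [TopologicalSpace X] [ChartedSpace (Eu 4) X]

/-- The differential of a map `M × ℝ² → X`. -/
def prodDeriv (Ψ : M × Eu 2 → X) (b : M) (θ : Eu 2) (ξ : Tan 2 b) (α : Eu 2) :
    Tan 4 (Ψ (b, θ)) :=
  mfderiv (𝓘(ℝ, Eu 2).prod 𝓘(ℝ, Eu 2)) 𝓘(ℝ, Eu 4) Ψ (b, θ)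
    ((ξ, α) : TangentSpace 𝓘(ℝ, Eu 2) b × Eu 2)

/-- Semi-flat coordinates near `b₀`: a local trivialization `U × ℝ²/ℤ² ≅ pr⁻¹(U)`, written as a
`ℤ²`-periodic smooth map `Ψ` on `U × ℝ²`, in which the reference metric `gRef` is
`g_B ⊕ ∑ h_ab(b) dθ^a dθ^b`: the horizontal and the vertical directions are those of the factors
`U` and `ℝ²/ℤ²`, and the metric on the fibre over `b` is flat, with constant matrix `h b`. -/
structure SemiflatChart (pr : X → M) (gB : Metric 2 M) (gRef : BilinField 4 X) (B₀ : Set M)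
    (b₀ : M) where
  U : Set M
  isOpen : IsOpen U
  mem : b₀ ∈ U
  subset : U ⊆ B₀
  Ψ : M × Eu 2 → X
  smooth : ContMDiffOn (𝓘(ℝ, Eu 2).prod 𝓘(ℝ, Eu 2)) 𝓘(ℝ, Eu 4) ∞ Ψ (U ×ˢ Set.univ)
  proj : ∀ b ∈ U, ∀ θ, pr (Ψ (b, θ)) = b
  surj : ∀ x, pr x ∈ U → ∃ θ, Ψ (pr x, θ) = x
  periodic : ∀ b ∈ U, ∀ θ θ', Ψ (b, θ) = Ψ (b, θ') ↔ ∃ k, θ' = θ + latticeVec k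
  h : M → Matrix (Fin 2) (Fin 2) ℝ
  smooth_h : ∀ a c, ContMDiffOn 𝓘(ℝ, Eu 2) 𝓘(ℝ, ℝ) ∞ (fun b => h b a c) U
  posDef_h : ∀ b ∈ U, (h b).PosDef
  metric : ∀ b ∈ U, ∀ (θ : Eu 2) (ξ η : Tan 2 b) (α β : Eu 2),
    gRef (Ψ (b, θ)) (prodDeriv Ψ b θ ξ α) (prodDeriv Ψ b θ η β)
      = gB.inner b ξ η + flatInner (h b) α β

/-- A product reference metric `gRef = g_B ⊕ g_F` on `pr⁻¹(B₀)`, where `g_F` is a family of flat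
metrics along the fibres of `pr` over `B₀`, which are 2-tori. -/
structure SemiflatReference (pr : X → M) (gB : Metric 2 M) (B₀ : Set M) where
  gRef : BilinField 4 X
  chart : ∀ b : B₀, SemiflatChart pr gB gRef B₀ (b : M)

namespace SemiflatReference

variable {pr : X → M} {gB : Metric 2 M} {B₀ : Set M} (R : SemiflatReference pr gB B₀)

/-- The flat metric of the fibre over `b ∈ B₀`, in linear coordinates identifying the fibre with
`ℝ²/ℤ²`. -/
def fiberMetric (b : B₀) : Matrix (Fin 2) (Fin 2) ℝ := (R.chart b).h b

open Classical in
/-- The area of the fibre over `b ∈ B₀` for the flat metric `g_F` (and `1` off `B₀`). -/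
def fiberArea (b : M) : ℝ := if hb : b ∈ B₀ then torusArea (R.fiberMetric ⟨b, hb⟩) else 1

open Classical in
/-- The Haar probability measure of the fibre over `b ∈ B₀`, as a measure on the total space
(and `0` off `B₀`). -/
def fiberHaar [MeasurableSpace X] (b : M) : Measure X :=
  if hb : b ∈ B₀ then
    Measure.map (fun θ => (R.chart ⟨b, hb⟩).Ψ (b, θ)) (volume.restrict unitSquare)
  else 0

end SemiflatReference

/-! ## Disintegration, normalized lift and fibre average -/

/-- The normalized disintegration
`∫_{X₀} f dμ = ∫_{B₀} A(b) (∫_{F_b} f ρ dϑ_b) dμ_B(b)` with `∫_{F_b} ρ dϑ_b = 1`, where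
`X₀ = pr⁻¹(B₀)`, with `A` and `ρ` measurable and positive. -/
structure IsNormalizedDisintegration [MeasurableSpace M] [MeasurableSpace X]
    (pr : X → M) (B₀ : Set M) (μ : Measure X) (μB : Measure M) (ϑ : M → Measure X)
    (A : M → ℝ) (ρ : X → ℝ) : Prop where
  measurable_A : Measurable A
  measurable_ρ : Measurable ρ
  pos_A : ∀ b ∈ B₀, 0 < A b
  pos_ρ : ∀ x, pr x ∈ B₀ → 0 < ρ x
  normalized : ∀ b ∈ B₀, ∫⁻ x, ENNReal.ofReal (ρ x) ∂(ϑ b) = 1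
  disintegration : ∀ f : X → ℝ≥0∞, Measurable f →
    ∫⁻ x in pr ⁻¹' B₀, f x ∂μ
      = ∫⁻ b in B₀, ENNReal.ofReal (A b) * ∫⁻ x, f x * ENNReal.ofReal (ρ x) ∂(ϑ b) ∂μB

/-- The normalized lift `(I v)(x) = A(pr x)^{-1/2} v(pr x)`. -/
def lift (pr : X → M) (A : M → ℝ) (v : M → ℝ) (x : X) : ℝ :=
  (Real.sqrt (A (pr x)))⁻¹ * v (pr x)

/-- The normalized fibre average `(P u)(b) = A(b)^{1/2} ∫_{F_b} u ρ dϑ_b`. -/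
def average [MeasurableSpace X] (ϑ : M → Measure X) (A : M → ℝ) (ρ : X → ℝ) (u : X → ℝ)
    (b : M) : ℝ :=
  Real.sqrt (A b) * ∫ x, u x * ρ x ∂(ϑ b)

end Fibration

/-! ## The regular locus and the limit `t ↓ 0` -/

/-- `B_reg = B ∖ D`, as an open subset of `B`. -/
def regularLocus {B : Type*} [TopologicalSpace B] [T1Space B] (D : Finset B) :
    TopologicalSpace.Opens B :=
  ⟨(D : Set B)ᶜ, D.finite_toSet.isClosed.isOpen_compl⟩

/-- The filter `t ↓ 0` on the parameter interval `(0, t₀]`. -/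
def downToZero (t₀ : ℝ) : Filter (Set.Ioc (0 : ℝ) t₀) :=
  Filter.comap (fun t => (t : ℝ)) (𝓝[>] 0)

end Collapse

end

set_option linter.unusedSectionVars false
noncomputable section

/-! The average `P_t` and the lift `I_t` carry test functions to test functions, and on test
functions the energies on the base and on the total space can be compared for each fixed `t`, with
errors of order `ε t`. Everything else is disintegration of measures and lower semicontinuity of the
Dirichlet form.

Let `J` (`density`) be the density of the Riemannian measure with respect to the base measure and
the Haar measures of the fibres: the volume ratio of the metric to the reference metric, times the
area of the fibre. Let `m` (`fiberMass`) be the integral of `J` over the fibre. Then `A = m` and `ρ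
= J / m` give a normalized disintegration, and any other choice agrees with it almost everywhere
(`ae_eq_of_isNormalizedDisintegration`). Nearness in `C¹` controls the logarithmic derivative of the
volume ratio: by Jacobi's formula it is half the trace of the inverse metric against the covariant
derivative of the difference (`abs_fderiv_sqrt_det_ratio_le`). With the assumption on the areas, `|d
log J| ≤ logError` in horizontal directions, and `logError` is `O(ε)`.

Differentiating `m^(-1/2) ∫ w J` under the integral sign bounds its differential by `m^(-1/2) ∫
(√(1+ε) |∇w| + δ |w|) J`, where `δ` is three halves of `logError`. Cauchy-Schwarz on the fibre turns
this into `E_B[P w] ≤ (1+δ)(1+ε) E[w] + (δ+δ²) ‖w‖²` (`smoothEnergy_stdAverage_le`). In the other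
direction the projection is a Riemannian submersion for the reference metric, which gives the
analogous bound for lifts (`smoothEnergy_lift_le`).

A function that is an `L²` limit of test functions of bounded energy lies in `H¹₀`, with the
expected bound on its form (`mem_H10_and_dirichletForm_le`). For the liminf inequality the
approximant of `v` is `P_t w`, for a single small `t` with `E_t[u_t]` close to the lower limit and a
single test function `w` close to `u_t`; it is close to `v` because `P_t` is an `L²` contraction.
For the recovery part, test functions approximating `v` are lifted, and `I_t` is an `L²` isometry.
-/

namespace Collapse

/-! ### Metrics in local parametrizations: coordinate matrices, determinants, regularity. -/

section ManifoldBasics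

variable {n : ℕ} {X : Type*} [TopologicalSpace X] [ChartedSpace (Eu n) X]

/-- The differential of a map from `ℝⁿ`, read as an endomorphism of the model space. -/
def modelDeriv (F : Eu n → X) (y : Eu n) : Eu n →L[ℝ] Eu n :=
  mfderiv 𝓘(ℝ, Eu n) 𝓘(ℝ, Eu n) F y

/-- A bilinear form on a tangent space, read on the model space. -/
def modelForm (T : BilinField n X) (x : X) : Eu n →L[ℝ] Eu n →L[ℝ] ℝ := T x

/-- The matrix of a bilinear form in the standard basis of the tangent space. -/
def stdMatrix (T : BilinField n X) (x : X) : Matrix (Fin n) (Fin n) ℝ :=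
  Matrix.of fun i j => modelForm T x (basisVec i) (basisVec j)

theorem sum_smul_basisVec (v : Eu n) : ∑ i, v i • (basisVec i : Eu n) = v := by
  have h := (EuclideanSpace.basisFun (Fin n) ℝ).sum_repr v
  simpa [basisVec] using h

/-- The Jacobian matrix of a map from `ℝⁿ`, in the standard bases. -/
def jacobianMatrix (F : Eu n → X) (y : Eu n) : Matrix (Fin n) (Fin n) ℝ :=
  Matrix.of fun k i => modelDeriv F y (basisVec i) k

theorem det_jacobianMatrix (F : Eu n → X) (y : Eu n) :
    (jacobianMatrix F y).det = (modelDeriv F y).det := by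
  rw [ContinuousLinearMap.det,
    ← LinearMap.det_toMatrix (EuclideanSpace.basisFun (Fin n) ℝ).toBasis]
  rfl

theorem bilin_sum (T : Eu n →L[ℝ] Eu n →L[ℝ] ℝ) (a b : Fin n → ℝ) (u : Fin n → Eu n) :
    T (∑ i, a i • u i) (∑ j, b j • u j) = ∑ i, ∑ j, a i * b j * T (u i) (u j) := by
  simp only [map_sum, map_smul, sum_apply, smul_apply, smul_eq_mul, Finset.mul_sum]
  rw [Finset.sum_comm]
  exact Finset.sum_congr rfl fun i _ => Finset.sum_congr rfl fun j _ => by ring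

theorem bilin_eq_sum (T : Eu n →L[ℝ] Eu n →L[ℝ] ℝ) (v w : Eu n) :
    T v w = ∑ i, ∑ j, v i * w j * T (basisVec i) (basisVec j) := by
  conv_lhs => rw [← sum_smul_basisVec v, ← sum_smul_basisVec w]
  exact bilin_sum T _ _ _

theorem modelDeriv_eq_sum (F : Eu n → X) (y e : Eu n) :
    modelDeriv F y e = ∑ i, e i • modelDeriv F y (basisVec i) := by
  conv_lhs => rw [← sum_smul_basisVec e]
  simp only [map_sum, map_smul]

theorem coordMatrix_apply (T : BilinField n X) (F : Eu n → X) (y : Eu n) (i j : Fin n) :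
    coordMatrix T F y i j =
      modelForm T (F y) (modelDeriv F y (basisVec i)) (modelDeriv F y (basisVec j)) := rfl

theorem modelForm_modelDeriv (T : BilinField n X) (F : Eu n → X) (y v w : Eu n) :
    modelForm T (F y) (modelDeriv F y v) (modelDeriv F y w) =
      ∑ i, ∑ j, v i * w j * coordMatrix T F y i j := by
  rw [modelDeriv_eq_sum F y v, modelDeriv_eq_sum F y w, bilin_sum]
  rfl

theorem coordMatrix_eq_mul (T : BilinField n X) (F : Eu n → X) (y : Eu n) :
    coordMatrix T F y =
      (jacobianMatrix F y).transpose * stdMatrix T (F y) * jacobianMatrix F y := by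
  ext i j
  rw [coordMatrix_apply, bilin_eq_sum]
  simp only [Matrix.mul_apply, Finset.sum_mul, Matrix.transpose_apply, jacobianMatrix, stdMatrix,
    Matrix.of_apply]
  rw [Finset.sum_comm]
  exact Finset.sum_congr rfl fun i _ => Finset.sum_congr rfl fun j _ => by ring

/-- The coordinate matrix is a congruence by the Jacobian matrix, so the parametrization enters only
through the squared Jacobian determinant. Both the change of variables formula and the independence
of `volRatio` from coordinates rest on this. -/
theorem det_coordMatrix (T : BilinField n X) (F : Eu n → X) (y : Eu n) :
    (coordMatrix T F y).det = (modelDeriv F y).det ^ 2 * (stdMatrix T (F y)).det := by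
  rw [coordMatrix_eq_mul, Matrix.det_mul, Matrix.det_mul, Matrix.det_transpose, det_jacobianMatrix]
  ring

theorem differential_comp_param {φ : X → ℝ} {F : Eu n → X} {y : Eu n}
    (hφ : MDifferentiableAt 𝓘(ℝ, Eu n) 𝓘(ℝ, ℝ) φ (F y))
    (hF : MDifferentiableAt 𝓘(ℝ, Eu n) 𝓘(ℝ, Eu n) F y) (e : Eu n) :
    fderiv ℝ (φ ∘ F) y e = differential φ (F y) (mfderiv 𝓘(ℝ, Eu n) 𝓘(ℝ, Eu n) F y e) := by
  rw [← mfderiv_eq_fderiv, mfderiv_comp y hφ hF]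
  rfl

variable [IsManifold 𝓘(ℝ, Eu n) ∞ X]

theorem isLocalParam_chart (x : X) :
    IsLocalParam (chartAt (Eu n) x).symm (chartAt (Eu n) x).target := by
  refine ⟨(chartAt (Eu n) x).open_target, contMDiffOn_chart_symm, fun y hy => ?_⟩
  exact (mdifferentiable_chart (I := 𝓘(ℝ, Eu n)) x).symm.mfderiv_injective hy

theorem IsLocalParam.mdifferentiableAt {F : Eu n → X} {V : Set (Eu n)} (hF : IsLocalParam F V)
    {y : Eu n} (hy : y ∈ V) : MDifferentiableAt 𝓘(ℝ, Eu n) 𝓘(ℝ, Eu n) F y :=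
  ((hF.smooth y hy).contMDiffAt (hF.isOpen.mem_nhds hy)).mdifferentiableAt (by simp)

/-- The coordinate vectors are the tangent map of `F` applied to constant sections, hence smooth
sections along `F`; an entry of the matrix is the metric paired with two of them. -/
theorem contDiffOn_coordMatrix (g : Metric n X) {F : Eu n → X} {V : Set (Eu n)} (hV : IsOpen V)
    (hF : ContMDiffOn 𝓘(ℝ, Eu n) 𝓘(ℝ, Eu n) ∞ F V) (i j : Fin n) :
    ContDiffOn ℝ ∞ (fun y => coordMatrix g.inner F y i j) V := by
  have hsec : ∀ i : Fin n, ContMDiffOn 𝓘(ℝ, Eu n) (𝓘(ℝ, Eu n).prod 𝓘(ℝ, Eu n)) ∞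
      (fun y => TotalSpace.mk' (Eu n) (E := fun x : X => Tan n x) (F y) (coordVec F y i)) V := by
    intro i
    have h0 : ContMDiff 𝓘(ℝ, Eu n) (𝓘(ℝ, Eu n).prod 𝓘(ℝ, Eu n)) ∞
        (fun y : Eu n => (⟨y, basisVec i⟩ : TangentBundle 𝓘(ℝ, Eu n) (Eu n))) := by
      intro y
      exact contMDiffAt_vectorSpace_iff_contDiffAt.2 contDiffAt_const
    have h1 := (hF.contMDiffOn_tangentMapWithin (m := ∞) (by simp) hV.uniqueMDiffOn).comp
      (s := V) h0.contMDiffOn (fun y hy => hy)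
    refine h1.congr fun y hy => ?_
    simp only [Function.comp, tangentMapWithin, mfderivWithin_of_isOpen hV hy]
    rfl
  have hg : ContMDiffOn 𝓘(ℝ, Eu n) (𝓘(ℝ, Eu n).prod 𝓘(ℝ, Eu n →L[ℝ] Eu n →L[ℝ] ℝ)) ∞
      (fun y => TotalSpace.mk' (Eu n →L[ℝ] Eu n →L[ℝ] ℝ)
        (E := fun x : X => Tan n x →L[ℝ] Tan n x →L[ℝ] ℝ) (F y) (g.inner (F y))) V :=
    g.contMDiff.comp_contMDiffOn hF
  have h := ContMDiffOn.clm_bundle_apply₂ (F₃ := ℝ) (E₃ := Bundle.Trivial X ℝ)  hg (hsec i) (hsec j)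
  have h2 : ContMDiffOn 𝓘(ℝ, Eu n) 𝓘(ℝ, ℝ) ∞ (fun y => coordMatrix g.inner F y i j) V := by
    intro y hy
    have := h y hy
    simp only [contMDiffWithinAt_totalSpace] at this
    exact this.2
  exact h2.contDiffOn

/-- The Riemannian volume density of a field of bilinear forms in the standard basis. -/
def volDensity (T : BilinField n X) (x : X) : ℝ := Real.sqrt (stdMatrix T x).det

theorem sqrt_det_coordMatrix (T : BilinField n X) (F : Eu n → X) (y : Eu n) :
    Real.sqrt (coordMatrix T F y).det = |(modelDeriv F y).det| * volDensity T (F y) := by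
  rw [det_coordMatrix, Real.sqrt_mul (sq_nonneg _), Real.sqrt_sq_eq_abs, volDensity]

theorem posDef_coordMatrix (T : BilinField n X) {F : Eu n → X} {y : Eu n}
    (hF : Function.Injective (mfderiv 𝓘(ℝ, Eu n) 𝓘(ℝ, Eu n) F y))
    (hsymm : ∀ v w, T (F y) v w = T (F y) w v)
    (hpos : ∀ v, v ≠ 0 → 0 < T (F y) v v) : (coordMatrix T F y).PosDef := by
  refine Matrix.PosDef.of_dotProduct_mulVec_pos ?_ fun z hz => ?_
  · ext i j
    exact hsymm _ _
  · have hv : modelDeriv F y (WithLp.toLp 2 z) ≠ 0 := by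
      intro h
      have h0 : (WithLp.toLp 2 z : Eu n) = 0 := hF (h.trans (map_zero (modelDeriv F y)).symm)
      exact hz (by simpa using congrArg WithLp.ofLp h0)
    have h1 : 0 < modelForm T (F y) _ _ := hpos _ hv
    have h2 := modelForm_modelDeriv T F y (WithLp.toLp 2 z) (WithLp.toLp 2 z)
    rw [h2] at h1
    simp only [dotProduct, Matrix.mulVec, Finset.mul_sum, Pi.star_apply, star_trivial]
    refine lt_of_lt_of_eq h1 ?_
    exact Finset.sum_congr rfl fun i _ => Finset.sum_congr rfl fun j _ => by ring

theorem IsLocalParam.posDef {F : Eu n → X} {V : Set (Eu n)} (hF : IsLocalParam F V)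
    (g : Metric n X) {y : Eu n} (hy : y ∈ V) : (coordMatrix g.inner F y).PosDef :=
  posDef_coordMatrix g.inner (hF.injective y hy) (g.symm _) (g.pos _)

theorem IsLocalParam.sqrt_det_pos {F : Eu n → X} {V : Set (Eu n)} (hF : IsLocalParam F V)
    (g : Metric n X) {y : Eu n} (hy : y ∈ V) :
    0 < Real.sqrt (coordMatrix g.inner F y).det :=
  Real.sqrt_pos.2 (hF.posDef g hy).det_pos

theorem contDiffOn_det {Y : Type*} [NormedAddCommGroup Y] [NormedSpace ℝ Y]
    {A : Y → Matrix (Fin n) (Fin n) ℝ} {V : Set Y} {m : ℕ∞ω}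
    (hA : ∀ i j, ContDiffOn ℝ m (fun y => A y i j) V) :
    ContDiffOn ℝ m (fun y => (A y).det) V := by
  simp only [Matrix.det_apply']
  refine ContDiffOn.sum fun σ _ => contDiffOn_const.mul ?_
  exact contDiffOn_prod fun i _ => hA _ _

theorem IsLocalParam.contDiffOn_sqrt_det {F : Eu n → X} {V : Set (Eu n)} (hF : IsLocalParam F V)
    (g : Metric n X) : ContDiffOn ℝ ∞ (fun y => Real.sqrt (coordMatrix g.inner F y).det) V := by
  intro y hy
  exact (contDiffOn_det (contDiffOn_coordMatrix g hF.isOpen hF.smooth) y hy).sqrt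
    (hF.posDef g hy).det_pos.ne'

/-! ### The gradient -/

theorem gradient_spec (g : Metric n X) (φ : X → ℝ) (x : X) (w : Tan n x) :
    g.inner x (gradient g φ x) w = differential φ x w :=
  (exists_riesz g x (differential φ x)).choose_spec w

theorem inner_self_nonneg' (g : Metric n X) (x : X) (v : Tan n x) : 0 ≤ g.inner x v v := by
  by_cases h : v = 0
  · subst h
    exact (by simp : g.inner x (0 : Tan n x) 0 = 0).ge
  · exact (g.pos x v h).le

theorem gradSq_nonneg (g : Metric n X) (φ : X → ℝ) (x : X) : 0 ≤ gradSq g φ x :=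
  inner_self_nonneg' g x _

theorem bilin_sq_le (T : Eu n →L[ℝ] Eu n →L[ℝ] ℝ) (hs : ∀ v w, T v w = T w v)
    (hp : ∀ v, 0 ≤ T v v) (v w : Eu n) : (T v w) ^ 2 ≤ T v v * T w w := by
  have h : ∀ t : ℝ, 0 ≤ T w w * (t * t) + (2 * T v w) * t + T v v := by
    intro t
    have := hp (v + t • w)
    simp only [map_add, map_smul, add_apply, smul_apply, smul_eq_mul, hs w v] at this
    linarith
  have := discrim_le_zero h
  unfold discrim at this
  nlinarith

theorem differential_sq_le (g : Metric n X) (φ : X → ℝ) (x : X) (w : Tan n x) :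
    (differential φ x w) ^ 2 ≤ gradSq g φ x * g.inner x w w := by
  rw [← gradient_spec g φ x w]
  exact bilin_sq_le (g.inner x) (g.symm x) (inner_self_nonneg' g x) (gradient g φ x) w

theorem abs_differential_le (g : Metric n X) (φ : X → ℝ) (x : X) (w : Tan n x) :
    |differential φ x w| ≤ Real.sqrt (gradSq g φ x) * Real.sqrt (g.inner x w w) := by
  rw [← Real.sqrt_mul (gradSq_nonneg g φ x)]
  exact Real.abs_le_sqrt (differential_sq_le g φ x w)

/-- Tested on the gradient itself, the hypothesis reads `|∇φ|² ≤ K |∇φ|`. Together with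
`abs_differential_le` this replaces gradients, which are chosen pointwise, by bounds on
differentials, the form in which the later estimates are proved. -/
theorem gradSq_le_sq (g : Metric n X) (φ : X → ℝ) (x : X) {K : ℝ}
    (h : ∀ w, |differential φ x w| ≤ K * Real.sqrt (g.inner x w w)) : gradSq g φ x ≤ K ^ 2 := by
  have h1 : gradSq g φ x ≤ K * Real.sqrt (gradSq g φ x) := by
    have h2 := h (gradient g φ x)
    rw [← gradient_spec g φ x] at h2
    exact (le_abs_self _).trans h2
  have h3 := Real.sq_sqrt (gradSq_nonneg g φ x)
  have h4 := Real.sqrt_nonneg (gradSq g φ x)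
  by_cases h5 : Real.sqrt (gradSq g φ x) = 0
  · rw [h5] at h3
    nlinarith [sq_nonneg K]
  · have h6 : Real.sqrt (gradSq g φ x) ≤ K := by
      have : 0 < Real.sqrt (gradSq g φ x) := lt_of_le_of_ne h4 (Ne.symm h5)
      nlinarith
    rw [← h3]
    exact pow_le_pow_left₀ h4 h6 2

/-- The components `e` of the gradient in the coordinate frame solve `G e = dφ`, and `|∇φ|² =
dφ(∇φ)`. The formula makes the continuity of `gradSq` visible, which its definition by choice does
not. -/
theorem gradSq_param (g : Metric n X) {φ : X → ℝ} {F : Eu n → X} {V : Set (Eu n)}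
    (hF : IsLocalParam F V) (hφ : ContMDiff 𝓘(ℝ, Eu n) 𝓘(ℝ, ℝ) ∞ φ) {y : Eu n} (hy : y ∈ V) :
    gradSq g φ (F y) = ∑ i, ∑ j, (coordMatrix g.inner F y)⁻¹ i j *
      fderiv ℝ (φ ∘ F) y (basisVec i) * fderiv ℝ (φ ∘ F) y (basisVec j) := by
  have hinj : Function.Injective (modelDeriv F y) := hF.injective y hy
  have hsurj : Function.Surjective (modelDeriv F y) :=
    (LinearMap.injective_iff_surjective (f := (modelDeriv F y).toLinearMap)).1 hinj
  obtain ⟨e, he⟩ := hsurj (gradient g φ (F y))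
  set G := coordMatrix g.inner F y with hG
  have hd : ∀ w : Eu n, fderiv ℝ (φ ∘ F) y w = differential φ (F y) (modelDeriv F y w) := fun w =>
    differential_comp_param (hφ.mdifferentiableAt (by simp)) (hF.mdifferentiableAt hy) w
  have h1 : ∀ j, fderiv ℝ (φ ∘ F) y (basisVec j) = (G.mulVec e.ofLp) j := by
    intro j
    rw [hd]
    refine (gradient_spec g φ (F y) _).symm.trans ?_
    have h2 : modelForm g.inner (F y) (modelDeriv F y e)
        (modelDeriv F y (basisVec j)) = (G.mulVec e.ofLp) j := by
      rw [modelDeriv_eq_sum F y e]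
      simp only [map_sum, map_smul, sum_apply, smul_apply, smul_eq_mul, Matrix.mulVec, dotProduct]
      refine Finset.sum_congr rfl fun i _ => ?_
      have : G j i = modelForm g.inner (F y)
        (modelDeriv F y (basisVec i)) (modelDeriv F y (basisVec j)) := g.symm _ _ _
      rw [this]
      ring
    rw [he] at h2
    exact h2
  have hdet : IsUnit G.det := (hF.posDef g hy).det_pos.ne'.isUnit
  have h3 : G⁻¹.mulVec (fun j => fderiv ℝ (φ ∘ F) y (basisVec j)) = e.ofLp := by
    have : (fun j => fderiv ℝ (φ ∘ F) y (basisVec j)) = G.mulVec e.ofLp := funext h1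
    rw [this, Matrix.mulVec_mulVec, Matrix.nonsing_inv_mul _ hdet, Matrix.one_mulVec]
  have h4 : gradSq g φ (F y) = ∑ i, e i * fderiv ℝ (φ ∘ F) y (basisVec i) := by
    refine (gradient_spec g φ (F y) (gradient g φ (F y))).trans ?_
    have h5 : differential φ (F y) (gradient g φ (F y)) = fderiv ℝ (φ ∘ F) y e := by
      rw [hd, he]
    rw [h5]
    conv_lhs => rw [← sum_smul_basisVec e]
    simp only [map_sum, map_smul, smul_eq_mul]
  rw [h4]
  refine Finset.sum_congr rfl fun i _ => ?_
  rw [← congrFun h3 i]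
  simp only [Matrix.mulVec, dotProduct, Finset.sum_mul]
  exact Finset.sum_congr rfl fun j _ => by ring

theorem continuous_gradSq (g : Metric n X) {φ : X → ℝ} (hφ : ContMDiff 𝓘(ℝ, Eu n) 𝓘(ℝ, ℝ) ∞ φ) :
    Continuous (gradSq g φ) := by
  rw [continuous_iff_continuousAt]
  intro x
  set c := chartAt (Eu n) x with hc
  have hF : IsLocalParam c.symm c.target := isLocalParam_chart x
  have hφF : ContDiffOn ℝ ∞ (φ ∘ c.symm) c.target :=
    (hφ.comp_contMDiffOn hF.smooth).contDiffOn
  have hcont : ContinuousOn (fun y => ∑ i, ∑ j, (coordMatrix g.inner c.symm y)⁻¹ i j *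
      fderiv ℝ (φ ∘ c.symm) y (basisVec i) * fderiv ℝ (φ ∘ c.symm) y (basisVec j)) c.target := by
    have hd : ∀ e : Eu n, ContinuousOn (fun y => fderiv ℝ (φ ∘ c.symm) y e) c.target := fun e =>
      (hφF.continuousOn_fderiv_of_isOpen hF.isOpen (by simp)).clm_apply continuousOn_const
    have hG : ContinuousOn (fun y => coordMatrix g.inner c.symm y) c.target := by
      refine continuousOn_pi.2 fun i => continuousOn_pi.2 fun j => ?_
      exact (contDiffOn_coordMatrix g hF.isOpen hF.smooth i j).continuousOn
    have hGi : ∀ i j, ContinuousOn (fun y => (coordMatrix g.inner c.symm y)⁻¹ i j) c.target := by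
      intro i j y hy
      have hdet := (hF.posDef g hy).det_pos.ne'
      have : ContinuousWithinAt (fun y => (coordMatrix g.inner c.symm y)⁻¹) c.target y := by
        refine ContinuousAt.comp_continuousWithinAt (g := fun A : Matrix (Fin n) (Fin n) ℝ => A⁻¹)
          ?_ (hG y hy)
        refine continuousAt_matrix_inv _ ?_
        simp only [Ring.inverse_eq_inv']
        exact continuousAt_inv₀ hdet
      exact (continuousWithinAt_pi.1 ((continuousWithinAt_pi.1 this) i)) j
    exact continuousOn_finsetSum _ fun i _ => continuousOn_finsetSum _ fun j _ =>
      ((hGi i j).mul (hd _)).mul (hd _)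
  have hx : x ∈ c.source := mem_chart_source _ x
  have h2 : ContinuousAt ((fun y => ∑ i, ∑ j, (coordMatrix g.inner c.symm y)⁻¹ i j *
      fderiv ℝ (φ ∘ c.symm) y (basisVec i) * fderiv ℝ (φ ∘ c.symm) y (basisVec j)) ∘ c) x :=
    ContinuousAt.comp (hcont.continuousAt (hF.isOpen.mem_nhds (c.map_source hx)))
      (c.continuousAt hx)
  refine h2.congr ?_
  filter_upwards [c.open_source.mem_nhds hx] with z hz
  have := gradSq_param g hF hφ (c.map_source hz)
  rw [c.left_inv hz] at this
  exact this.symm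

end ManifoldBasics

/-! ### The Riemannian measure in arbitrary local parametrizations. -/

section ChangeOfVariables

variable {n : ℕ} {X : Type*} [TopologicalSpace X] [ChartedSpace (Eu n) X]
  [IsManifold 𝓘(ℝ, Eu n) ∞ X]

theorem IsLocalParam.contDiffAt_chart {F : Eu n → X} {V : Set (Eu n)} (hF : IsLocalParam F V)
    (x : X) {y : Eu n} (hy : y ∈ V) (hx : F y ∈ (chartAt (Eu n) x).source) :
    ContDiffAt ℝ ∞ (chartAt (Eu n) x ∘ F) y := by
  have h1 : ContMDiffAt 𝓘(ℝ, Eu n) 𝓘(ℝ, Eu n) ∞ (chartAt (Eu n) x) (F y) :=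
    (contMDiffOn_chart (I := 𝓘(ℝ, Eu n)) (n := ∞) (x := x)).contMDiffAt
      ((chartAt (Eu n) x).open_source.mem_nhds hx)
  have h2 := (hF.smooth y hy).contMDiffAt (hF.isOpen.mem_nhds hy)
  exact (h1.comp y h2).contDiffAt

theorem IsLocalParam.modelDeriv_eq_comp {F : Eu n → X} {V : Set (Eu n)} (hF : IsLocalParam F V)
    (x : X) {y : Eu n} (hy : y ∈ V) (hx : F y ∈ (chartAt (Eu n) x).source) :
    modelDeriv F y = (modelDeriv (chartAt (Eu n) x).symm (chartAt (Eu n) x (F y))).comp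
      (fderiv ℝ (chartAt (Eu n) x ∘ F) y) := by
  set c := chartAt (Eu n) x
  have h1 : F =ᶠ[𝓝 y] c.symm ∘ (c ∘ F) := by
    have : ∀ᶠ z in 𝓝 y, F z ∈ c.source :=
      (hF.mdifferentiableAt hy).continuousAt.eventually (c.open_source.mem_nhds hx)
    filter_upwards [this] with z hz
    exact (c.left_inv hz).symm
  have h2 : mfderiv 𝓘(ℝ, Eu n) 𝓘(ℝ, Eu n) F y =
      mfderiv 𝓘(ℝ, Eu n) 𝓘(ℝ, Eu n) (c.symm ∘ (c ∘ F)) y := h1.mfderiv_eq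
  have h3 := mfderiv_comp (I := 𝓘(ℝ, Eu n)) (I' := 𝓘(ℝ, Eu n)) (I'' := 𝓘(ℝ, Eu n)) y
    (g := c.symm) (f := c ∘ F)
    ((isLocalParam_chart x).mdifferentiableAt (c.map_source hx))
    ((hF.contDiffAt_chart x hy hx).differentiableAt (by simp)).mdifferentiableAt
  rw [mfderiv_eq_fderiv] at h3
  exact h2.trans h3

theorem IsLocalParam.bijective_fderiv_chart {F : Eu n → X} {V : Set (Eu n)}
    (hF : IsLocalParam F V)
    (x : X) {y : Eu n} (hy : y ∈ V) (hx : F y ∈ (chartAt (Eu n) x).source) :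
    Function.Bijective (fderiv ℝ (chartAt (Eu n) x ∘ F) y) := by
  have h : Function.Injective (modelDeriv F y) := hF.injective y hy
  rw [hF.modelDeriv_eq_comp x hy hx] at h
  have h1 : Function.Injective (fderiv ℝ (chartAt (Eu n) x ∘ F) y) :=
    Function.Injective.of_comp (f := modelDeriv (chartAt (Eu n) x).symm (chartAt (Eu n) x (F y))) h
  exact ⟨h1, (LinearMap.injective_iff_surjective
    (f := (fderiv ℝ (chartAt (Eu n) x ∘ F) y).toLinearMap)).1 h1⟩

/-- In a chart the differential of `F` is surjective, so `F` is open at `y` by the inverse function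
theorem. Continuity on the manifold can therefore be tested after composition with `F`. -/
theorem IsLocalParam.map_nhds_eq {F : Eu n → X} {V : Set (Eu n)} (hF : IsLocalParam F V)
    {y : Eu n} (hy : y ∈ V) : map F (𝓝 y) = 𝓝 (F y) := by
  set c := chartAt (Eu n) (F y) with hc
  have hx : F y ∈ c.source := mem_chart_source _ _
  have h1 := (hF.contDiffAt_chart (F y) hy hx).hasStrictFDerivAt (by simp)
  have h2 := h1.map_nhds_eq_of_surj
    (LinearMap.range_eq_top.2 (hF.bijective_fderiv_chart (F y) hy hx).2)
  have h3 : map F (𝓝 y) = map c.symm (map (c ∘ F) (𝓝 y)) := by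
    rw [map_map]
    refine map_congr ?_
    have : ∀ᶠ z in 𝓝 y, F z ∈ c.source :=
      (hF.mdifferentiableAt hy).continuousAt.eventually (c.open_source.mem_nhds hx)
    filter_upwards [this] with z hz
    exact (c.left_inv hz).symm
  rw [h3, h2]
  exact c.symm_map_nhds_eq hx

theorem IsLocalParam.continuousAt_iff {Y : Type*} [TopologicalSpace Y] {F : Eu n → X}
    {V : Set (Eu n)} (hF : IsLocalParam F V) {y : Eu n} (hy : y ∈ V) {q : X → Y} :
    ContinuousAt q (F y) ↔ ContinuousAt (q ∘ F) y := by
  unfold ContinuousAt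
  rw [← hF.map_nhds_eq hy, tendsto_map'_iff]
  rfl

theorem IsLocalParam.sqrt_det_eq {F : Eu n → X} {V : Set (Eu n)} (hF : IsLocalParam F V)
    (T : BilinField n X) (x : X) {y : Eu n} (hy : y ∈ V)
    (hx : F y ∈ (chartAt (Eu n) x).source) :
    Real.sqrt (coordMatrix T F y).det = |(fderiv ℝ (chartAt (Eu n) x ∘ F) y).det| *
      Real.sqrt (coordMatrix T (chartAt (Eu n) x).symm (chartAt (Eu n) x (F y))).det := by
  have h1 : (modelDeriv F y).det = (modelDeriv (chartAt (Eu n) x).symm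
      (chartAt (Eu n) x (F y))).det * (fderiv ℝ (chartAt (Eu n) x ∘ F) y).det := by
    rw [hF.modelDeriv_eq_comp x hy hx]
    exact LinearMap.det_comp _ _
  rw [sqrt_det_coordMatrix, sqrt_det_coordMatrix, h1, abs_mul, (chartAt (Eu n) x).left_inv hx]
  ring

theorem continuousOn_sqrt_det_chart (g : Metric n X) (x : X) :
    ContinuousOn (fun y => Real.sqrt (coordMatrix g.inner (chartAt (Eu n) x).symm y).det)
      (chartAt (Eu n) x).target :=
  ((isLocalParam_chart x).contDiffOn_sqrt_det g).continuousOn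

variable [T2Space X] [SecondCountableTopology X] [MeasurableSpace X] [BorelSpace X]

theorem IsLocalParam.measurableSet_image {F : Eu n → X} {V : Set (Eu n)} (hF : IsLocalParam F V)
    {S : Set (Eu n)} (hS : MeasurableSet S) (hSV : S ⊆ V) (hinj : InjOn F S) :
    MeasurableSet (F '' S) :=
  hS.image_of_continuousOn_injOn (hF.smooth.continuousOn.mono hSV) hinj

theorem aemeasurable_chart_symm (x : X) : AEMeasurable (chartAt (Eu n) x).symm
    (volume.restrict (chartAt (Eu n) x).target) :=
  (chartAt (Eu n) x).continuousOn_symm.aemeasurable (chartAt (Eu n) x).open_target.measurableSet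

theorem lintegral_chartMeasure (g : Metric n X) (x : X) {f : X → ℝ≥0∞} (hf : Measurable f) :
    ∫⁻ z, f z ∂(chartMeasure g x) = ∫⁻ y in (chartAt (Eu n) x).target,
      f ((chartAt (Eu n) x).symm y) * ENNReal.ofReal
        (Real.sqrt (coordMatrix g.inner (chartAt (Eu n) x).symm y).det) := by
  have hd : AEMeasurable (fun y => ENNReal.ofReal
      (Real.sqrt (coordMatrix g.inner (chartAt (Eu n) x).symm y).det))
      (volume.restrict (chartAt (Eu n) x).target) :=
    ((continuousOn_sqrt_det_chart g x).aemeasurable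
      (chartAt (Eu n) x).open_target.measurableSet).ennreal_ofReal
  have hc := aemeasurable_chart_symm (n := n) x
  rw [chartMeasure, lintegral_map' hf.aemeasurable
    (hc.mono_ac (withDensity_absolutelyContinuous _ _))]
  refine (lintegral_withDensity_eq_lintegral_mul₀ hd (hf.comp_aemeasurable hc)).trans ?_
  exact lintegral_congr fun y => mul_comm _ _

/-- This is the Euclidean change of variables for the transition map from `F` to the chart; its
Jacobian is the factor by which the two square roots of determinants differ (`sqrt_det_eq`). -/
theorem IsLocalParam.setLIntegral_chartMeasure {F : Eu n → X} {V : Set (Eu n)}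
    (hF : IsLocalParam F V) (g : Metric n X) (x : X)
    {S : Set (Eu n)} (hS : MeasurableSet S) (hSV : S ⊆ V) (hinj : InjOn F S)
    (hSx : MapsTo F S (chartAt (Eu n) x).source) {f : X → ℝ≥0∞} (hf : Measurable f) :
    ∫⁻ z in F '' S, f z ∂(chartMeasure g x) = ∫⁻ y in S, f (F y) *
        ENNReal.ofReal (Real.sqrt (coordMatrix g.inner F y).det) := by
  set c := chartAt (Eu n) x with hc
  have hm := hF.measurableSet_image hS hSV hinj
  have hinj' : InjOn (c ∘ F) S := fun a ha b hb h => hinj ha hb (c.injOn (hSx ha) (hSx hb) h)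
  have himg : ∀ y ∈ c.target, c.symm y ∈ F '' S ↔ y ∈ (c ∘ F) '' S := by
    intro y hy
    constructor
    · rintro ⟨a, ha, h⟩
      exact ⟨a, ha, by simp [h, c.right_inv hy]⟩
    · rintro ⟨a, ha, rfl⟩
      exact ⟨a, ha, (c.left_inv (hSx ha)).symm⟩
  have hsub : (c ∘ F) '' S ⊆ c.target := by
    rintro _ ⟨a, ha, rfl⟩
    exact c.map_source (hSx ha)
  have hd : ∀ y ∈ S, HasFDerivWithinAt (c ∘ F) (fderiv ℝ (c ∘ F) y) S y := fun y hy =>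
    ((hF.contDiffAt_chart x (hSV hy) (hSx hy)).differentiableAt
      (by simp)).hasFDerivAt.hasFDerivWithinAt
  have hms : MeasurableSet ((c ∘ F) '' S) :=
    hS.image_of_continuousOn_injOn (fun y hy => (hd y hy).continuousWithinAt) hinj'
  rw [← lintegral_indicator hm, lintegral_chartMeasure g x (hf.indicator hm)]
  have h1 : ∫⁻ y in c.target, (F '' S).indicator f (c.symm y) *
      ENNReal.ofReal (Real.sqrt (coordMatrix g.inner c.symm y).det) =
      ∫⁻ y in (c ∘ F) '' S, f (c.symm y) *
        ENNReal.ofReal (Real.sqrt (coordMatrix g.inner c.symm y).det) := by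
    rw [← lintegral_indicator c.open_target.measurableSet, ← lintegral_indicator hms]
    refine lintegral_congr fun y => ?_
    by_cases hy : y ∈ c.target
    · rw [indicator_of_mem hy]
      by_cases h2 : y ∈ (c ∘ F) '' S
      · rw [indicator_of_mem h2, indicator_of_mem ((himg y hy).2 h2)]
      · rw [indicator_of_notMem h2, indicator_of_notMem (fun h => h2 ((himg y hy).1 h)), zero_mul]
    · rw [indicator_of_notMem hy, indicator_of_notMem fun h => hy (hsub h)]
  rw [h1, lintegral_image_eq_lintegral_abs_det_fderiv_mul volume hS hd hinj']
  refine setLIntegral_congr_fun hS fun y hy => ?_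
  rw [hF.sqrt_det_eq g.inner x (hSV hy) (hSx hy), ENNReal.ofReal_mul (abs_nonneg _)]
  simp only [Function.comp, c.left_inv (hSx hy)]
  ring

theorem chartMeasure_restrict_source (g : Metric n X) (x : X) :
    (chartMeasure g x).restrict (chartAt (Eu n) x).source = chartMeasure g x := by
  refine Measure.restrict_eq_self_of_ae_mem ?_
  have hm : MeasurableSet (chartAt (Eu n) x).sourceᶜ :=
    (chartAt (Eu n) x).open_source.measurableSet.compl
  rw [ae_iff]
  have h : chartMeasure g x (chartAt (Eu n) x).sourceᶜ = 0 := by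
    rw [← lintegral_indicator_one hm, lintegral_chartMeasure g x (measurable_one.indicator hm)]
    rw [setLIntegral_congr_fun (g := fun _ => 0) (chartAt (Eu n) x).open_target.measurableSet]
    · simp
    · intro y hy
      have : (chartAt (Eu n) x).symm y ∉ (chartAt (Eu n) x).sourceᶜ := fun h =>
        h ((chartAt (Eu n) x).map_target hy)
      simp [indicator_of_notMem this]
  exact h

theorem measurableSet_inter_preimage_of_continuousOn {Y : Type*} [TopologicalSpace Y]
    [MeasurableSpace Y] [BorelSpace Y] {Z : Type*} [TopologicalSpace Z]
    [MeasurableSpace Z] [BorelSpace Z] {F : Y → Z} {V : Set Y} (hV : MeasurableSet V)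
    (hF : ContinuousOn F V) {s : Set Z} (hs : MeasurableSet s) : MeasurableSet (V ∩ F ⁻¹' s) := by
  have h := (hF.domRestrict).measurable hs
  have h2 := MeasurableSet.subtype_image hV h
  convert h2 using 1
  ext y
  simp [and_comm]

theorem image_inter_preimage_chart_symm (x : X) {s : Set X} (hs : s ⊆ (chartAt (Eu n) x).source) :
    (chartAt (Eu n) x).symm '' ((chartAt (Eu n) x).target ∩ (chartAt (Eu n) x).symm ⁻¹' s) = s := by
  ext z
  constructor
  · rintro ⟨y, hy, rfl⟩
    exact hy.2
  · intro hz
    exact ⟨chartAt (Eu n) x z, ⟨(chartAt (Eu n) x).map_source (hs hz), by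
      simpa [(chartAt (Eu n) x).left_inv (hs hz)] using hz⟩, (chartAt (Eu n) x).left_inv (hs hz)⟩

/-- Both measures are computed in the same parametrization, the inverse chart at `x'`; the resulting
integral no longer mentions the chart that defined the measure. -/
theorem chartMeasure_restrict_inter (g : Metric n X) (x x' : X) :
    (chartMeasure g x).restrict ((chartAt (Eu n) x).source ∩ (chartAt (Eu n) x').source) =
    (chartMeasure g x').restrict ((chartAt (Eu n) x).source ∩ (chartAt (Eu n) x').source) := by
  set c := chartAt (Eu n) x
  set c' := chartAt (Eu n) x' with hc'
  ext s hs
  rw [Measure.restrict_apply hs, Measure.restrict_apply hs]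
  set I := s ∩ (c.source ∩ c'.source)
  have hI : MeasurableSet I :=
    hs.inter (c.open_source.measurableSet.inter c'.open_source.measurableSet)
  have hS : MeasurableSet (c'.target ∩ c'.symm ⁻¹' I) :=
    measurableSet_inter_preimage_of_continuousOn c'.open_target.measurableSet
      c'.continuousOn_symm hI
  have himg : c'.symm '' (c'.target ∩ c'.symm ⁻¹' I) = I :=
    image_inter_preimage_chart_symm x' (fun z hz => hz.2.2)
  have key : ∀ z : X, (∀ w ∈ I, w ∈ (chartAt (Eu n) z).source) → chartMeasure g z I =
      ∫⁻ y in c'.target ∩ c'.symm ⁻¹' I, 1 *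
        ENNReal.ofReal (Real.sqrt (coordMatrix g.inner c'.symm y).det) := by
    intro z hz
    have h := (isLocalParam_chart x').setLIntegral_chartMeasure g z hS inter_subset_left
      (c'.symm.injOn.mono inter_subset_left) (fun y hy => hz _ hy.2) measurable_one
    rw [← hc', himg] at h
    simpa using h
  rw [key x fun w hw => hw.2.1, key x' fun w hw => hw.2.2]

/-- A supremum of measures is not computed set by set, so the upper bound is obtained by exhibiting
a measure above every chart measure: the one at `x` plus the Riemannian measure off its domain `S`.
Restricting to `S` removes the second summand. -/
theorem riemannianMeasure_restrict_source (g : Metric n X) (x : X) :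
    (riemannianMeasure g).restrict (chartAt (Eu n) x).source = chartMeasure g x := by
  set S := (chartAt (Eu n) x).source with hS
  have hSm : MeasurableSet S := (chartAt (Eu n) x).open_source.measurableSet
  have hle : ∀ y, chartMeasure g y ≤ riemannianMeasure g := fun y => le_iSup (chartMeasure g) y
  refine le_antisymm ?_ ?_
  · have h1 : riemannianMeasure g ≤ chartMeasure g x + (riemannianMeasure g).restrict Sᶜ := by
      refine iSup_le fun y => ?_
      have h2 : (chartMeasure g y).restrict S ≤ chartMeasure g x := by
        have h3 : (chartMeasure g y).restrict S =
            (chartMeasure g y).restrict (S ∩ (chartAt (Eu n) y).source) := by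
          conv_lhs => rw [← chartMeasure_restrict_source g y]
          rw [Measure.restrict_restrict hSm]
        rw [h3, ← chartMeasure_restrict_inter g x y]
        exact Measure.restrict_le_self
      rw [← Measure.restrict_add_restrict_compl (μ := chartMeasure g y) hSm]
      exact add_le_add h2 (Measure.restrict_mono le_rfl (hle y))
    have h4 := Measure.restrict_mono (le_refl S) h1
    rw [Measure.restrict_add, Measure.restrict_restrict hSm, inter_compl_self,
      Measure.restrict_empty, add_zero, chartMeasure_restrict_source] at h4
    exact h4
  · have h5 := Measure.restrict_mono (le_refl S) (hle x)
    rwa [chartMeasure_restrict_source] at h5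

theorem exists_countable_chart_cover :
    ∃ s : Set X, s.Countable ∧ ⋃ x ∈ s, (chartAt (Eu n) x).source = univ :=
  TopologicalSpace.countable_cover_nhds fun x =>
    (chartAt (Eu n) x).open_source.mem_nhds (mem_chart_source _ x)

/-- The two measures are compared on the members of a countable cover by chart domains, where the
Riemannian measure is a chart measure. -/
theorem IsLocalParam.restrict_riemannianMeasure {F : Eu n → X} {V : Set (Eu n)}
    (hF : IsLocalParam F V) (g : Metric n X)
    {S : Set (Eu n)} (hS : MeasurableSet S) (hSV : S ⊆ V) (hinj : InjOn F S) :
    (riemannianMeasure g).restrict (F '' S) = Measure.map F ((volume.restrict S).withDensity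
      fun y => ENNReal.ofReal (Real.sqrt (coordMatrix g.inner F y).det)) := by
  have hFc : ContinuousOn F S := hF.smooth.continuousOn.mono hSV
  have hae : AEMeasurable F ((volume.restrict S).withDensity
      fun y => ENNReal.ofReal (Real.sqrt (coordMatrix g.inner F y).det)) :=
    (hFc.aemeasurable hS).mono_ac (withDensity_absolutelyContinuous _ _)
  obtain ⟨s, hsc, hs⟩ := exists_countable_chart_cover (n := n) (X := X)
  rw [Measure.ext_iff_of_biUnion_eq_univ hsc hs]
  intro x _
  set O := (chartAt (Eu n) x).source with hO
  have hOm : MeasurableSet O := (chartAt (Eu n) x).open_source.measurableSet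
  ext E hE
  have hEO : MeasurableSet (E ∩ O) := hE.inter hOm
  have hS' : MeasurableSet (S ∩ F ⁻¹' (E ∩ O)) :=
    measurableSet_inter_preimage_of_continuousOn hS hFc hEO
  rw [Measure.restrict_apply hE, Measure.restrict_apply hE, Measure.map_apply_of_aemeasurable hae hEO,
    Measure.restrict_apply hEO]
  have h1 : E ∩ O ∩ F '' S = F '' (S ∩ F ⁻¹' (E ∩ O)) := by
    rw [image_inter_preimage, inter_comm]
  have h2 := hF.setLIntegral_chartMeasure g x hS' (inter_subset_left.trans hSV)
    (hinj.mono inter_subset_left) (fun y hy => hy.2.2) measurable_one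
  rw [← h1] at h2
  have h3 : riemannianMeasure g (E ∩ O ∩ F '' S) = chartMeasure g x (E ∩ O ∩ F '' S) := by
    rw [← riemannianMeasure_restrict_source, Measure.restrict_apply
      (hEO.inter (hF.measurableSet_image hS hSV hinj))]
    congr 1
    ext z
    simp only [mem_inter_iff]
    tauto
  simp only [Pi.one_apply, lintegral_one, Measure.restrict_apply_univ, one_mul] at h2
  rw [h3, h2, withDensity_apply', Measure.restrict_restrict' hS, inter_comm]

/-- No measurability of `f` is required: on `S` the map `F` is a measurable embedding. This matters
because the formula is later applied to inner integrals over fibres, whose measurability in the base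
point is not known at that stage. -/
theorem IsLocalParam.setLIntegral_riemannianMeasure {F : Eu n → X} {V : Set (Eu n)}
    (hF : IsLocalParam F V) (g : Metric n X)
    {S : Set (Eu n)} (hS : MeasurableSet S) (hSV : S ⊆ V) (hinj : InjOn F S)
    (f : X → ℝ≥0∞) :
    ∫⁻ z in F '' S, f z ∂(riemannianMeasure g) = ∫⁻ y in S, f (F y) *
        ENNReal.ofReal (Real.sqrt (coordMatrix g.inner F y).det) := by
  have hFc : ContinuousOn F S := hF.smooth.continuousOn.mono hSV
  have hd : AEMeasurable (fun y => ENNReal.ofReal (Real.sqrt (coordMatrix g.inner F y).det))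
      (volume.restrict S) :=
    (((hF.contDiffOn_sqrt_det g).continuousOn.mono hSV).aemeasurable hS).ennreal_ofReal
  rw [hF.restrict_riemannianMeasure g hS hSV hinj]
  set ν := (volume.restrict S).withDensity
      fun y => ENNReal.ofReal (Real.sqrt (coordMatrix g.inner F y).det) with hν
  have hFν : AEMeasurable F ν := (hFc.aemeasurable hS).mono_ac (withDensity_absolutelyContinuous _ _)
  have hνS : ν.restrict S = ν := by
    rw [hν, restrict_withDensity hS, Measure.restrict_restrict hS, inter_self]
  have hval : Measure.map Subtype.val (Measure.comap (Subtype.val : S → Eu n) ν) = ν := by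
    rw [map_comap_subtype_coe hS, hνS]
  have hemb : MeasurableEmbedding (S.domRestrict F) :=
    hFc.measurableEmbedding hS hinj
  have hmap : Measure.map F ν =
      Measure.map (S.domRestrict F) (Measure.comap (Subtype.val : S → Eu n) ν) := by
    conv_lhs => rw [← hval]
    rw [AEMeasurable.map_map_of_aemeasurable (hval.symm ▸ hFν) measurable_subtype_coe.aemeasurable]
    rfl
  rw [hmap, hemb.lintegral_map]
  have h1 : ∫⁻ a, f (S.domRestrict F a) ∂(Measure.comap (Subtype.val : S → Eu n) ν) =
      ∫⁻ y, f (F y) ∂ν := by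
    conv_rhs => rw [← hval, (MeasurableEmbedding.subtype_coe hS).lintegral_map]
    rfl
  rw [h1]
  refine (lintegral_withDensity_eq_lintegral_mul_non_measurable₀ _ hd (by simp) _).trans ?_
  exact lintegral_congr fun y => mul_comm _ _

theorem riemannianMeasure_chart_image (g : Metric n X) (x : X) {S : Set (Eu n)}
    (hS : MeasurableSet S) (hSV : S ⊆ (chartAt (Eu n) x).target) :
    riemannianMeasure g ((chartAt (Eu n) x).symm '' S) = ∫⁻ y in S,
        ENNReal.ofReal (Real.sqrt (coordMatrix g.inner (chartAt (Eu n) x).symm y).det) := by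
  have h := (isLocalParam_chart x).setLIntegral_riemannianMeasure g hS hSV
    ((chartAt (Eu n) x).symm.injOn.mono hSV) 1
  simpa using h

theorem riemannianMeasure_lt_top_of_isCompact (g : Metric n X) {K : Set X} (hK : IsCompact K) :
    riemannianMeasure g K < ⊤ := by
  refine hK.measure_lt_top_of_nhdsWithin fun x _ => ?_
  set c := chartAt (Eu n) x with hc
  have hx : c x ∈ c.target := mem_chart_target _ x
  obtain ⟨r, hr, hball⟩ := Metric.nhds_basis_closedBall.mem_iff.1 (c.open_target.mem_nhds hx)
  have hcpt : IsCompact (Metric.closedBall (c x) r) := isCompact_closedBall _ _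
  refine ⟨c.symm '' Metric.closedBall (c x) r, mem_nhdsWithin_of_mem_nhds ?_, ?_⟩
  · have h := (isLocalParam_chart x).map_nhds_eq hx
    rw [← hc, c.left_inv (mem_chart_source _ x)] at h
    rw [← h]
    exact image_mem_map (Metric.closedBall_mem_nhds _ hr)
  · rw [riemannianMeasure_chart_image g x hcpt.measurableSet hball]
    obtain ⟨C, hC⟩ := (hcpt.image_of_continuousOn
      ((continuousOn_sqrt_det_chart g x).mono hball)).bddAbove
    calc _ ≤ ∫⁻ y in Metric.closedBall (c x) r, ENNReal.ofReal C :=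
          setLIntegral_mono' hcpt.measurableSet fun y hy =>
            ENNReal.ofReal_le_ofReal (hC (mem_image_of_mem _ hy))
      _ = ENNReal.ofReal C * volume (Metric.closedBall (c x) r) := setLIntegral_const _ _
      _ < ⊤ := ENNReal.mul_lt_top ENNReal.ofReal_lt_top hcpt.measure_lt_top

theorem isOpenPosMeasure_riemannianMeasure (g : Metric n X) :
    (riemannianMeasure g).IsOpenPosMeasure := by
  refine ⟨fun U hU hne hzero => ?_⟩
  obtain ⟨x, hx⟩ := hne
  set c := chartAt (Eu n) x with hc
  set S := c.target ∩ c.symm ⁻¹' U with hS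
  have hSo : IsOpen S := c.symm.isOpen_inter_preimage hU
  have hSne : S.Nonempty := ⟨c x, mem_chart_target _ x, by
    simpa [hc, (chartAt (Eu n) x).left_inv (mem_chart_source _ x)] using hx⟩
  have h1 := riemannianMeasure_chart_image g x hSo.measurableSet inter_subset_left
  have h2 : riemannianMeasure g (c.symm '' S) = 0 :=
    measure_mono_null (by rintro _ ⟨y, hy, rfl⟩; exact hy.2) hzero
  rw [← hc, h2, eq_comm, lintegral_eq_zero_iff'] at h1
  · have h3 : ∀ᵐ y ∂(volume.restrict S), False := by
      filter_upwards [h1, ae_restrict_mem hSo.measurableSet] with y hy hyS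
      have := (isLocalParam_chart x).sqrt_det_pos g hyS.1
      simp only [Pi.zero_apply, ENNReal.ofReal_eq_zero] at hy
      exact absurd hy (not_le.2 this)
    have h4 : volume S = 0 := by
      have := (ae_iff.1 h3)
      simpa using this
    exact (hSo.measure_pos volume hSne).ne' h4
  · exact (((continuousOn_sqrt_det_chart g x).mono inter_subset_left).aemeasurable
      hSo.measurableSet).ennreal_ofReal

end ChangeOfVariables

/-! ### Integrals over a fixed bounded set depending smoothly on a parameter. -/

section ParametricIntegral

universe u

variable {E F : Type u} {G : Type*} [NormedAddCommGroup E] [NormedSpace ℝ E]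
  [FiniteDimensional ℝ E] [NormedAddCommGroup G]
  [NormedSpace ℝ G] [FiniteDimensional ℝ G] [MeasurableSpace G] [BorelSpace G]
  [NormedAddCommGroup F] [NormedSpace ℝ F] [FiniteDimensional ℝ F]

theorem hasFDerivAt_setIntegral_param {μ : Measure G} [IsFiniteMeasureOnCompacts μ] {f : E × G → F}
    {V : Set E} (hV : IsOpen V) {Q : Set G} (hQ : MeasurableSet Q) (hQc : IsCompact (closure Q))
    (hf : ContDiffOn ℝ 1 f (V ×ˢ univ)) {y : E} (hy : y ∈ V) :
    HasFDerivAt (fun z => ∫ θ in Q, f (z, θ) ∂μ)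
      (∫ θ in Q, (fderiv ℝ f (y, θ)).comp (ContinuousLinearMap.inl ℝ E G) ∂μ) y := by
  obtain ⟨δ, hδ, hball⟩ := Metric.nhds_basis_closedBall.mem_iff.1 (hV.mem_nhds hy)
  have hVo : IsOpen (V ×ˢ (univ : Set G)) := hV.prod isOpen_univ
  have hfd : ContinuousOn (fderiv ℝ f) (V ×ˢ univ) := hf.continuousOn_fderiv_of_isOpen hVo le_rfl
  have hfd' : ContinuousOn (fun p => (fderiv ℝ f p).comp (ContinuousLinearMap.inl ℝ E G))
      (V ×ˢ univ) := hfd.clm_comp continuousOn_const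
  have hslice : ∀ z ∈ V, ContinuousOn (fun θ : G => (z, θ)) univ := fun z _ => by fun_prop
  have hmaps : ∀ z ∈ V, MapsTo (fun θ : G => (z, θ)) univ (V ×ˢ univ) := fun z hz θ _ => ⟨hz, trivial⟩
  have hfc : ∀ z ∈ V, Continuous (fun θ => f (z, θ)) := fun z hz =>
    continuousOn_univ.1 (hf.continuousOn.comp (hslice z hz) (hmaps z hz))
  have hfc' : Continuous (fun θ => (fderiv ℝ f (y, θ)).comp (ContinuousLinearMap.inl ℝ E G)) :=
    continuousOn_univ.1 (hfd'.comp (hslice y hy) (hmaps y hy))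
  have hcpt : IsCompact (Metric.closedBall y δ ×ˢ closure Q) :=
    (isCompact_closedBall y δ).prod hQc
  -- The partial derivative is bounded on the compact product of a closed ball and `closure Q`; the
  -- bound is the dominating function.
  obtain ⟨C, hC⟩ := (hcpt.image_of_continuousOn (hfd'.norm.mono
    (prod_mono hball (subset_univ _)))).bddAbove
  have hvol : μ Q ≠ ⊤ := ((measure_mono subset_closure).trans_lt hQc.measure_lt_top).ne
  refine hasFDerivAt_integral_of_dominated_of_fderiv_le (bound := fun _ => C)
    (F' := fun z θ => (fderiv ℝ f (z, θ)).comp (ContinuousLinearMap.inl ℝ E G))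
    (Metric.ball_mem_nhds y hδ) ?_ ?_ ?_ ?_ ?_ ?_
  · filter_upwards [hV.mem_nhds hy] with z hz
    exact (hfc z hz).aestronglyMeasurable
  · exact ((hfc y hy).continuousOn.integrableOn_compact hQc).mono_set subset_closure
  · exact hfc'.aestronglyMeasurable
  · filter_upwards [ae_restrict_mem hQ] with θ hθ z hz
    exact hC (mem_image_of_mem (fun p => ‖(fderiv ℝ f p).comp (ContinuousLinearMap.inl ℝ E G)‖)
      (mk_mem_prod (Metric.ball_subset_closedBall hz) (subset_closure hθ)))
  · exact integrableOn_const hvol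
  · filter_upwards with θ z hz
    have hz' : (z, θ) ∈ V ×ˢ (univ : Set G) := ⟨hball (Metric.ball_subset_closedBall hz), trivial⟩
    have h1 : HasFDerivAt f (fderiv ℝ f (z, θ)) (z, θ) :=
      ((hf.differentiableOn one_ne_zero).differentiableAt (hVo.mem_nhds hz')).hasFDerivAt
    exact h1.comp z (hasFDerivAt_prodMk_left z θ)

/-- Induction on the order: the derivative is a parametric integral of the same kind with values in
`E →L[ℝ] F`. The target has to vary in the induction, which is why `E` and `F` share a universe. -/
theorem contDiffOn_setIntegral_param {μ : Measure G} [IsFiniteMeasureOnCompacts μ] {f : E × G → F}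
    {V : Set E} (hV : IsOpen V) {Q : Set G} (hQ : MeasurableSet Q) (hQc : IsCompact (closure Q))
    (hf : ContDiffOn ℝ ∞ f (V ×ˢ univ)) :
    ContDiffOn ℝ ∞ (fun z => ∫ θ in Q, f (z, θ) ∂μ) V := by
  refine contDiffOn_infty.2 fun m => ?_
  induction m generalizing F with
  | zero =>
    refine contDiffOn_zero.2 fun y hy => ?_
    exact (hasFDerivAt_setIntegral_param hV hQ hQc (hf.of_le (by simp))
      hy).continuousAt.continuousWithinAt
  | succ m ih =>
    have hVo : IsOpen (V ×ˢ (univ : Set G)) := hV.prod isOpen_univ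
    have hd := fun y (hy : y ∈ V) => hasFDerivAt_setIntegral_param (μ := μ) hV hQ hQc
      (hf.of_le (by simp)) hy
    push_cast
    rw [contDiffOn_succ_iff_fderiv_of_isOpen hV]
    refine ⟨fun y hy => (hd y hy).differentiableAt.differentiableWithinAt, by simp, ?_⟩
    refine (ih (f := fun p => (fderiv ℝ f p).comp (ContinuousLinearMap.inl ℝ E G)) ?_).congr
      fun y hy => (hd y hy).fderiv
    exact (hf.fderiv_of_isOpen hVo (by simp)).clm_comp contDiffOn_const

theorem fderiv_setIntegral_param {μ : Measure G} [IsFiniteMeasureOnCompacts μ] {f : E × G → F}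
    {V : Set E} (hV : IsOpen V) {Q : Set G} (hQ : MeasurableSet Q) (hQc : IsCompact (closure Q))
    (hf : ContDiffOn ℝ ∞ f (V ×ˢ univ)) {y : E} (hy : y ∈ V) (e : E) :
    fderiv ℝ (fun z => ∫ θ in Q, f (z, θ) ∂μ) y e = ∫ θ in Q, fderiv ℝ f (y, θ) (e, 0) ∂μ := by
  have h := hasFDerivAt_setIntegral_param (μ := μ) hV hQ hQc (hf.of_le (by simp)) hy
  have hVo : IsOpen (V ×ˢ (univ : Set G)) := hV.prod isOpen_univ
  have hfd : ContinuousOn (fderiv ℝ f) (V ×ˢ univ) :=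
    hf.continuousOn_fderiv_of_isOpen hVo (by simp)
  have hfd' : ContinuousOn (fun p => (fderiv ℝ f p).comp (ContinuousLinearMap.inl ℝ E G))
      (V ×ˢ univ) := hfd.clm_comp continuousOn_const
  have hfc' : Continuous (fun θ => (fderiv ℝ f (y, θ)).comp (ContinuousLinearMap.inl ℝ E G)) :=
    continuousOn_univ.1 (hfd'.comp (by fun_prop : ContinuousOn (fun θ : G => (y, θ)) univ)
      fun θ _ => ⟨hy, trivial⟩)
  rw [h.fderiv, ContinuousLinearMap.integral_apply]
  · rfl
  · exact ((hfc'.continuousOn.integrableOn_compact hQc).mono_set subset_closure)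

end ParametricIntegral

/-! ### Jacobi's formula and the logarithmic derivative of a volume ratio. -/

section LinearAlgebra

variable {n : ℕ}

/-- In the Leibniz expansion a permutation other than the identity moves at least two indices, so
after one factor is differentiated an off-diagonal entry of the identity matrix remains. Only the
trace survives. -/
theorem hasDerivAt_det_of_eq_one {B : ℝ → Matrix (Fin n) (Fin n) ℝ} {B' : Matrix (Fin n) (Fin n) ℝ}
    {t : ℝ} (hB : ∀ i j, HasDerivAt (fun t => B t i j) (B' i j) t) (h1 : B t = 1) :
    HasDerivAt (fun t => (B t).det) B'.trace t := by
  have h : HasDerivAt (fun t => (B t).det) (∑ σ : Equiv.Perm (Fin n), ((Equiv.Perm.sign σ : ℤ) : ℝ) *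
      ∑ i, (∏ j ∈ Finset.univ.erase i, B t (σ j) j) • B' (σ i) i) t := by
    simp only [Matrix.det_apply']
    exact HasDerivAt.fun_sum fun σ _ => (HasDerivAt.fun_finsetProd fun i _ => hB _ _).const_mul _
  convert h using 1
  rw [Finset.sum_eq_single 1]
  · simp [h1, Matrix.trace]
  · intro σ _ hσ
    rw [Finset.sum_eq_zero, mul_zero]
    intro i _
    have : ∃ j, j ≠ i ∧ σ j ≠ j := by
      by_contra! hcon
      apply hσ
      ext k
      by_cases hk : k = i
      · subst hk
        by_contra hne
        have h2 : σ (σ k) = σ k := hcon (σ k) (fun h => hne (congrArg Fin.val h))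
        exact hne (congrArg Fin.val (σ.injective h2))
      · simp [hcon k hk]
    obtain ⟨j, hji, hj⟩ := this
    rw [Finset.prod_eq_zero (i := j) (by simp [hji]) (by simp [h1, Matrix.one_apply_ne hj]), zero_smul]
  · simp

/-- Left multiplication by the inverse of `A t` reduces to a curve through the identity matrix. -/
theorem hasDerivAt_det {A : ℝ → Matrix (Fin n) (Fin n) ℝ} {A' : Matrix (Fin n) (Fin n) ℝ}
    {t : ℝ} (hA : ∀ i j, HasDerivAt (fun t => A t i j) (A' i j) t) (h : IsUnit (A t).det) :
    HasDerivAt (fun t => (A t).det) ((A t).det * ((A t)⁻¹ * A').trace) t := by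
  have h1 : HasDerivAt (fun s => ((A t)⁻¹ * A s).det) ((A t)⁻¹ * A').trace t := by
    refine hasDerivAt_det_of_eq_one (fun i j => ?_) (Matrix.nonsing_inv_mul _ h)
    simp only [Matrix.mul_apply]
    exact HasDerivAt.fun_sum fun k _ => (hA k j).const_mul _
  have h2 := h1.const_mul (A t).det
  refine h2.congr_of_eventuallyEq (Eventually.of_forall fun s => ?_)
  simp only
  rw [← Matrix.det_mul, Matrix.mul_nonsing_inv_cancel_left _ _ h]

theorem sum_coord_sq (v : Eu n) : ∑ i, v i ^ 2 = ‖v‖ ^ 2 := by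
  simp [EuclideanSpace.norm_sq_eq]

theorem abs_coord_le (v : Eu n) (i : Fin n) : |v i| ≤ ‖v‖ := by
  simpa using PiLp.norm_apply_le v i

/-- The Hilbert-Schmidt norm dominates the operator norm, by Cauchy-Schwarz over pairs of indices.
At a point where the reference matrix is the identity, `tensorNorm` is the Hilbert-Schmidt norm. -/
theorem abs_quadratic_le {S : Matrix (Fin n) (Fin n) ℝ} {ε : ℝ}
    (hS : Real.sqrt (∑ i, ∑ j, S i j ^ 2) ≤ ε) (v : Eu n) :
    |∑ i, ∑ j, v i * v j * S i j| ≤ ε * ‖v‖ ^ 2 := by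
  have h1 : (∑ p : Fin n × Fin n, (v p.1 * v p.2) * S p.1 p.2) ^ 2 ≤
      (∑ p : Fin n × Fin n, (v p.1 * v p.2) ^ 2) * ∑ p : Fin n × Fin n, S p.1 p.2 ^ 2 :=
    Finset.sum_mul_sq_le_sq_mul_sq _ _ _
  rw [Fintype.sum_prod_type, Fintype.sum_prod_type, Fintype.sum_prod_type] at h1
  have h2 : ∑ i, ∑ j, (v i * v j) ^ 2 = (‖v‖ ^ 2) ^ 2 := by
    rw [← sum_coord_sq, sq (∑ i, v i ^ 2), Finset.sum_mul_sum]
    exact Finset.sum_congr rfl fun i _ => Finset.sum_congr rfl fun j _ => by ring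
  simp only at h1
  rw [h2] at h1
  have h3 := Real.abs_le_sqrt h1
  rw [Real.sqrt_mul (sq_nonneg _), Real.sqrt_sq (sq_nonneg _)] at h3
  calc _ ≤ _ := h3
    _ ≤ ‖v‖ ^ 2 * ε := by gcongr
    _ = _ := mul_comm _ _

theorem tensorNorm_of_eq_one {G S : Eu n → Matrix (Fin n) (Fin n) ℝ} {y : Eu n} (h : G y = 1) :
    tensorNorm G S y = Real.sqrt (∑ i, ∑ j, S y i j ^ 2) := by
  simp [tensorNorm, h, Matrix.one_apply, sq]

theorem covDerivNorm_of_eq_one {G S : Eu n → Matrix (Fin n) (Fin n) ℝ} {y : Eu n} (h : G y = 1) :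
    covDerivNorm G S y = Real.sqrt (∑ k, ∑ i, ∑ j, covDeriv G S k i j y ^ 2) := by
  simp [covDerivNorm, h, Matrix.one_apply, sq]

theorem abs_covDeriv_le_of_eq_one {G S : Eu n → Matrix (Fin n) (Fin n) ℝ} {y : Eu n} (h : G y = 1)
    (k i j : Fin n) : |covDeriv G S k i j y| ≤ covDerivNorm G S y := by
  rw [covDerivNorm_of_eq_one h]
  refine Real.abs_le_sqrt ?_
  calc covDeriv G S k i j y ^ 2 ≤ ∑ j, covDeriv G S k i j y ^ 2 :=
        Finset.single_le_sum (f := fun j => covDeriv G S k i j y ^ 2)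
          (fun _ _ => sq_nonneg _) (Finset.mem_univ j)
    _ ≤ ∑ i, ∑ j, covDeriv G S k i j y ^ 2 :=
        Finset.single_le_sum (f := fun i => ∑ j, covDeriv G S k i j y ^ 2)
          (fun _ _ => Finset.sum_nonneg fun _ _ => sq_nonneg _) (Finset.mem_univ i)
    _ ≤ _ := Finset.single_le_sum (f := fun k => ∑ i, ∑ j, covDeriv G S k i j y ^ 2)
          (fun _ _ => Finset.sum_nonneg fun _ _ => Finset.sum_nonneg fun _ _ => sq_nonneg _)
          (Finset.mem_univ k)

/-- The trace of `G⁻¹ ∇S`, where `S = G - Gr` and `∇` is the Levi-Civita connection of `Gr`, at a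
point where `Gr` is the identity matrix. -/
theorem sum_inv_mul_covDeriv {G Gr : Eu n → Matrix (Fin n) (Fin n) ℝ} {y : Eu n}
    (hG : ∀ i j, DifferentiableAt ℝ (fun z => G z i j) y)
    (hGr : ∀ i j, DifferentiableAt ℝ (fun z => Gr z i j) y)
    (hsymm : ∀ᶠ z in 𝓝 y, ∀ i j, Gr z i j = Gr z j i) (h1 : Gr y = 1)
    (hGsymm : ∀ i j, G y i j = G y j i) (hdet : IsUnit (G y).det) (k : Fin n) :
    ∑ i, ∑ j, (G y)⁻¹ i j * covDeriv Gr (fun z => G z - Gr z) k i j y =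
      ∑ i, ∑ j, (G y)⁻¹ i j * partialD k (fun z => G z i j) y
        - ∑ i, partialD k (fun z => Gr z i i) y := by
  set H := (G y)⁻¹ with hH
  have hd : ∀ k i j, partialD k (fun z => Gr z i j) y = partialD k (fun z => Gr z j i) y := by
    intro k i j
    have : (fun z => Gr z i j) =ᶠ[𝓝 y] fun z => Gr z j i := by
      filter_upwards [hsymm] with z hz using hz i j
    rw [partialD, partialD, this.fderiv_eq]
  have hΓ : ∀ l i j, christoffel Gr l i j y = (1 / 2 : ℝ) * (partialD i (fun z => Gr z j l) y
      + partialD j (fun z => Gr z i l) y - partialD l (fun z => Gr z i j) y) := by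
    intro l i j
    simp [christoffel, h1, Matrix.one_apply]
  have hp : ∀ i j, partialD k (fun z => (G z - Gr z) i j) y =
      partialD k (fun z => G z i j) y - partialD k (fun z => Gr z i j) y := by
    intro i j
    simp only [partialD, Matrix.sub_apply]
    rw [fderiv_fun_sub (hG i j) (hGr i j)]
    rfl
  -- Compatibility of the connection with `Gr`, with indices lowered by the identity matrix.
  have hΓsum : ∀ i j, christoffel Gr j k i y + christoffel Gr i k j y =
      partialD k (fun z => Gr z i j) y := by
    intro i j
    rw [hΓ, hΓ, hd k j i, hd i k j, hd j k i]
    ring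
  -- Since `Gr` is parallel, the covariant derivative of the difference is that of `G` alone.
  have hcov : ∀ i j, covDeriv Gr (fun z => G z - Gr z) k i j y = partialD k (fun z => G z i j) y
      - ∑ l, christoffel Gr l k i y * G y l j - ∑ l, christoffel Gr l k j y * G y i l := by
    intro i j
    simp only [covDeriv, hp]
    simp only [Matrix.sub_apply, h1, mul_sub, Finset.sum_sub_distrib,
      Matrix.one_apply, mul_ite, mul_one, mul_zero, Finset.sum_ite_eq, Finset.sum_ite_eq',
      Finset.mem_univ, if_true]
    rw [← hΓsum i j]
    ring
  have hHG : H * G y = 1 := Matrix.nonsing_inv_mul _ hdet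
  have hHG1 : ∀ i l, ∑ j, H i j * G y l j = if i = l then 1 else 0 := by
    intro i l
    have := congrFun (congrFun hHG i) l
    rw [Matrix.mul_apply, Matrix.one_apply] at this
    rw [← this]
    exact Finset.sum_congr rfl fun j _ => by rw [hGsymm l j]
  have hGH : G y * H = 1 := Matrix.mul_nonsing_inv _ hdet
  have hHG2 : ∀ j l, ∑ i, H i j * G y i l = if l = j then 1 else 0 := by
    intro j l
    have := congrFun (congrFun hGH l) j
    rw [Matrix.mul_apply, Matrix.one_apply] at this
    rw [← this]
    exact Finset.sum_congr rfl fun i _ => by rw [hGsymm i l]; ring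
  -- Contracting with `H`, the inverse of `G y`, leaves the trace of the Christoffel symbols; the
  -- two such traces together are the trace of `∂_k Gr`.
  have e1 : ∑ i, ∑ j, H i j * ∑ l, christoffel Gr l k i y * G y l j =
      ∑ i, christoffel Gr i k i y := by
    refine Finset.sum_congr rfl fun i _ => ?_
    calc ∑ j, H i j * ∑ l, christoffel Gr l k i y * G y l j
        = ∑ l, christoffel Gr l k i y * ∑ j, H i j * G y l j := by
          simp only [Finset.mul_sum]
          rw [Finset.sum_comm]
          exact Finset.sum_congr rfl fun _ _ => Finset.sum_congr rfl fun _ _ => by ring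
      _ = _ := by simp [hHG1]
  have e2 : ∑ i, ∑ j, H i j * ∑ l, christoffel Gr l k j y * G y i l =
      ∑ j, christoffel Gr j k j y := by
    rw [Finset.sum_comm]
    refine Finset.sum_congr rfl fun j _ => ?_
    calc ∑ i, H i j * ∑ l, christoffel Gr l k j y * G y i l
        = ∑ l, christoffel Gr l k j y * ∑ i, H i j * G y i l := by
          simp only [Finset.mul_sum]
          rw [Finset.sum_comm]
          exact Finset.sum_congr rfl fun _ _ => Finset.sum_congr rfl fun _ _ => by ring
      _ = _ := by simp [hHG2]
  simp only [hcov, mul_sub, Finset.sum_sub_distrib]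
  rw [e1, e2]
  have e3 : ∑ i, partialD k (fun z => Gr z i i) y = 2 * ∑ i, christoffel Gr i k i y := by
    rw [Finset.mul_sum]
    exact Finset.sum_congr rfl fun i _ => by rw [← hΓsum i i]; ring
  rw [e3]
  ring

/-- Entries of the inverse of a matrix which is close to the identity. -/
theorem abs_inv_apply_le {A : Matrix (Fin n) (Fin n) ℝ} {δ : ℝ} (hδ : 0 < δ)
    (hA : ∀ v : Eu n, δ * ‖v‖ ^ 2 ≤ ∑ i, ∑ j, v i * v j * A i j) (hdet : IsUnit A.det)
    (i j : Fin n) : |A⁻¹ i j| ≤ δ⁻¹ := by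
  -- The quadratic form of `A` at the `j`-th column `w` of its inverse equals `w j`, so coercivity
  -- gives `δ ‖w‖² ≤ w j ≤ ‖w‖`.
  set w : Eu n := WithLp.toLp 2 fun i => A⁻¹ i j with hw
  have h1 : ∑ i, ∑ j, w i * w j * A i j = w j := by
    have h2 : ∀ a, ∑ b, w b * A a b = if a = j then 1 else 0 := by
      intro a
      have := congrFun (congrFun (Matrix.mul_nonsing_inv _ hdet) a) j
      rw [Matrix.mul_apply, Matrix.one_apply] at this
      rw [← this]
      exact Finset.sum_congr rfl fun b _ => by rw [hw]; ring
    have h3 : ∀ a, ∑ b, w a * w b * A a b = w a * ∑ b, w b * A a b := fun a => by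
      rw [Finset.mul_sum]
      exact Finset.sum_congr rfl fun b _ => by ring
    simp [h3, h2]
  have h4 := hA w
  rw [h1] at h4
  have h5 := (le_abs_self _).trans (abs_coord_le w j)
  have h6 : ‖w‖ ≤ δ⁻¹ := by
    rw [← one_div, le_div_iff₀ hδ]
    by_contra! h
    have h0 : 0 ≤ ‖w‖ := norm_nonneg w
    nlinarith
  exact (abs_coord_le w i).trans h6

/-- The logarithmic derivative of the volume ratio of two metrics is controlled by their
`C¹` distance. -/
theorem abs_fderiv_sqrt_det_ratio_le {G Gr : Eu n → Matrix (Fin n) (Fin n) ℝ} {y : Eu n} {ε : ℝ}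
    (hε : ε < 1)
    (hG : ∀ i j, DifferentiableAt ℝ (fun z => G z i j) y)
    (hGr : ∀ i j, DifferentiableAt ℝ (fun z => Gr z i j) y)
    (hsymm : ∀ᶠ z in 𝓝 y, ∀ i j, Gr z i j = Gr z j i) (h1 : Gr y = 1)
    (hGpos : (G y).PosDef)
    (hC : tensorNorm Gr (fun z => G z - Gr z) y + covDerivNorm Gr (fun z => G z - Gr z) y ≤ ε)
    (v : Eu n) :
    |fderiv ℝ (fun z => Real.sqrt ((G z).det / (Gr z).det)) y v| ≤
      n ^ 3 * (ε / (1 - ε)) * Real.sqrt ((G y).det / (Gr y).det) * ‖v‖ := by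
  have ht0 : 0 ≤ tensorNorm Gr (fun z => G z - Gr z) y := Real.sqrt_nonneg _
  have hc0 : 0 ≤ covDerivNorm Gr (fun z => G z - Gr z) y := Real.sqrt_nonneg _
  have hε0 : 0 ≤ ε := by linarith
  have hdet := hGpos.det_pos
  have hGsymm : ∀ i j, G y i j = G y j i := fun i j => (hGpos.1.apply i j).symm
  -- The reference is the identity at `y` and the difference has norm at most `ε`; hence the entries
  -- of the inverse of `G y` are at most `1 / (1 - ε)`.
  have hquad : ∀ v : Eu n, (1 - ε) * ‖v‖ ^ 2 ≤ ∑ i, ∑ j, v i * v j * G y i j := by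
    intro v
    have h2 := abs_quadratic_le (ε := ε) (S := G y - Gr y)
      (by rw [← tensorNorm_of_eq_one (S := fun z => G z - Gr z) h1]; linarith) v
    have h3 : ∑ i, ∑ j, v i * v j * (G y - Gr y) i j =
        ∑ i, ∑ j, v i * v j * G y i j - ‖v‖ ^ 2 := by
      rw [h1, ← sum_coord_sq]
      simp [mul_sub, Finset.sum_sub_distrib, Matrix.one_apply, sq]
    rw [h3] at h2
    have := (abs_le.1 h2).1
    linarith
  have hinv := abs_inv_apply_le (sub_pos.2 hε) hquad hdet.ne'.isUnit
  have hdetG : DifferentiableAt ℝ (fun z => (G z).det) y := by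
    simp only [Matrix.det_apply']
    fun_prop
  have hdetGr : DifferentiableAt ℝ (fun z => (Gr z).det) y := by
    simp only [Matrix.det_apply']
    fun_prop
  have hline : ∀ {A : Eu n → Matrix (Fin n) (Fin n) ℝ}
      (hA : ∀ i j, DifferentiableAt ℝ (fun z => A z i j) y)
      (hAd : DifferentiableAt ℝ (fun z => (A z).det) y) (hu : IsUnit (A y).det) (k : Fin n),
      fderiv ℝ (fun z => (A z).det) y (basisVec k) = (A y).det *
        ∑ i, ∑ j, (A y)⁻¹ i j * partialD k (fun z => A z j i) y := by
    intro A hA hAd hu k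
    have h2 : ∀ i j, HasDerivAt (fun t : ℝ => A (y + t • basisVec k) i j)
        (Matrix.of (fun i j => partialD k (fun z => A z i j) y) i j) 0 := fun i j =>
      (hA i j).hasFDerivAt.hasLineDerivAt (basisVec k)
    have h3 := hasDerivAt_det h2 (by simpa using hu)
    have h4 : HasDerivAt (fun t : ℝ => (A (y + t • basisVec k)).det)
      (fderiv ℝ (fun z => (A z).det) y (basisVec k)) 0 := hAd.hasFDerivAt.hasLineDerivAt (basisVec k)
    rw [h4.unique h3]
    simp [Matrix.trace, Matrix.mul_apply]
  set D : Eu n → ℝ := fun z => (G z).det / (Gr z).det with hD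
  have hGr1 : (Gr y).det ≠ 0 := by simp [h1]
  have hDd : DifferentiableAt ℝ D y := by
    simp only [hD, div_eq_mul_inv]
    exact hdetG.fun_mul (hdetGr.fun_inv hGr1)
  have hDy : D y = (G y).det := by simp [hD, h1]
  have hDpos : 0 < D y := by rwa [hDy]
  -- Jacobi's formula for numerator and denominator; the term from `Gr` is what turns partial
  -- derivatives of `G` into covariant derivatives of the difference.
  have hk : ∀ k, fderiv ℝ D y (basisVec k) = D y *
      ∑ i, ∑ j, (G y)⁻¹ i j * covDeriv Gr (fun z => G z - Gr z) k i j y := by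
    intro k
    rw [sum_inv_mul_covDeriv hG hGr hsymm h1 hGsymm hdet.ne'.isUnit k, hDy]
    have h5 : HasDerivAt (fun t : ℝ => D (y + t • basisVec k)) _ 0 := HasDerivAt.fun_div
      (hdetG.hasFDerivAt.hasLineDerivAt (basisVec k))
      (hdetGr.hasFDerivAt.hasLineDerivAt (basisVec k)) (by simpa using hGr1)
    have h5' : HasDerivAt (fun t : ℝ => D (y + t • basisVec k)) (fderiv ℝ D y (basisVec k)) 0 :=
      hDd.hasFDerivAt.hasLineDerivAt (basisVec k)
    rw [h5'.unique h5]
    have h6 := hline hG hdetG hdet.ne'.isUnit k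
    have h7 := hline hGr hdetGr (by simp [h1]) k
    have hinvsymm : ∀ i j, (G y)⁻¹ i j = (G y)⁻¹ j i := fun i j => (hGpos.inv.1.apply i j).symm
    have h8 : ∑ i, ∑ j, (G y)⁻¹ i j * partialD k (fun z => G z j i) y =
        ∑ i, ∑ j, (G y)⁻¹ i j * partialD k (fun z => G z i j) y := by
      rw [Finset.sum_comm]
      exact Finset.sum_congr rfl fun i _ => Finset.sum_congr rfl fun j _ => by rw [hinvsymm]
    rw [h8] at h6
    simp only [h1, Matrix.det_one, inv_one, Matrix.one_apply, ite_mul, one_mul, zero_mul,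
      Finset.sum_ite_eq, Finset.mem_univ, if_true] at h7
    simp only [zero_smul, add_zero, h1, Matrix.det_one, h6, h7]
    ring
  -- There are `n²` terms, each an entry of the inverse times a component of the covariant
  -- derivative.
  have hkb : ∀ k, |fderiv ℝ D y (basisVec k)| ≤ D y * (n ^ 2 * (ε / (1 - ε))) := by
    intro k
    rw [hk, abs_mul, abs_of_pos hDpos]
    refine mul_le_mul_of_nonneg_left ?_ hDpos.le
    calc _ ≤ ∑ i, ∑ j, |(G y)⁻¹ i j * covDeriv Gr (fun z => G z - Gr z) k i j y| :=
          (Finset.abs_sum_le_sum_abs _ _).trans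
            (Finset.sum_le_sum fun i _ => Finset.abs_sum_le_sum_abs _ _)
      _ ≤ ∑ i : Fin n, ∑ j : Fin n, (1 - ε)⁻¹ * ε := by
          refine Finset.sum_le_sum fun i _ => Finset.sum_le_sum fun j _ => ?_
          rw [abs_mul]
          refine mul_le_mul (hinv i j) ?_ (abs_nonneg _) (inv_nonneg.2 (by linarith))
          exact (abs_covDeriv_le_of_eq_one h1 k i j).trans (by linarith)
      _ = _ := by
          simp
          ring
  have hsq : fderiv ℝ (fun z => Real.sqrt (D z)) y v =
      (1 / (2 * Real.sqrt (D y))) * fderiv ℝ D y v := by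
    rw [(hDd.hasFDerivAt.sqrt hDpos.ne').fderiv]
    rfl
  -- Summing over the components of `v` costs another factor `n`. The resulting `n ^ 3` is the
  -- constant 64 in dimension four; the factor `1/2` from the square root is given away at the end.
  have hv : |fderiv ℝ D y v| ≤ ‖v‖ * (n * (D y * (n ^ 2 * (ε / (1 - ε))))) := by
    conv_lhs => rw [← sum_smul_basisVec v]
    simp only [map_sum, map_smul, smul_eq_mul]
    calc _ ≤ ∑ i, |v i * fderiv ℝ D y (basisVec i)| := Finset.abs_sum_le_sum_abs _ _
      _ ≤ ∑ i : Fin n, ‖v‖ * (D y * (n ^ 2 * (ε / (1 - ε)))) := by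
          refine Finset.sum_le_sum fun i _ => ?_
          rw [abs_mul]
          exact mul_le_mul (abs_coord_le v i) (hkb i) (abs_nonneg _) (norm_nonneg _)
      _ = _ := by
          simp
          ring
  have hsp : 0 < Real.sqrt (D y) := Real.sqrt_pos.2 hDpos
  have hss : Real.sqrt (D y) * Real.sqrt (D y) = D y := Real.mul_self_sqrt hDpos.le
  have h0 : 0 ≤ ε / (1 - ε) := div_nonneg hε0 (by linarith)
  rw [hsq, abs_mul, abs_of_pos (by positivity)]
  calc _ ≤ (1 / (2 * Real.sqrt (D y))) * (‖v‖ * (n * (D y * (n ^ 2 * (ε / (1 - ε)))))) := by gcongr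
    _ = (1 / 2) * (n ^ 3 * (ε / (1 - ε)) * Real.sqrt (D y) * ‖v‖) := by
        nth_rewrite 2 [← hss]
        field_simp
    _ ≤ _ := by
        have : 0 ≤ n ^ 3 * (ε / (1 - ε)) * Real.sqrt (D y) * ‖v‖ := by positivity
        linarith

end LinearAlgebra

/-- `T` itself is installed as an inner product on `V`, and an orthonormal basis is read back as a
linear equivalence. It serves to make the reference metric the identity matrix at a chosen point. -/
theorem exists_orthonormal_linearEquiv {V : Type*} [AddCommGroup V] [Module ℝ V]
    [FiniteDimensional ℝ V] {n : ℕ} (hn : Module.finrank ℝ V = n) (T : V →ₗ[ℝ] V →ₗ[ℝ] ℝ)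
    (hsymm : ∀ v w, T v w = T w v) (hpos : ∀ v, v ≠ 0 → 0 < T v v) :
    ∃ L : Eu n ≃ₗ[ℝ] V, ∀ e e' : Eu n, T (L e) (L e') = ∑ i, e i * e' i := by
  have hnonneg : ∀ v, 0 ≤ T v v := fun v => by
    by_cases hv : v = 0
    · simp [hv]
    · exact (hpos v hv).le
  let core : InnerProductSpace.Core ℝ V :=
    { inner := fun v w => T v w
      conj_inner_symm := fun v w => by simpa using hsymm w v
      re_inner_nonneg := fun v => by simpa using hnonneg v
      add_left := fun v w z => by simp
      smul_left := fun v w r => by simp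
      definite := fun v hv => by
        by_contra h
        exact (hpos v h).ne' hv }
  let _ : NormedAddCommGroup V := core.toNormedAddCommGroup
  let _ : InnerProductSpace ℝ V := InnerProductSpace.ofCore core.toCore
  let b : OrthonormalBasis (Fin n) ℝ V := (stdOrthonormalBasis ℝ V).reindex (finCongr hn)
  refine ⟨b.repr.symm.toLinearEquiv, fun e e' => ?_⟩
  have h : T (b.repr.symm e) (b.repr.symm e') = inner ℝ (b.repr.symm e) (b.repr.symm e') := rfl
  refine h.trans ?_
  rw [LinearIsometryEquiv.inner_map_map]
  simp [PiLp.inner_apply, mul_comm]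

section FlatInner

theorem flatInner_symm {h : Matrix (Fin 2) (Fin 2) ℝ} (hh : h.PosDef) (α β : Eu 2) :
    flatInner h α β = flatInner h β α := by
  unfold flatInner
  rw [Finset.sum_comm]
  refine Finset.sum_congr rfl fun a _ => Finset.sum_congr rfl fun b _ => ?_
  rw [show h b a = h a b from hh.1.apply a b]
  ring

theorem flatInner_pos {h : Matrix (Fin 2) (Fin 2) ℝ} (hh : h.PosDef) {α : Eu 2} (hα : α ≠ 0) :
    0 < flatInner h α α := by
  have h1 := hh.dotProduct_mulVec_pos (x := α.ofLp) (by simpa using hα)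
  refine lt_of_lt_of_eq h1 ?_
  simp only [dotProduct, Matrix.mulVec, Finset.mul_sum, flatInner, Pi.star_apply, star_trivial]
  exact Finset.sum_congr rfl fun i _ => Finset.sum_congr rfl fun j _ => by ring

theorem flatInner_nonneg {h : Matrix (Fin 2) (Fin 2) ℝ} (hh : h.PosDef) (α : Eu 2) :
    0 ≤ flatInner h α α := by
  by_cases hα : α = 0
  · simp [hα, flatInner]
  · exact (flatInner_pos hh hα).le

/-- `flatInner` as a bilinear map. -/
def flatInnerₗ (h : Matrix (Fin 2) (Fin 2) ℝ) : Eu 2 →ₗ[ℝ] Eu 2 →ₗ[ℝ] ℝ :=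
  LinearMap.mk₂ ℝ (flatInner h)
    (fun a b c => by simp only [flatInner, PiLp.add_apply, ← Finset.sum_add_distrib]
                     exact Finset.sum_congr rfl fun i _ => Finset.sum_congr rfl fun j _ => by ring)
    (fun a b c => by simp only [flatInner, PiLp.smul_apply, smul_eq_mul, Finset.mul_sum]
                     exact Finset.sum_congr rfl fun i _ => Finset.sum_congr rfl fun j _ => by ring)
    (fun a b c => by simp only [flatInner, PiLp.add_apply, ← Finset.sum_add_distrib]
                     exact Finset.sum_congr rfl fun i _ => Finset.sum_congr rfl fun j _ => by ring)
    (fun a b c => by simp only [flatInner, PiLp.smul_apply, smul_eq_mul, Finset.mul_sum]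
                     exact Finset.sum_congr rfl fun i _ => Finset.sum_congr rfl fun j _ => by ring)

end FlatInner

/-- The ratio of the volume densities of two fields of bilinear forms. -/
def volRatio {n : ℕ} {X : Type*} [TopologicalSpace X] [ChartedSpace (Eu n) X]
    (T T' : BilinField n X) (x : X) : ℝ :=
  Real.sqrt ((stdMatrix T x).det / (stdMatrix T' x).det)

/-- The squared Jacobian cancels in the quotient. The same function can thus be estimated in
coordinates orthonormal at a point and integrated in coordinates that split base and fibre. -/
theorem volRatio_param {n : ℕ} {X : Type*} [TopologicalSpace X] [ChartedSpace (Eu n) X]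
    (T T' : BilinField n X) {F : Eu n → X} {y : Eu n}
    (hF : Function.Injective (mfderiv 𝓘(ℝ, Eu n) 𝓘(ℝ, Eu n) F y)) :
    volRatio T T' (F y) =
      Real.sqrt ((coordMatrix T F y).det / (coordMatrix T' F y).det) := by
  have h : (modelDeriv F y).det ≠ 0 := by
    have h1 : LinearMap.ker (modelDeriv F y).toLinearMap = ⊥ := LinearMap.ker_eq_bot.2 hF
    exact (LinearMap.isUnit_det _
      ((LinearMap.isUnit_iff_ker_eq_bot _).2 h1)).ne_zero
  rw [det_coordMatrix, det_coordMatrix, mul_div_mul_left _ _ (pow_ne_zero 2 h), volRatio]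

/-! ### Semi-flat trivializations as local parametrizations of the total space. -/

namespace SemiflatChart

variable {M : Type*} [TopologicalSpace M] [ChartedSpace (Eu 2) M] [IsManifold 𝓘(ℝ, Eu 2) ∞ M]
  {X : Type*} [TopologicalSpace X] [ChartedSpace (Eu 4) X]
  [IsManifold 𝓘(ℝ, Eu 4) ∞ X] {pr : X → M} {gB : Metric 2 M} {gRef : BilinField 4 X} {B₀ : Set M} {b₀ : M}
  (κ : SemiflatChart pr gB gRef B₀ b₀) (x₀ : M)

/-- The part of the target of the preferred chart at `x₀` over which the trivialization is
defined. -/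
def baseSet : Set (Eu 2) :=
  (chartAt (Eu 2) x₀).target ∩ (chartAt (Eu 2) x₀).symm ⁻¹' κ.U

theorem isOpen_baseSet : IsOpen (κ.baseSet x₀) :=
  (chartAt (Eu 2) x₀).symm.isOpen_inter_preimage κ.isOpen

/-- The trivialization in coordinates of the base. -/
def prodParam (p : Eu 2 × Eu 2) : X := κ.Ψ ((chartAt (Eu 2) x₀).symm p.1, p.2)

/-- The local parametrization of the total space defined by a trivialization and linear coordinates
on the product. -/
def param (L : Eu 4 ≃L[ℝ] Eu 2 × Eu 2) (y : Eu 4) : X := κ.prodParam x₀ (L y)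

/-- The domain of `param`. -/
def paramSet (L : Eu 4 ≃L[ℝ] Eu 2 × Eu 2) : Set (Eu 4) := L ⁻¹' (κ.baseSet x₀ ×ˢ univ)

theorem isOpen_paramSet (L : Eu 4 ≃L[ℝ] Eu 2 × Eu 2) : IsOpen (κ.paramSet x₀ L) :=
  ((κ.isOpen_baseSet x₀).prod isOpen_univ).preimage L.continuous

theorem contMDiffOn_prodParam : ContMDiffOn 𝓘(ℝ, Eu 2 × Eu 2) 𝓘(ℝ, Eu 4) ∞ (κ.prodParam x₀)
    (κ.baseSet x₀ ×ˢ univ) := by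
  have h1 : ContMDiffOn 𝓘(ℝ, Eu 2 × Eu 2) 𝓘(ℝ, Eu 2) ∞
      (fun p : Eu 2 × Eu 2 => (chartAt (Eu 2) x₀).symm p.1) (κ.baseSet x₀ ×ˢ univ) :=
    (contMDiffOn_chart_symm (I := 𝓘(ℝ, Eu 2)) (n := ∞) (x := x₀)).comp
      contDiff_fst.contMDiff.contMDiffOn (fun p hp => hp.1.1)
  have h2 : ContMDiffOn 𝓘(ℝ, Eu 2 × Eu 2) 𝓘(ℝ, Eu 2) ∞
      (fun p : Eu 2 × Eu 2 => p.2) (κ.baseSet x₀ ×ˢ univ) := contDiff_snd.contMDiff.contMDiffOn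
  exact κ.smooth.comp (h1.prodMk h2) fun p hp => ⟨hp.1.2, trivial⟩

theorem contMDiffOn_param (L : Eu 4 ≃L[ℝ] Eu 2 × Eu 2) :
    ContMDiffOn 𝓘(ℝ, Eu 4) 𝓘(ℝ, Eu 4) ∞ (κ.param x₀ L) (κ.paramSet x₀ L) :=
  (κ.contMDiffOn_prodParam x₀).comp L.contDiff.contMDiff.contMDiffOn (fun _ h => h)

theorem modelDeriv_param (L : Eu 4 ≃L[ℝ] Eu 2 × Eu 2) {y : Eu 4} (hy : y ∈ κ.paramSet x₀ L)
    (e : Eu 4) : modelDeriv (κ.param x₀ L) y e =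
      prodDeriv κ.Ψ ((chartAt (Eu 2) x₀).symm (L y).1) (L y).2
        (modelDeriv (chartAt (Eu 2) x₀).symm (L y).1 (L e).1) (L e).2 := by
  set c := chartAt (Eu 2) x₀
  have hc : MDifferentiableAt 𝓘(ℝ, Eu 2) 𝓘(ℝ, Eu 2) c.symm (L y).1 :=
    (isLocalParam_chart x₀).mdifferentiableAt hy.1.1
  have hL1 : HasMFDerivAt 𝓘(ℝ, Eu 4) 𝓘(ℝ, Eu 2) (fun y => (L y).1) y
      ((ContinuousLinearMap.fst ℝ (Eu 2) (Eu 2)).comp (L : Eu 4 →L[ℝ] Eu 2 × Eu 2)) :=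
    (((ContinuousLinearMap.fst ℝ (Eu 2) (Eu 2)).comp
      (L : Eu 4 →L[ℝ] Eu 2 × Eu 2)).hasFDerivAt (x := y)).hasMFDerivAt
  have hL2 : HasMFDerivAt 𝓘(ℝ, Eu 4) 𝓘(ℝ, Eu 2) (fun y => (L y).2) y
      ((ContinuousLinearMap.snd ℝ (Eu 2) (Eu 2)).comp (L : Eu 4 →L[ℝ] Eu 2 × Eu 2)) :=
    (((ContinuousLinearMap.snd ℝ (Eu 2) (Eu 2)).comp
      (L : Eu 4 →L[ℝ] Eu 2 × Eu 2)).hasFDerivAt (x := y)).hasMFDerivAt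
  have h1 : HasMFDerivAt 𝓘(ℝ, Eu 4) 𝓘(ℝ, Eu 2) (fun y => c.symm (L y).1) y _ :=
    HasMFDerivAt.comp (I' := 𝓘(ℝ, Eu 2)) y hc.hasMFDerivAt hL1
  have hmem : (c.symm (L y).1, (L y).2) ∈ κ.U ×ˢ (univ : Set (Eu 2)) := ⟨hy.1.2, trivial⟩
  have hΨ : MDifferentiableAt (𝓘(ℝ, Eu 2).prod 𝓘(ℝ, Eu 2)) 𝓘(ℝ, Eu 4) κ.Ψ
      (c.symm (L y).1, (L y).2) :=
    ((κ.smooth _ hmem).contMDiffAt ((κ.isOpen.prod isOpen_univ).mem_nhds hmem)).mdifferentiableAt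
      (by simp)
  have h3 : HasMFDerivAt 𝓘(ℝ, Eu 4) 𝓘(ℝ, Eu 4) (κ.param x₀ L) y _ :=
    HasMFDerivAt.comp (I' := 𝓘(ℝ, Eu 2).prod 𝓘(ℝ, Eu 2)) (g := κ.Ψ)
      (f := fun y => (c.symm (L y).1, (L y).2)) y hΨ.hasMFDerivAt (h1.prodMk hL2)
  have h4 := h3.mfderiv
  exact congrArg (fun A : Eu 4 →L[ℝ] Eu 4 => A e) h4

/-- The reference form in the coordinates of the product. -/
def refForm (q : Eu 2) : (Eu 2 × Eu 2) →ₗ[ℝ] (Eu 2 × Eu 2) →ₗ[ℝ] ℝ :=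
  LinearMap.mk₂ ℝ (fun v w =>
    modelForm gB.inner ((chartAt (Eu 2) x₀).symm q) (modelDeriv (chartAt (Eu 2) x₀).symm q v.1)
        (modelDeriv (chartAt (Eu 2) x₀).symm q w.1)
      + flatInnerₗ (κ.h ((chartAt (Eu 2) x₀).symm q)) v.2 w.2)
    (fun a b c => by simp only [Prod.fst_add, Prod.snd_add, map_add, add_apply,
      LinearMap.add_apply]; ring)
    (fun a b c => by simp only [Prod.smul_fst, Prod.smul_snd, map_smul, smul_apply,
      LinearMap.smul_apply, smul_eq_mul]; ring)
    (fun a b c => by simp only [Prod.fst_add, Prod.snd_add, map_add]; ring)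
    (fun a b c => by simp only [Prod.smul_fst, Prod.smul_snd, map_smul, smul_eq_mul]; ring)

theorem refForm_apply (q : Eu 2) (v w : Eu 2 × Eu 2) : κ.refForm x₀ q v w =
    modelForm gB.inner ((chartAt (Eu 2) x₀).symm q) (modelDeriv (chartAt (Eu 2) x₀).symm q v.1)
        (modelDeriv (chartAt (Eu 2) x₀).symm q w.1)
      + flatInner (κ.h ((chartAt (Eu 2) x₀).symm q)) v.2 w.2 := rfl

theorem refForm_symm {q : Eu 2} (hq : q ∈ κ.baseSet x₀) (v w : Eu 2 × Eu 2) :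
    κ.refForm x₀ q v w = κ.refForm x₀ q w v := by
  rw [refForm_apply, refForm_apply, flatInner_symm (κ.posDef_h _ hq.2)]
  congr 1
  exact gB.symm _ _ _

theorem refForm_pos {q : Eu 2} (hq : q ∈ κ.baseSet x₀) {v : Eu 2 × Eu 2} (hv : v ≠ 0) :
    0 < κ.refForm x₀ q v v := by
  rw [refForm_apply]
  have h1 : 0 ≤ modelForm gB.inner ((chartAt (Eu 2) x₀).symm q)
      (modelDeriv (chartAt (Eu 2) x₀).symm q v.1) (modelDeriv (chartAt (Eu 2) x₀).symm q v.1) :=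
    inner_self_nonneg' gB _ _
  have h2 := flatInner_nonneg (κ.posDef_h _ hq.2) v.2
  by_cases hv2 : v.2 = 0
  · have hv1 : v.1 ≠ 0 := fun h => hv (Prod.ext h hv2)
    have h3 : modelDeriv (chartAt (Eu 2) x₀).symm q v.1 ≠ 0 := fun h =>
      hv1 ((isLocalParam_chart x₀).injective q hq.1
        (h.trans (map_zero (modelDeriv (chartAt (Eu 2) x₀).symm q)).symm))
    have h4 : 0 < modelForm gB.inner ((chartAt (Eu 2) x₀).symm q)
      (modelDeriv (chartAt (Eu 2) x₀).symm q v.1) (modelDeriv (chartAt (Eu 2) x₀).symm q v.1) :=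
      gB.pos _ _ h3
    linarith
  · have := flatInner_pos (κ.posDef_h _ hq.2) hv2
    linarith

theorem modelForm_gRef (L : Eu 4 ≃L[ℝ] Eu 2 × Eu 2) {y : Eu 4} (hy : y ∈ κ.paramSet x₀ L)
    (e e' : Eu 4) :
    modelForm gRef (κ.param x₀ L y) (modelDeriv (κ.param x₀ L) y e) (modelDeriv (κ.param x₀ L) y e')
      = κ.refForm x₀ (L y).1 (L e) (L e') := by
  rw [modelDeriv_param κ x₀ L hy, modelDeriv_param κ x₀ L hy]
  exact κ.metric _ hy.1.2 _ _ _ _ _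

/-- A vector in the kernel of the differential would have length zero for the pulled back reference
form, which is positive definite; so the differential of `Ψ` is injective. -/
theorem isLocalParam_param (L : Eu 4 ≃L[ℝ] Eu 2 × Eu 2) :
    IsLocalParam (κ.param x₀ L) (κ.paramSet x₀ L) := by
  refine ⟨κ.isOpen_paramSet x₀ L, κ.contMDiffOn_param x₀ L, fun y hy => ?_⟩
  have h : Function.Injective (modelDeriv (κ.param x₀ L) y) := by
    rw [injective_iff_map_eq_zero]
    intro e he
    by_contra hne
    have h1 := κ.refForm_pos x₀ hy.1 (v := L e) (by simpa using hne)
    rw [← κ.modelForm_gRef x₀ L hy, he] at h1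
    simp at h1
  exact h

theorem coordMatrix_gRef (L : Eu 4 ≃L[ℝ] Eu 2 × Eu 2) {y : Eu 4} (hy : y ∈ κ.paramSet x₀ L)
    (i j : Fin 4) : coordMatrix gRef (κ.param x₀ L) y i j =
      κ.refForm x₀ (L y).1 (L (basisVec i)) (L (basisVec j)) :=
  κ.modelForm_gRef x₀ L hy _ _

theorem contDiffOn_h (a b : Fin 2) :
    ContDiffOn ℝ ∞ (fun q => κ.h ((chartAt (Eu 2) x₀).symm q) a b) (κ.baseSet x₀) := by
  have h1 : ContMDiffOn 𝓘(ℝ, Eu 2) 𝓘(ℝ, Eu 2) ∞ (chartAt (Eu 2) x₀).symm (κ.baseSet x₀) :=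
    (contMDiffOn_chart_symm (I := 𝓘(ℝ, Eu 2)) (n := ∞) (x := x₀)).mono inter_subset_left
  exact ((κ.smooth_h a b).comp h1 fun q hq => hq.2).contDiffOn

theorem contDiffOn_refForm (v w : Eu 2 × Eu 2) :
    ContDiffOn ℝ ∞ (fun q => κ.refForm x₀ q v w) (κ.baseSet x₀) := by
  simp only [refForm_apply, modelForm_modelDeriv, flatInner]
  refine ContDiffOn.add ?_ ?_
  · refine ContDiffOn.sum fun i _ => ContDiffOn.sum fun j _ => contDiffOn_const.mul ?_
    exact (contDiffOn_coordMatrix gB (isLocalParam_chart x₀).isOpen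
      (isLocalParam_chart x₀).smooth i j).mono inter_subset_left
  · refine ContDiffOn.sum fun i _ => ContDiffOn.sum fun j _ => ?_
    exact ((κ.contDiffOn_h x₀ i j).mul contDiffOn_const).mul contDiffOn_const

theorem contDiffOn_coordMatrix_gRef (L : Eu 4 ≃L[ℝ] Eu 2 × Eu 2) (i j : Fin 4) :
    ContDiffOn ℝ ∞ (fun y => coordMatrix gRef (κ.param x₀ L) y i j) (κ.paramSet x₀ L) := by
  have h1 : ContDiffOn ℝ ∞ (fun y => κ.refForm x₀ (L y).1 (L (basisVec i)) (L (basisVec j)))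
      (κ.paramSet x₀ L) :=
    (κ.contDiffOn_refForm x₀ _ _).comp (L.contDiff.fst).contDiffOn fun y hy => hy.1
  exact h1.congr fun y hy => κ.coordMatrix_gRef x₀ L hy i j

theorem posDef_coordMatrix_gRef (L : Eu 4 ≃L[ℝ] Eu 2 × Eu 2) {y : Eu 4}
    (hy : y ∈ κ.paramSet x₀ L) : (coordMatrix gRef (κ.param x₀ L) y).PosDef := by
  have hinj : Function.Injective (modelDeriv (κ.param x₀ L) y) :=
    (κ.isLocalParam_param x₀ L).injective y hy
  have hsurj : Function.Surjective (modelDeriv (κ.param x₀ L) y) :=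
    (LinearMap.injective_iff_surjective (f := (modelDeriv (κ.param x₀ L) y).toLinearMap)).1 hinj
  refine posDef_coordMatrix gRef hinj ?_ ?_
  · intro v w
    obtain ⟨e, rfl⟩ := hsurj v
    obtain ⟨e', rfl⟩ := hsurj w
    refine (κ.modelForm_gRef x₀ L hy e e').trans ?_
    rw [κ.refForm_symm x₀ hy.1]
    exact (κ.modelForm_gRef x₀ L hy e' e).symm
  · intro v hv
    obtain ⟨e, rfl⟩ := hsurj v
    refine lt_of_lt_of_eq (κ.refForm_pos x₀ hy.1 (v := L e) ?_) (κ.modelForm_gRef x₀ L hy e e).symm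
    intro h
    apply hv
    have : e = 0 := by simpa using h
    rw [this]
    exact map_zero (modelDeriv (κ.param x₀ L) y)

/-- Linear coordinates in which the reference form at `q` is the Euclidean inner product. -/
theorem exists_orthonormal_coords {q : Eu 2} (hq : q ∈ κ.baseSet x₀) :
    ∃ L : Eu 4 ≃L[ℝ] Eu 2 × Eu 2, ∀ e e' : Eu 4, κ.refForm x₀ q (L e) (L e') = ∑ i, e i * e' i := by
  obtain ⟨L, hL⟩ := exists_orthonormal_linearEquiv (n := 4) (by simp) (κ.refForm x₀ q)
    (κ.refForm_symm x₀ hq) (fun v hv => κ.refForm_pos x₀ hq hv)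
  exact ⟨L.toContinuousLinearEquiv, hL⟩

theorem contDiffOn_volRatio_param (g : Metric 4 X) (L : Eu 4 ≃L[ℝ] Eu 2 × Eu 2) :
    ContDiffOn ℝ ∞ (volRatio g.inner gRef ∘ κ.param x₀ L) (κ.paramSet x₀ L) := by
  have hF := κ.isLocalParam_param x₀ L
  have h1 : ContDiffOn ℝ ∞ (fun y => Real.sqrt ((coordMatrix g.inner (κ.param x₀ L) y).det /
      (coordMatrix gRef (κ.param x₀ L) y).det)) (κ.paramSet x₀ L) := by
    intro y hy
    have h2 := contDiffOn_det (contDiffOn_coordMatrix g hF.isOpen hF.smooth) y hy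
    have h3 := contDiffOn_det (κ.contDiffOn_coordMatrix_gRef x₀ L) y hy
    have p2 := (hF.posDef g hy).det_pos
    have p3 := (κ.posDef_coordMatrix_gRef x₀ L hy).det_pos
    exact (h2.div h3 p3.ne').sqrt (div_pos p2 p3).ne'
  exact h1.congr fun y hy => volRatio_param _ _ (hF.injective y hy)

theorem volRatio_param_pos (g : Metric 4 X) (L : Eu 4 ≃L[ℝ] Eu 2 × Eu 2) {y : Eu 4}
    (hy : y ∈ κ.paramSet x₀ L) : 0 < volRatio g.inner gRef (κ.param x₀ L y) := by
  have hF := κ.isLocalParam_param x₀ L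
  rw [volRatio_param _ _ (hF.injective y hy)]
  exact Real.sqrt_pos.2 (div_pos (hF.posDef g hy).det_pos
    (κ.posDef_coordMatrix_gRef x₀ L hy).det_pos)

end SemiflatChart

/-! ### Pointwise comparison of the metric with the reference metric. -/

namespace SemiflatChart

variable {M : Type*} [TopologicalSpace M] [ChartedSpace (Eu 2) M] [IsManifold 𝓘(ℝ, Eu 2) ∞ M]
  {X : Type*} [TopologicalSpace X] [ChartedSpace (Eu 4) X]
  [IsManifold 𝓘(ℝ, Eu 4) ∞ X] {pr : X → M} {gB : Metric 2 M} {gRef : BilinField 4 X} {B₀ : Set M}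
  {b₀ : M} (κ : SemiflatChart pr gB gRef B₀ b₀) (x₀ : M)

theorem param_symm_apply (L : Eu 4 ≃L[ℝ] Eu 2 × Eu 2) (p : Eu 2 × Eu 2) :
    κ.param x₀ L (L.symm p) = κ.prodParam x₀ p := by simp [param]

theorem symm_mem_paramSet (L : Eu 4 ≃L[ℝ] Eu 2 × Eu 2) {p : Eu 2 × Eu 2}
    (hp : p.1 ∈ κ.baseSet x₀) : L.symm p ∈ κ.paramSet x₀ L := by simpa [paramSet] using hp

theorem pr_prodParam {p : Eu 2 × Eu 2} (hp : p.1 ∈ κ.baseSet x₀) :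
    pr (κ.prodParam x₀ p) = (chartAt (Eu 2) x₀).symm p.1 := κ.proj _ hp.2 _

/-- The data of linear coordinates that are orthonormal at a point, with the resulting control. -/
theorem exists_normal_coords (g : Metric 4 X) {ε : ℝ}
    (hC1 : C1NormLE gRef (fun x => g.inner x - gRef x) (pr ⁻¹' B₀) ε)
    {p : Eu 2 × Eu 2} (hp : p.1 ∈ κ.baseSet x₀) :
    ∃ L : Eu 4 ≃L[ℝ] Eu 2 × Eu 2,
      (∀ e e' : Eu 4, κ.refForm x₀ p.1 (L e) (L e') = ∑ i, e i * e' i) ∧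
      coordMatrix gRef (κ.param x₀ L) (L.symm p) = 1 ∧
      tensorNorm (coordMatrix gRef (κ.param x₀ L)) (fun y => coordMatrix g.inner (κ.param x₀ L) y -
        coordMatrix gRef (κ.param x₀ L) y) (L.symm p) +
      covDerivNorm (coordMatrix gRef (κ.param x₀ L)) (fun y => coordMatrix g.inner (κ.param x₀ L) y -
        coordMatrix gRef (κ.param x₀ L) y) (L.symm p) ≤ ε := by
  obtain ⟨L, hL⟩ := κ.exists_orthonormal_coords x₀ hp
  have hy := κ.symm_mem_paramSet x₀ L hp
  refine ⟨L, hL, ?_, ?_⟩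
  · ext i j
    rw [κ.coordMatrix_gRef x₀ L hy, L.apply_symm_apply, hL]
    simp [basisVec, Matrix.one_apply, eq_comm]
  · refine hC1 _ _ (κ.isLocalParam_param x₀ L) _ hy ?_
    rw [param_symm_apply]
    exact κ.subset (by rw [κ.pr_prodParam x₀ hp]; exact hp.2)

/-- In coordinates orthonormal for the reference metric, the tensor norm of the difference bounds
its quadratic form. Both `g ≤ (1+ε) gRef` and `(1-ε) gRef ≤ g` are read off from this. -/
theorem abs_metric_sub_le (g : Metric 4 X) {ε : ℝ}
    (hC1 : C1NormLE gRef (fun x => g.inner x - gRef x) (pr ⁻¹' B₀) ε)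
    {p : Eu 2 × Eu 2} (hp : p.1 ∈ κ.baseSet x₀) (v : Eu 4) :
    |modelForm g.inner (κ.prodParam x₀ p) v v - modelForm gRef (κ.prodParam x₀ p) v v| ≤
      ε * modelForm gRef (κ.prodParam x₀ p) v v := by
  obtain ⟨L, hL, h1, hC⟩ := κ.exists_normal_coords x₀ g hC1 hp
  have hy := κ.symm_mem_paramSet x₀ L hp
  set F := κ.param x₀ L with hFdef
  set y := L.symm p with hydef
  have hF := κ.isLocalParam_param x₀ L
  have hFy : F y = κ.prodParam x₀ p := κ.param_symm_apply x₀ L p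
  have hsurj : Function.Surjective (modelDeriv F y) :=
    (LinearMap.injective_iff_surjective (f := (modelDeriv F y).toLinearMap)).1 (hF.injective y hy)
  obtain ⟨e, rfl⟩ := hsurj v
  have hc0 : 0 ≤ covDerivNorm (coordMatrix gRef F) (fun y => coordMatrix g.inner F y -
        coordMatrix gRef F y) y := Real.sqrt_nonneg _
  have h2 := abs_quadratic_le (ε := ε) (S := coordMatrix g.inner F y - coordMatrix gRef F y)
      (by rw [← tensorNorm_of_eq_one (S := fun z => coordMatrix g.inner F z -
            coordMatrix gRef F z) h1]; linarith) e
  rw [← hFy, modelForm_modelDeriv, modelForm_modelDeriv]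
  have h3 : ∑ i, ∑ j, e i * e j * coordMatrix gRef F y i j = ‖e‖ ^ 2 := by
    rw [h1, ← sum_coord_sq]
    simp [Matrix.one_apply, sq]
  rw [h3]
  simp only [Matrix.sub_apply, mul_sub, Finset.sum_sub_distrib] at h2
  rwa [h3] at h2

/-- The length of a coordinate vector of the base. -/
def baseNorm (gB : Metric 2 M) (x₀ : M) (q e : Eu 2) : ℝ :=
  Real.sqrt (modelForm gB.inner ((chartAt (Eu 2) x₀).symm q) (modelDeriv (chartAt (Eu 2) x₀).symm q e)
    (modelDeriv (chartAt (Eu 2) x₀).symm q e))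

theorem contDiffOn_volRatio (g : Metric 4 X) :
    ContDiffOn ℝ ∞ (volRatio g.inner gRef ∘ κ.prodParam x₀) (κ.baseSet x₀ ×ˢ univ) := by
  rintro p ⟨hp, -⟩
  obtain ⟨L, -⟩ := κ.exists_orthonormal_coords x₀ hp
  have h := (κ.contDiffOn_volRatio_param x₀ g L).comp L.symm.contDiff.contDiffOn
    (s := κ.baseSet x₀ ×ˢ univ) (fun p hp => κ.symm_mem_paramSet x₀ L hp.1)
  refine (h.congr fun p _ => ?_) p ⟨hp, trivial⟩
  simp [param]

theorem volRatio_pos (g : Metric 4 X) {p : Eu 2 × Eu 2} (hp : p.1 ∈ κ.baseSet x₀) :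
    0 < volRatio g.inner gRef (κ.prodParam x₀ p) := by
  obtain ⟨L, -⟩ := κ.exists_orthonormal_coords x₀ hp
  rw [← κ.param_symm_apply x₀ L]
  exact κ.volRatio_param_pos x₀ g L (κ.symm_mem_paramSet x₀ L hp)

/-- This is `abs_fderiv_sqrt_det_ratio_le` in coordinates orthonormal at `p`, with `64 = 4³`. The
reference metric is a product, so the horizontal vector `(e, 0)` has the length of `e` in the base.
-/
theorem abs_fderiv_volRatio_le (g : Metric 4 X) {ε : ℝ} (hε : ε < 1)
    (hC1 : C1NormLE gRef (fun x => g.inner x - gRef x) (pr ⁻¹' B₀) ε)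
    {p : Eu 2 × Eu 2} (hp : p.1 ∈ κ.baseSet x₀) (e : Eu 2) :
    |fderiv ℝ (volRatio g.inner gRef ∘ κ.prodParam x₀) p (e, 0)| ≤
      64 * (ε / (1 - ε)) * volRatio g.inner gRef (κ.prodParam x₀ p) * baseNorm gB x₀ p.1 e := by
  obtain ⟨L, hL, h1, hC⟩ := κ.exists_normal_coords x₀ g hC1 hp
  have hy := κ.symm_mem_paramSet x₀ L hp
  have hF := κ.isLocalParam_param x₀ L
  have hnhds := hF.isOpen.mem_nhds hy
  have h2 := abs_fderiv_sqrt_det_ratio_le hε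
    (fun i j => ((contDiffOn_coordMatrix g hF.isOpen hF.smooth i j).contDiffAt hnhds).differentiableAt
      (by simp))
    (fun i j => ((κ.contDiffOn_coordMatrix_gRef x₀ L i j).contDiffAt hnhds).differentiableAt (by simp))
    (by
      filter_upwards [hnhds] with z hz i j
      exact ((κ.posDef_coordMatrix_gRef x₀ L hz).1.apply i j).symm)
    h1 (hF.posDef g hy) hC (L.symm (e, 0))
  have h3 : (fun z => Real.sqrt ((coordMatrix g.inner (κ.param x₀ L) z).det /
      (coordMatrix gRef (κ.param x₀ L) z).det)) =ᶠ[𝓝 (L.symm p)]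
      (volRatio g.inner gRef ∘ κ.prodParam x₀) ∘ L := by
    filter_upwards [hnhds] with z hz
    exact (volRatio_param _ _ (hF.injective z hz)).symm
  rw [h3.fderiv_eq, ← volRatio_param _ _ (hF.injective _ hy), κ.param_symm_apply x₀ L,
    L.comp_right_fderiv] at h2
  have h4 : ‖L.symm (e, 0)‖ = baseNorm gB x₀ p.1 e := by
    have h5 := hL (L.symm (e, 0)) (L.symm (e, 0))
    rw [L.apply_symm_apply, refForm_apply] at h5
    have h6 : ‖L.symm (e, 0)‖ ^ 2 = ∑ i, (L.symm (e, 0)) i * (L.symm (e, 0)) i := by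
      rw [← sum_coord_sq]
      exact Finset.sum_congr rfl fun i _ => sq _
    rw [← h5] at h6
    simp only [flatInner, PiLp.zero_apply, mul_zero, Finset.sum_const_zero, add_zero] at h6
    rw [baseNorm, ← h6, Real.sqrt_sq (norm_nonneg _)]
  rw [h4] at h2
  simp only [ContinuousLinearMap.comp_apply, ContinuousLinearEquiv.coe_coe, L.apply_symm_apply] at h2
  norm_num at h2
  exact h2

/-- Along a horizontal direction the derivative is at most `|∇φ|` times the `g`-length of the
vector, and that length exceeds the one in the base by at most `√(1+ε)`. -/
theorem abs_fderiv_comp_prodParam_le (g : Metric 4 X) {ε : ℝ}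
    (hC1 : C1NormLE gRef (fun x => g.inner x - gRef x) (pr ⁻¹' B₀) ε)
    {φ : X → ℝ} (hφ : ContMDiff 𝓘(ℝ, Eu 4) 𝓘(ℝ, ℝ) ∞ φ)
    {p : Eu 2 × Eu 2} (hp : p.1 ∈ κ.baseSet x₀) (e : Eu 2) :
    |fderiv ℝ (φ ∘ κ.prodParam x₀) p (e, 0)| ≤
      Real.sqrt (gradSq g φ (κ.prodParam x₀ p)) * (Real.sqrt (1 + ε) * baseNorm gB x₀ p.1 e) := by
  obtain ⟨L, -⟩ := κ.exists_orthonormal_coords x₀ hp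
  have hy := κ.symm_mem_paramSet x₀ L hp
  have hF := κ.isLocalParam_param x₀ L
  have h1 := differential_comp_param (φ := φ) (hφ.mdifferentiableAt (by simp))
    (hF.mdifferentiableAt hy) (L.symm (e, 0))
  have h2 : φ ∘ κ.param x₀ L = (φ ∘ κ.prodParam x₀) ∘ L := rfl
  rw [h2, L.comp_right_fderiv] at h1
  simp only [ContinuousLinearMap.comp_apply, ContinuousLinearEquiv.coe_coe, L.apply_symm_apply] at h1
  rw [h1]
  refine (abs_differential_le g φ _ _).trans ?_
  rw [κ.param_symm_apply x₀ L]
  refine mul_le_mul_of_nonneg_left ?_ (Real.sqrt_nonneg _)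
  have h3 := κ.abs_metric_sub_le x₀ g hC1 hp (modelDeriv (κ.param x₀ L) (L.symm p) (L.symm (e, 0)))
  have h4 := κ.modelForm_gRef x₀ L hy (L.symm (e, 0)) (L.symm (e, 0))
  rw [κ.param_symm_apply x₀ L, L.apply_symm_apply, L.apply_symm_apply, refForm_apply] at h4
  simp only [flatInner, PiLp.zero_apply, mul_zero, Finset.sum_const_zero, add_zero] at h4
  rw [h4] at h3
  have h5 := (abs_le.1 h3).2
  have h6 : 0 ≤ modelForm gB.inner ((chartAt (Eu 2) x₀).symm p.1)
      (modelDeriv (chartAt (Eu 2) x₀).symm p.1 e) (modelDeriv (chartAt (Eu 2) x₀).symm p.1 e) :=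
    inner_self_nonneg' gB _ _
  rw [baseNorm, ← Real.sqrt_mul' _ h6]
  refine Real.sqrt_le_sqrt ?_
  have h7 : modelForm g.inner (κ.prodParam x₀ p)
      (modelDeriv (κ.param x₀ L) (L.symm p) (L.symm (e, 0)))
      (modelDeriv (κ.param x₀ L) (L.symm p) (L.symm (e, 0))) ≤
      (1 + ε) * modelForm gB.inner ((chartAt (Eu 2) x₀).symm p.1)
        (modelDeriv (chartAt (Eu 2) x₀).symm p.1 e)
        (modelDeriv (chartAt (Eu 2) x₀).symm p.1 e) := by linarith
  exact h7

theorem mfderiv_pr_param (hpr : ContMDiff 𝓘(ℝ, Eu 4) 𝓘(ℝ, Eu 2) ∞ pr)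
    (L : Eu 4 ≃L[ℝ] Eu 2 × Eu 2) {y : Eu 4} (hy : y ∈ κ.paramSet x₀ L) (e : Eu 4) :
    mfderiv 𝓘(ℝ, Eu 4) 𝓘(ℝ, Eu 2) pr (κ.param x₀ L y) (modelDeriv (κ.param x₀ L) y e) =
      modelDeriv (chartAt (Eu 2) x₀).symm (L y).1 (L e).1 := by
  set c := chartAt (Eu 2) x₀
  have hF := κ.isLocalParam_param x₀ L
  have h1 : HasMFDerivAt 𝓘(ℝ, Eu 4) 𝓘(ℝ, Eu 2) (pr ∘ κ.param x₀ L) y _ :=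
    HasMFDerivAt.comp (I' := 𝓘(ℝ, Eu 4)) y (hpr.mdifferentiableAt (by simp)).hasMFDerivAt
      (hF.mdifferentiableAt hy).hasMFDerivAt
  have hL1 : HasMFDerivAt 𝓘(ℝ, Eu 4) 𝓘(ℝ, Eu 2) (fun y => (L y).1) y
      ((ContinuousLinearMap.fst ℝ (Eu 2) (Eu 2)).comp (L : Eu 4 →L[ℝ] Eu 2 × Eu 2)) :=
    (((ContinuousLinearMap.fst ℝ (Eu 2) (Eu 2)).comp
      (L : Eu 4 →L[ℝ] Eu 2 × Eu 2)).hasFDerivAt (x := y)).hasMFDerivAt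
  have hc : MDifferentiableAt 𝓘(ℝ, Eu 2) 𝓘(ℝ, Eu 2) c.symm (L y).1 :=
    (isLocalParam_chart x₀).mdifferentiableAt hy.1.1
  have h2 : HasMFDerivAt 𝓘(ℝ, Eu 4) 𝓘(ℝ, Eu 2) (c.symm ∘ fun y => (L y).1) y _ :=
    HasMFDerivAt.comp (I' := 𝓘(ℝ, Eu 2)) y hc.hasMFDerivAt hL1
  have h3 : pr ∘ κ.param x₀ L =ᶠ[𝓝 y] c.symm ∘ fun y => (L y).1 := by
    filter_upwards [hF.isOpen.mem_nhds hy] with z hz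
    exact κ.pr_prodParam x₀ hz.1
  have h4 := (h1.mfderiv.symm.trans h3.mfderiv_eq).trans h2.mfderiv
  exact congrArg (fun A : Eu 4 →L[ℝ] Eu 2 => A e) h4

/-- For the reference metric the projection does not increase lengths, since the vertical part only
adds a nonnegative term. Replacing the reference metric by `g` costs the factor `(1 - ε)⁻¹`. -/
theorem gradSq_comp_pr_le (g : Metric 4 X) {ε : ℝ} (hε : ε < 1)
    (hpr : ContMDiff 𝓘(ℝ, Eu 4) 𝓘(ℝ, Eu 2) ∞ pr)
    (hC1 : C1NormLE gRef (fun x => g.inner x - gRef x) (pr ⁻¹' B₀) ε)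
    {ψ : M → ℝ} {p : Eu 2 × Eu 2} (hp : p.1 ∈ κ.baseSet x₀)
    (hψ : MDifferentiableAt 𝓘(ℝ, Eu 2) 𝓘(ℝ, ℝ) ψ (pr (κ.prodParam x₀ p))) :
    gradSq g (ψ ∘ pr) (κ.prodParam x₀ p) ≤
      (1 - ε)⁻¹ * gradSq gB ψ (pr (κ.prodParam x₀ p)) := by
  obtain ⟨L, -⟩ := κ.exists_orthonormal_coords x₀ hp
  have hy := κ.symm_mem_paramSet x₀ L hp
  have hF := κ.isLocalParam_param x₀ L
  set x := κ.prodParam x₀ p with hx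
  set F := κ.param x₀ L with hFdef
  set y := L.symm p with hydef
  have hFy : F y = x := κ.param_symm_apply x₀ L p
  have hsurj : Function.Surjective (modelDeriv F y) :=
    (LinearMap.injective_iff_surjective (f := (modelDeriv F y).toLinearMap)).1 (hF.injective y hy)
  have h0 : 0 ≤ (1 - ε)⁻¹ := inv_nonneg.2 (by linarith)
  have hG0 := gradSq_nonneg gB ψ (pr x)
  have hsq : (Real.sqrt ((1 - ε)⁻¹ * gradSq gB ψ (pr x))) ^ 2 = (1 - ε)⁻¹ * gradSq gB ψ (pr x) :=
    Real.sq_sqrt (mul_nonneg h0 hG0)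
  rw [← hsq]
  refine gradSq_le_sq g _ _ fun w => ?_
  obtain ⟨e, rfl⟩ := hsurj w
  have h1 : differential (ψ ∘ pr) x (modelDeriv F y e) = differential ψ (pr x)
      (mfderiv 𝓘(ℝ, Eu 4) 𝓘(ℝ, Eu 2) pr x (modelDeriv F y e)) := by
    have h2 := mfderiv_comp (I := 𝓘(ℝ, Eu 4)) (I' := 𝓘(ℝ, Eu 2)) (I'' := 𝓘(ℝ, ℝ)) x hψ
      (hpr.mdifferentiableAt (x := x) (by simp))
    exact congrArg (fun A : Eu 4 →L[ℝ] ℝ => A (modelDeriv F y e)) h2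
  rw [h1]
  refine (abs_differential_le gB ψ _ _).trans ?_
  rw [← Real.sqrt_mul hG0, ← Real.sqrt_mul (mul_nonneg h0 hG0)]
  refine Real.sqrt_le_sqrt ?_
  have h3 := κ.abs_metric_sub_le x₀ g hC1 hp (modelDeriv F y e)
  rw [← hx] at h3
  have h4 := (abs_le.1 h3).1
  have h5 := κ.modelForm_gRef x₀ L hy e e
  rw [refForm_apply, ← hFdef, hFy] at h5
  have h6 := flatInner_nonneg (κ.posDef_h _ hy.1.2) (L e).2
  have h7 := κ.mfderiv_pr_param x₀ hpr L hy e
  rw [← hFdef, hFy] at h7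
  have h8 : pr x = (chartAt (Eu 2) x₀).symm (L y).1 := by
    rw [hx, κ.pr_prodParam x₀ hp, hydef, L.apply_symm_apply]
  have h9 : gB.inner (pr x) (mfderiv 𝓘(ℝ, Eu 4) 𝓘(ℝ, Eu 2) pr x (modelDeriv F y e))
      (mfderiv 𝓘(ℝ, Eu 4) 𝓘(ℝ, Eu 2) pr x (modelDeriv F y e)) =
      modelForm gB.inner ((chartAt (Eu 2) x₀).symm (L y).1)
        (modelDeriv (chartAt (Eu 2) x₀).symm (L y).1 (L e).1)
        (modelDeriv (chartAt (Eu 2) x₀).symm (L y).1 (L e).1) := by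
    rw [h7, ← h8]
    rfl
  rw [h9]
  have h10 : (1 - ε) * modelForm gRef x (modelDeriv F y e) (modelDeriv F y e) ≤
      modelForm g.inner x (modelDeriv F y e) (modelDeriv F y e) := by linarith
  have h11 : modelForm gRef x (modelDeriv F y e) (modelDeriv F y e) ≤
      (1 - ε)⁻¹ * modelForm g.inner x (modelDeriv F y e) (modelDeriv F y e) := by
    rw [inv_mul_eq_div, le_div_iff₀ (by linarith)]
    linarith
  calc _ ≤ gradSq gB ψ (pr x) * ((1 - ε)⁻¹ *
        modelForm g.inner x (modelDeriv F y e) (modelDeriv F y e)) :=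
        mul_le_mul_of_nonneg_left (by linarith) hG0
    _ = (1 - ε)⁻¹ * gradSq gB ψ (pr x) *
        modelForm g.inner x (modelDeriv F y e) (modelDeriv F y e) := by ring

end SemiflatChart

/-! ### Splitting coordinates, fundamental domain and measurable partitions. -/

/-- The splitting `ℝ⁴ = ℝ² × ℝ²`, as a linear equivalence. -/
def splitₗ : Eu 4 ≃ₗ[ℝ] Eu 2 × Eu 2 :=
  (WithLp.linearEquiv 2 ℝ (Fin 4 → ℝ)).trans
    (((LinearEquiv.funCongrLeft ℝ ℝ (finSumFinEquiv (m := 2) (n := 2))).trans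
      (LinearEquiv.sumArrowLequivProdArrow (Fin 2) (Fin 2) ℝ ℝ)).trans
        ((WithLp.linearEquiv 2 ℝ (Fin 2 → ℝ)).symm.prodCongr
          (WithLp.linearEquiv 2 ℝ (Fin 2 → ℝ)).symm))

/-- The splitting `ℝ⁴ = ℝ² × ℝ²`. -/
def split : Eu 4 ≃L[ℝ] Eu 2 × Eu 2 := splitₗ.toContinuousLinearEquiv

theorem split_basisVec_inl (a : Fin 2) :
    split (basisVec (finSumFinEquiv (Sum.inl a : Fin 2 ⊕ Fin 2))) = (basisVec a, 0) := by
  fin_cases a <;>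
  · ext i <;> fin_cases i <;> simp [split, splitₗ, basisVec, LinearEquiv.funCongrLeft]

theorem split_basisVec_inr (a : Fin 2) :
    split (basisVec (finSumFinEquiv (Sum.inr a : Fin 2 ⊕ Fin 2))) = (0, basisVec a) := by
  fin_cases a <;>
  · ext i <;> fin_cases i <;> simp [split, splitₗ, basisVec, LinearEquiv.funCongrLeft]

theorem measurePreserving_split : MeasurePreserving split (volume : Measure (Eu 4)) volume := by
  have h1 := PiLp.volume_preserving_ofLp (Fin 4)
  have h2 := (volume_measurePreserving_piCongrLeft (fun _ : Fin 4 => ℝ)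
    (finSumFinEquiv (m := 2) (n := 2))).symm
  have h3 := volume_measurePreserving_sumPiEquivProdPi (fun _ : Fin 2 ⊕ Fin 2 => ℝ)
  have h4 := (PiLp.volume_preserving_toLp (Fin 2)).prod (PiLp.volume_preserving_toLp (Fin 2))
  have hfun : (split : Eu 4 → Eu 2 × Eu 2) = Prod.map (WithLp.toLp 2) (WithLp.toLp 2) ∘
      (MeasurableEquiv.sumPiEquivProdPi fun _ : Fin 2 ⊕ Fin 2 => ℝ) ∘
        (MeasurableEquiv.piCongrLeft (fun _ : Fin 4 => ℝ)
          (finSumFinEquiv (m := 2) (n := 2))).symm ∘ WithLp.ofLp := rfl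
  rw [hfun]
  exact h4.comp (h3.comp (h2.comp h1))

/-! ### The fundamental square -/

theorem measurableSet_unitSquare : MeasurableSet unitSquare := by
  have : unitSquare = ⋂ a : Fin 2, (fun θ : Eu 2 => θ a) ⁻¹' Ico 0 1 := by
    ext θ; simp [unitSquare]
  rw [this]
  exact MeasurableSet.iInter fun a => measurableSet_Ico.preimage (by fun_prop)

/-- The closed unit square. -/
def closedSquare : Set (Eu 2) := (EuclideanSpace.equiv (Fin 2) ℝ) ⁻¹' (Set.pi univ fun _ => Icc 0 1)

theorem isCompact_closedSquare : IsCompact closedSquare :=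
  (EuclideanSpace.equiv (Fin 2) ℝ).toHomeomorph.isCompact_preimage.2
    (isCompact_univ_pi fun _ => isCompact_Icc)

theorem unitSquare_subset_closedSquare : unitSquare ⊆ closedSquare := by
  intro θ hθ a _
  exact Ico_subset_Icc_self (hθ a)

theorem isCompact_closure_unitSquare : IsCompact (closure unitSquare) :=
  isCompact_closedSquare.closure_of_subset unitSquare_subset_closedSquare

theorem volume_unitSquare : volume unitSquare = 1 := by
  have h := (PiLp.volume_preserving_ofLp (Fin 2)).measure_preimage
    (s := Set.pi univ fun _ : Fin 2 => Ico (0 : ℝ) 1)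
    (MeasurableSet.univ_pi fun _ => measurableSet_Ico).nullMeasurableSet
  have h2 : (WithLp.ofLp : Eu 2 → (Fin 2 → ℝ)) ⁻¹' (Set.pi univ fun _ : Fin 2 => Ico (0 : ℝ) 1) =
      unitSquare := by
    ext θ; simp [unitSquare]
  rw [h2] at h
  rw [h, Real.volume_pi_Ico]
  simp

instance isProbabilityMeasure_unitSquare :
    IsProbabilityMeasure ((volume : Measure (Eu 2)).restrict unitSquare) :=
  ⟨by simp [volume_unitSquare]⟩

theorem exists_add_latticeVec_mem (θ : Eu 2) : ∃ k, θ + latticeVec k ∈ unitSquare := by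
  refine ⟨fun a => -⌊θ a⌋, fun a => ?_⟩
  have h1 := Int.floor_le (θ a)
  have h2 := Int.lt_floor_add_one (θ a)
  constructor <;> simp [latticeVec] <;> linarith

theorem eq_of_mem_unitSquare {θ θ' : Eu 2} (h : θ ∈ unitSquare) (h' : θ' ∈ unitSquare)
    {k : Fin 2 → ℤ} (hk : θ' = θ + latticeVec k) : θ = θ' := by
  ext a
  have h1 := h a
  have h2 := h' a
  have h3 : θ' a = θ a + k a := by rw [hk]; simp [latticeVec]
  have h4 : k a = 0 := by
    have h5 : (-1 : ℝ) < k a := by linarith [h1.2, h2.1]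
    have h6 : (k a : ℝ) < 1 := by linarith [h1.1, h2.2]
    have h5' : (-1 : ℤ) < k a := by exact_mod_cast h5
    have h6' : k a < 1 := by exact_mod_cast h6
    omega
  rw [h3, h4]
  simp

/-- Each point is assigned to the member of the cover with the smallest code in `ℕ`. Integral
formulas valid over chart domains or trivializing sets are summed along such a partition. -/
theorem exists_measurable_partition {Y ι : Type*} [MeasurableSpace Y] [Countable ι] {O : ι → Set Y}
    (hO : ∀ i, MeasurableSet (O i)) {E : Set Y} (hE : MeasurableSet E) (hEO : E ⊆ ⋃ i, O i) :
    ∃ T : ι → Set Y, (∀ i, MeasurableSet (T i)) ∧ Pairwise (fun i j => Disjoint (T i) (T j)) ∧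
      ⋃ i, T i = E ∧ ∀ i, T i ⊆ O i := by
  obtain ⟨e, he⟩ := exists_injective_nat ι
  refine ⟨fun i => E ∩ (O i \ ⋃ (j) (_ : e j < e i), O j), fun i => hE.inter ((hO i).diff
    (MeasurableSet.iUnion fun j => MeasurableSet.iUnion fun _ => hO j)), ?_, ?_, fun i x hx => hx.2.1⟩
  · intro i j hij
    rw [Set.disjoint_left]
    rintro x ⟨-, hx1, hx2⟩ ⟨-, hx3, hx4⟩
    simp only [mem_iUnion, not_exists] at hx2 hx4
    rcases lt_trichotomy (e i) (e j) with h | h | h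
    · exact hx4 i h hx1
    · exact hij (he h)
    · exact hx2 j h hx3
  · ext x
    simp only [mem_iUnion]
    constructor
    · rintro ⟨i, hx⟩
      exact hx.1
    · intro hx
      have hne : (e '' {i | x ∈ O i}).Nonempty := by
        obtain ⟨i, hi⟩ := mem_iUnion.1 (hEO hx)
        exact ⟨e i, i, hi, rfl⟩
      obtain ⟨i, hi, hie⟩ := Nat.sInf_mem hne
      refine ⟨i, hx, hi, ?_⟩
      simp only [mem_iUnion, not_exists]
      intro j hj hxj
      rw [hie] at hj
      exact absurd (Nat.sInf_le (show e j ∈ e '' {i | x ∈ O i} from ⟨j, hxj, rfl⟩)) (not_le.2 hj)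

/-! ### Disintegration of the measure over a trivializing set. -/

namespace SemiflatChart

variable {M : Type*} [TopologicalSpace M] [ChartedSpace (Eu 2) M] [IsManifold 𝓘(ℝ, Eu 2) ∞ M]
  {X : Type*} [TopologicalSpace X] [ChartedSpace (Eu 4) X]
  [IsManifold 𝓘(ℝ, Eu 4) ∞ X] {pr : X → M} {gB : Metric 2 M} {gRef : BilinField 4 X} {B₀ : Set M}
  {b₀ : M} (κ : SemiflatChart pr gB gRef B₀ b₀) (x₀ : M)

/-- In split coordinates the reference matrix is block diagonal, with the base metric and the fibre
metric as blocks. -/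
theorem det_coordMatrix_gRef_split {p : Eu 2 × Eu 2} (hp : p.1 ∈ κ.baseSet x₀) :
    (coordMatrix gRef (κ.param x₀ split) (split.symm p)).det =
      (coordMatrix gB.inner (chartAt (Eu 2) x₀).symm p.1).det *
        (κ.h ((chartAt (Eu 2) x₀).symm p.1)).det := by
  have hy := κ.symm_mem_paramSet x₀ split hp
  rw [← Matrix.det_submatrix_equiv_self (finSumFinEquiv (m := 2) (n := 2)),
    ← Matrix.det_fromBlocks_zero₂₁ _ 0]
  congr 1
  ext i j
  rw [Matrix.submatrix_apply, κ.coordMatrix_gRef x₀ split hy, split.apply_symm_apply]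
  rcases i with a | a <;> rcases j with b | b
  · rw [split_basisVec_inl, split_basisVec_inl, refForm_apply, Matrix.fromBlocks_apply₁₁]
    simp [flatInner]
    rfl
  · rw [split_basisVec_inl, split_basisVec_inr, refForm_apply, Matrix.fromBlocks_apply₁₂]
    simp [flatInner]
  · rw [split_basisVec_inl, split_basisVec_inr, refForm_apply, Matrix.fromBlocks_apply₂₁]
    simp [flatInner]
  · rw [split_basisVec_inr, split_basisVec_inr, refForm_apply, Matrix.fromBlocks_apply₂₂]
    simp [flatInner, basisVec]

theorem sqrt_det_param_split (g : Metric 4 X) {p : Eu 2 × Eu 2} (hp : p.1 ∈ κ.baseSet x₀) :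
    Real.sqrt (coordMatrix g.inner (κ.param x₀ split) (split.symm p)).det =
      volRatio g.inner gRef (κ.prodParam x₀ p) * torusArea (κ.h ((chartAt (Eu 2) x₀).symm p.1)) *
        Real.sqrt (coordMatrix gB.inner (chartAt (Eu 2) x₀).symm p.1).det := by
  have hy := κ.symm_mem_paramSet x₀ split hp
  have hF := κ.isLocalParam_param x₀ split
  have h1 := (κ.posDef_coordMatrix_gRef x₀ split hy).det_pos
  have h2 := (hF.posDef g hy).det_pos
  have h3 := volRatio_param g.inner gRef (hF.injective _ hy)
  rw [κ.param_symm_apply] at h3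
  have h4 := ((isLocalParam_chart x₀).posDef gB hp.1).det_pos
  rw [h3, mul_assoc, torusArea, ← Real.sqrt_mul (κ.posDef_h _ hp.2).det_pos.le,
    ← Real.sqrt_mul (div_pos h2 h1).le, mul_comm (κ.h _).det, ← κ.det_coordMatrix_gRef_split x₀ hp,
    div_mul_cancel₀ _ h1.ne']

/-- The half-open square meets every `ℤ²`-orbit, so it covers each fibre; it meets it only once,
which gives the injectivity in `injOn_param_split`. -/
theorem image_param_split {E : Set M} (hE : E ⊆ κ.U) (hEx : E ⊆ (chartAt (Eu 2) x₀).source) :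
    κ.param x₀ split '' (split ⁻¹' (((chartAt (Eu 2) x₀).target ∩ (chartAt (Eu 2) x₀).symm ⁻¹' E) ×ˢ
      unitSquare)) = pr ⁻¹' E := by
  set c := chartAt (Eu 2) x₀
  ext x
  constructor
  · rintro ⟨y, hy, rfl⟩
    have := κ.pr_prodParam x₀ (p := split y) ⟨hy.1.1, hE hy.1.2⟩
    exact (show pr (κ.prodParam x₀ (split y)) ∈ E by rw [this]; exact hy.1.2)
  · intro hx
    obtain ⟨θ, hθ⟩ := κ.surj x (hE hx)
    obtain ⟨k, hk⟩ := exists_add_latticeVec_mem θ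
    have h1 : κ.Ψ (pr x, θ + latticeVec k) = x := by
      rw [← hθ, κ.proj _ (hE hx)]
      exact ((κ.periodic _ (hE hx) θ _).2 ⟨k, rfl⟩).symm
    refine ⟨split.symm (c (pr x), θ + latticeVec k), ?_, ?_⟩
    · refine mem_preimage.2 ?_
      rw [split.apply_symm_apply]
      refine ⟨⟨c.map_source (hEx hx), ?_⟩, hk⟩
      rw [mem_preimage, c.left_inv (hEx hx)]
      exact hx
    · rw [κ.param_symm_apply]
      simp only [prodParam]
      rw [c.left_inv (hEx hx), h1]

theorem injOn_param_split {E : Set M} (hE : E ⊆ κ.U) :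
    InjOn (κ.param x₀ split) (split ⁻¹' (((chartAt (Eu 2) x₀).target ∩
      (chartAt (Eu 2) x₀).symm ⁻¹' E) ×ˢ unitSquare)) := by
  set c := chartAt (Eu 2) x₀
  intro y hy y' hy' h
  have h0 : κ.prodParam x₀ (split y) = κ.prodParam x₀ (split y') := h
  have h1 := κ.pr_prodParam x₀ (p := split y) ⟨hy.1.1, hE hy.1.2⟩
  have h2 := κ.pr_prodParam x₀ (p := split y') ⟨hy'.1.1, hE hy'.1.2⟩
  have h3 : c.symm (split y).1 = c.symm (split y').1 := by rw [← h1, ← h2, h0]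
  have h4 : (split y).1 = (split y').1 := c.symm.injOn hy.1.1 hy'.1.1 h3
  have h5 : κ.Ψ (c.symm (split y).1, (split y).2) = κ.Ψ (c.symm (split y).1, (split y').2) := by
    have : κ.Ψ (c.symm (split y).1, (split y).2) = κ.Ψ (c.symm (split y').1, (split y').2) := h0
    rw [this, h3]
  obtain ⟨k, hk⟩ := (κ.periodic _ (hE hy.1.2) _ _).1 h5
  exact split.injective (Prod.ext h4 (eq_of_mem_unitSquare hy.2 hy'.2 hk))

variable [T2Space M] [SecondCountableTopology M] [MeasurableSpace M] [BorelSpace M]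
  [T2Space X] [SecondCountableTopology X] [MeasurableSpace X] [BorelSpace X]

/-- The disintegration of the Riemannian measure over a trivializing open set contained in the
domain of a chart. -/
theorem setLIntegral_preimage_of_subset_source (g : Metric 4 X) {E : Set M}
    (hEm : MeasurableSet E) (hE : E ⊆ κ.U) (hEx : E ⊆ (chartAt (Eu 2) x₀).source)
    {f : X → ℝ≥0∞} (hf : Measurable f) :
    ∫⁻ x in pr ⁻¹' E, f x ∂(riemannianMeasure g) =
      ∫⁻ b in E, (∫⁻ θ in unitSquare, f (κ.Ψ (b, θ)) *
        ENNReal.ofReal (volRatio g.inner gRef (κ.Ψ (b, θ)) * torusArea (κ.h b)))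
          ∂(riemannianMeasure gB) := by
  set c := chartAt (Eu 2) x₀ with hc
  set S' := c.target ∩ c.symm ⁻¹' E with hS'
  have hS'm : MeasurableSet S' := measurableSet_inter_preimage_of_continuousOn
    c.open_target.measurableSet c.continuousOn_symm hEm
  have hS'sub : S' ⊆ κ.baseSet x₀ := fun q hq => ⟨hq.1, hE hq.2⟩
  have hSm : MeasurableSet (split ⁻¹' (S' ×ˢ unitSquare)) :=
    (hS'm.prod measurableSet_unitSquare).preimage split.continuous.measurable
  have hF := κ.isLocalParam_param x₀ split
  have h1 := hF.setLIntegral_riemannianMeasure g hSm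
    (fun y hy => ⟨hS'sub hy.1, trivial⟩) (κ.injOn_param_split x₀ hE) f
  rw [κ.image_param_split x₀ hE hEx] at h1
  have h2 := (isLocalParam_chart x₀).setLIntegral_riemannianMeasure gB hS'm inter_subset_left
    (c.symm.injOn.mono inter_subset_left) (fun b => ∫⁻ θ in unitSquare, f (κ.Ψ (b, θ)) *
        ENNReal.ofReal (volRatio g.inner gRef (κ.Ψ (b, θ)) * torusArea (κ.h b)))
  rw [image_inter_preimage_chart_symm x₀ hEx] at h2
  rw [h1, h2]
  have hsub : S' ×ˢ unitSquare ⊆ κ.baseSet x₀ ×ˢ (univ : Set (Eu 2)) :=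
    prod_mono hS'sub (subset_univ _)
  have hmeas := hS'm.prod measurableSet_unitSquare
  have hPm : AEMeasurable (κ.prodParam x₀) (volume.restrict (S' ×ˢ unitSquare)) :=
    ((κ.contMDiffOn_prodParam x₀).continuousOn.mono hsub).aemeasurable hmeas
  have hVm : AEMeasurable (fun p => volRatio g.inner gRef (κ.prodParam x₀ p))
      (volume.restrict (S' ×ˢ unitSquare)) :=
    ((κ.contDiffOn_volRatio x₀ g).continuousOn.mono hsub).aemeasurable hmeas
  have hdetc : ContinuousOn (fun q => torusArea (κ.h (c.symm q))) (κ.baseSet x₀) :=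
    (contDiffOn_det (κ.contDiffOn_h x₀)).continuousOn.sqrt
  have hTm : AEMeasurable (fun p : Eu 2 × Eu 2 => torusArea (κ.h (c.symm p.1)))
      (volume.restrict (S' ×ˢ unitSquare)) :=
    ContinuousOn.aemeasurable (hdetc.comp continuousOn_fst fun p hp => hS'sub hp.1) hmeas
  have hGm : AEMeasurable (fun p : Eu 2 × Eu 2 =>
      Real.sqrt (coordMatrix gB.inner c.symm p.1).det) (volume.restrict (S' ×ˢ unitSquare)) :=
    ContinuousOn.aemeasurable ((continuousOn_sqrt_det_chart gB x₀).comp continuousOn_fst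
      fun p hp => hp.1.1) hmeas
  let Φ : Eu 2 × Eu 2 → ℝ≥0∞ := fun p => f (κ.prodParam x₀ p) * ENNReal.ofReal
    (volRatio g.inner gRef (κ.prodParam x₀ p) * torusArea (κ.h (c.symm p.1)) *
      Real.sqrt (coordMatrix gB.inner c.symm p.1).det)
  calc _ = ∫⁻ y in split ⁻¹' (S' ×ˢ unitSquare), Φ (split y) := by
        refine setLIntegral_congr_fun hSm fun y hy => ?_
        have := κ.sqrt_det_param_split x₀ g (p := split y) (hS'sub hy.1)
        rw [split.symm_apply_apply] at this
        rw [this]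
        rfl
    _ = ∫⁻ p in S' ×ˢ unitSquare, Φ p :=
        measurePreserving_split.setLIntegral_comp_preimage_emb
          split.toHomeomorph.measurableEmbedding Φ _
    _ = ∫⁻ q in S', ∫⁻ θ in unitSquare, Φ (q, θ) := by
        rw [Measure.volume_eq_prod, ← Measure.prod_restrict, lintegral_prod]
        rw [Measure.prod_restrict, ← Measure.volume_eq_prod]
        exact (hf.comp_aemeasurable hPm).mul ((hVm.mul hTm).mul hGm).ennreal_ofReal
    _ = _ := by
        refine setLIntegral_congr_fun hS'm fun q hq => ?_
        rw [← lintegral_mul_const' _ _ ENNReal.ofReal_ne_top]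
        refine lintegral_congr fun θ => ?_
        rw [mul_assoc, ← ENNReal.ofReal_mul' (Real.sqrt_nonneg _)]
        rfl

/-- The disintegration of the Riemannian measure over a trivializing open set. -/
theorem setLIntegral_preimage (g : Metric 4 X) (hpr : Measurable pr) {E : Set M}
    (hEm : MeasurableSet E) (hE : E ⊆ κ.U)
    {f : X → ℝ≥0∞} (hf : Measurable f) :
    ∫⁻ x in pr ⁻¹' E, f x ∂(riemannianMeasure g) =
      ∫⁻ b in E, (∫⁻ θ in unitSquare, f (κ.Ψ (b, θ)) *
        ENNReal.ofReal (volRatio g.inner gRef (κ.Ψ (b, θ)) * torusArea (κ.h b)))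
          ∂(riemannianMeasure gB) := by
  obtain ⟨s, hsc, hs⟩ := exists_countable_chart_cover (n := 2) (X := M)
  have hU : E ⊆ ⋃ x ∈ s, (chartAt (Eu 2) x).source := hs ▸ subset_univ _
  let _ : Countable s := hsc.to_subtype
  obtain ⟨T, hTm, hTd, hTE, hTs⟩ := exists_measurable_partition
    (fun x : s => ((chartAt (Eu 2) (x : M)).open_source.measurableSet)) hEm
    (by rw [← biUnion_eq_iUnion s fun x _ => (chartAt (Eu 2) (x : M)).source]; exact hU)
  rw [← hTE, preimage_iUnion, lintegral_iUnion (fun i => hpr (hTm i))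
    (fun i j hij => (hTd hij).preimage pr), lintegral_iUnion hTm hTd]
  refine tsum_congr fun x => ?_
  exact κ.setLIntegral_preimage_of_subset_source (x : M) g (hTm x)
    (((subset_iUnion T x).trans hTE.subset).trans hE) (hTs x) hf

end SemiflatChart

theorem measurable_indicator_of_continuousOn {Y Z : Type*} [TopologicalSpace Y]
    [MeasurableSpace Y] [BorelSpace Y] [TopologicalSpace Z] [Zero Z]
    [MeasurableSpace Z] [BorelSpace Z] {F : Y → Z} {V : Set Y} (hV : MeasurableSet V)
    (hF : ContinuousOn F V) : Measurable (V.indicator F) := by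
  intro T hT
  rw [indicator_preimage, Set.ite]
  refine (inter_comm V _ ▸ measurableSet_inter_preimage_of_continuousOn hV hF hT).union
    (MeasurableSet.diff ?_ hV)
  exact measurable_const hT

section LocallyFinite

variable {n : ℕ} {X : Type*} [TopologicalSpace X] [ChartedSpace (Eu n) X]
  [IsManifold 𝓘(ℝ, Eu n) ∞ X] [T2Space X] [SecondCountableTopology X] [MeasurableSpace X]
  [BorelSpace X]

theorem isLocallyFiniteMeasure_riemannianMeasure (g : Metric n X) :
    IsLocallyFiniteMeasure (riemannianMeasure g) := by
  have : LocallyCompactSpace X := ChartedSpace.locallyCompactSpace (Eu n) X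
  refine ⟨fun x => ?_⟩
  obtain ⟨K, hK, hx⟩ := exists_compact_mem_nhds x
  exact ⟨K, hx, riemannianMeasure_lt_top_of_isCompact g hK⟩

theorem sigmaFinite_riemannianMeasure (g : Metric n X) : SigmaFinite (riemannianMeasure g) := by
  have := isLocallyFiniteMeasure_riemannianMeasure g
  infer_instance

end LocallyFinite

/-! ### Fibre area and Haar measure do not depend on the trivialization. -/

namespace SemiflatChart

variable {M : Type*} [TopologicalSpace M] [ChartedSpace (Eu 2) M] [IsManifold 𝓘(ℝ, Eu 2) ∞ M]
  {X : Type*} [TopologicalSpace X] [ChartedSpace (Eu 4) X]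
  [IsManifold 𝓘(ℝ, Eu 4) ∞ X] {pr : X → M} {gB : Metric 2 M} {gRef : BilinField 4 X} {B₀ : Set M}
  {b₀ b₁ : M} (κ : SemiflatChart pr gB gRef B₀ b₀) (κ₁ : SemiflatChart pr gB gRef B₀ b₁) (x₀ : M)

theorem chart_mem_baseSet {b : M} (hb : b ∈ κ.U) (hx : b ∈ (chartAt (Eu 2) x₀).source) :
    chartAt (Eu 2) x₀ b ∈ κ.baseSet x₀ :=
  ⟨(chartAt (Eu 2) x₀).map_source hx, by rwa [mem_preimage, (chartAt (Eu 2) x₀).left_inv hx]⟩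

theorem prodParam_chart {b : M} (hx : b ∈ (chartAt (Eu 2) x₀).source) (θ : Eu 2) :
    κ.prodParam x₀ (chartAt (Eu 2) x₀ b, θ) = κ.Ψ (b, θ) := by
  simp [prodParam, (chartAt (Eu 2) x₀).left_inv hx]

theorem volRatio_Ψ_pos (g : Metric 4 X) {b : M} (hb : b ∈ κ.U) (θ : Eu 2) :
    0 < volRatio g.inner gRef (κ.Ψ (b, θ)) := by
  have hx := mem_chart_source (Eu 2) b
  rw [← κ.prodParam_chart b hx]
  exact κ.volRatio_pos b g (κ.chart_mem_baseSet b hb hx)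

theorem continuousAt_volRatio (g : Metric 4 X) {b : M} (hb : b ∈ κ.U) (θ : Eu 2) :
    ContinuousAt (volRatio g.inner gRef) (κ.Ψ (b, θ)) := by
  have hx := mem_chart_source (Eu 2) b
  rw [← κ.prodParam_chart b hx, ← κ.param_symm_apply b split]
  have hy := κ.symm_mem_paramSet b split (p := (chartAt (Eu 2) b b, θ))
    (κ.chart_mem_baseSet b hb hx)
  rw [(κ.isLocalParam_param b split).continuousAt_iff hy]
  exact (κ.contDiffOn_volRatio_param b g split).continuousOn.continuousAt
    ((κ.isOpen_paramSet b split).mem_nhds hy)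

theorem continuousAt_volRatio_of_mem (g : Metric 4 X) {x : X} (hx : pr x ∈ κ.U) :
    ContinuousAt (volRatio g.inner gRef) x := by
  obtain ⟨θ, hθ⟩ := κ.surj x hx
  rw [← hθ]
  exact κ.continuousAt_volRatio g hx θ

theorem volRatio_pos_of_mem (g : Metric 4 X) {x : X} (hx : pr x ∈ κ.U) :
    0 < volRatio g.inner gRef x := by
  obtain ⟨θ, hθ⟩ := κ.surj x hx
  rw [← hθ]
  exact κ.volRatio_Ψ_pos g hx θ

theorem torusArea_pos {b : M} (hb : b ∈ κ.U) : 0 < torusArea (κ.h b) :=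
  Real.sqrt_pos.2 (κ.posDef_h b hb).det_pos

theorem contMDiffOn_torusArea :
    ContMDiffOn 𝓘(ℝ, Eu 2) 𝓘(ℝ, ℝ) ∞ (fun b => torusArea (κ.h b)) κ.U := by
  intro b hb
  have h1 : ContMDiffOn 𝓘(ℝ, Eu 2) 𝓘(ℝ, ℝ) ∞ (fun b => (κ.h b).det) κ.U := by
    simp only [Matrix.det_fin_two]
    exact ((κ.smooth_h 0 0).mul (κ.smooth_h 1 1)).sub ((κ.smooth_h 0 1).mul (κ.smooth_h 1 0))
  exact (Real.contDiffAt_sqrt (κ.posDef_h b hb).det_pos.ne').contMDiffAt.comp_contMDiffWithinAt b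
    (h1 b hb)

theorem continuousAt_Ψ {b : M} (hb : b ∈ κ.U) (θ : Eu 2) : ContinuousAt κ.Ψ (b, θ) :=
  κ.smooth.continuousOn.continuousAt ((κ.isOpen.prod isOpen_univ).mem_nhds ⟨hb, trivial⟩)

theorem continuous_Ψ_fiber {b : M} (hb : b ∈ κ.U) : Continuous fun θ => κ.Ψ (b, θ) :=
  continuous_iff_continuousAt.2 fun θ => ContinuousAt.comp' (g := κ.Ψ) (f := fun θ => (b, θ))
    (κ.continuousAt_Ψ hb θ) (by fun_prop)

variable [T2Space M] [SecondCountableTopology M] [MeasurableSpace M] [BorelSpace M]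
  [T2Space X] [SecondCountableTopology X] [MeasurableSpace X] [BorelSpace X]

theorem continuousOn_fiberIntegral {f : X → ℝ} (hf : Continuous f) {K : ℝ} (hK : ∀ x, |f x| ≤ K) :
    ContinuousOn (fun b => torusArea (κ.h b) * ∫ θ in unitSquare, f (κ.Ψ (b, θ))) κ.U := by
  refine κ.contMDiffOn_torusArea.continuousOn.mul fun b hb => ?_
  refine ContinuousAt.continuousWithinAt ?_
  refine continuousAt_of_dominated (bound := fun _ => K) ?_ ?_ (integrable_const K) ?_
  · filter_upwards [κ.isOpen.mem_nhds hb] with b' hb'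
    exact (hf.comp (κ.continuous_Ψ_fiber hb')).aestronglyMeasurable
  · exact Eventually.of_forall fun b' => Eventually.of_forall fun θ => hK _
  · refine Eventually.of_forall fun θ => ?_
    exact hf.continuousAt.comp (ContinuousAt.comp' (g := κ.Ψ) (f := fun b => (b, θ))
      (κ.continuousAt_Ψ hb θ) (by fun_prop))

/-- The weighted fibre integrals of a continuous function do not depend on the trivialization. -/
theorem fiberIntegral_eq (g : Metric 4 X) (hpr : Continuous pr) {f : X → ℝ} (hf : Continuous f)
    {K : ℝ} (hK : ∀ x, |f x| ≤ K) (hf0 : ∀ x, 0 ≤ f x) {b : M} (hb : b ∈ κ.U) (hb₁ : b ∈ κ₁.U) :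
    torusArea (κ.h b) * ∫ θ in unitSquare, f (κ.Ψ (b, θ)) =
      torusArea (κ₁.h b) * ∫ θ in unitSquare, f (κ₁.Ψ (b, θ)) := by
  have := sigmaFinite_riemannianMeasure gB
  have := isOpenPosMeasure_riemannianMeasure gB
  set W := κ.U ∩ κ₁.U with hW
  have hWo : IsOpen W := κ.isOpen.inter κ₁.isOpen
  have hpW : IsOpen (pr ⁻¹' W) := hWo.preimage hpr
  -- Dividing by the volume ratio cancels it in the disintegration. The integral of `G` over the
  -- preimage of `E` is then the base integral of the weighted fibre integral in either
  -- trivialization.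
  set G : X → ℝ := (pr ⁻¹' W).indicator fun x => f x * (volRatio g.inner gRef x)⁻¹ with hG
  have hGm : Measurable G := by
    refine measurable_indicator_of_continuousOn hpW.measurableSet fun x hx => ?_
    exact (hf.continuousAt.mul ((κ.continuousAt_volRatio_of_mem g hx.1).inv₀
      (κ.volRatio_pos_of_mem g hx.1).ne')).continuousWithinAt
  have key : ∀ {b' : M} (κ' : SemiflatChart pr gB gRef B₀ b'), W ⊆ κ'.U → ∀ E, MeasurableSet E →
      E ⊆ W → ∫⁻ b in E, ENNReal.ofReal (torusArea (κ'.h b) *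
        ∫ θ in unitSquare, f (κ'.Ψ (b, θ))) ∂(riemannianMeasure gB) =
      ∫⁻ x in pr ⁻¹' E, ENNReal.ofReal (G x) ∂(riemannianMeasure g) := by
    intro b' κ' hW' E hE hEW
    rw [κ'.setLIntegral_preimage g hpr.measurable hE (hEW.trans hW') hGm.ennreal_ofReal]
    refine setLIntegral_congr_fun hE fun b hb => ?_
    have hbU := hW' (hEW hb)
    have hT := (κ'.torusArea_pos hbU).le
    rw [← integral_const_mul, ofReal_integral_eq_lintegral_ofReal]
    · refine lintegral_congr fun θ => ?_
      have hr := κ'.volRatio_Ψ_pos g hbU θ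
      have hmem : κ'.Ψ (b, θ) ∈ pr ⁻¹' W := by rw [mem_preimage, κ'.proj b hbU]; exact hEW hb
      rw [hG, indicator_of_mem hmem, ← ENNReal.ofReal_mul (mul_nonneg (hf0 _) (inv_nonneg.2 hr.le))]
      congr 1
      field_simp
    · refine Integrable.const_mul ?_ _
      refine Integrable.mono' (integrable_const K)
        (hf.comp (κ'.continuous_Ψ_fiber hbU)).aestronglyMeasurable
        (Eventually.of_forall fun θ => hK _)
    · exact Eventually.of_forall fun θ => mul_nonneg hT (hf0 _)
  have hc := (κ.continuousOn_fiberIntegral hf hK).mono (inter_subset_left (t := κ₁.U))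
  have hc₁ := (κ₁.continuousOn_fiberIntegral hf hK).mono (inter_subset_right (s := κ.U))
  have hae : (fun b => ENNReal.ofReal (torusArea (κ.h b) * ∫ θ in unitSquare, f (κ.Ψ (b, θ))))
      =ᵐ[(riemannianMeasure gB).restrict W]
      fun b => ENNReal.ofReal (torusArea (κ₁.h b) * ∫ θ in unitSquare, f (κ₁.Ψ (b, θ))) := by
    refine ae_eq_of_forall_setLIntegral_eq_of_sigmaFinite₀
      (hc.aemeasurable hWo.measurableSet).ennreal_ofReal
      (hc₁.aemeasurable hWo.measurableSet).ennreal_ofReal fun s hs _ => ?_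
    rw [Measure.restrict_restrict hs, key κ inter_subset_left _ (hs.inter hWo.measurableSet)
      inter_subset_right, key κ₁ inter_subset_right _ (hs.inter hWo.measurableSet)
      inter_subset_right]
  have heq := Measure.eqOn_open_of_ae_eq hae hWo
    (ENNReal.continuous_ofReal.comp_continuousOn hc)
    (ENNReal.continuous_ofReal.comp_continuousOn hc₁) ⟨hb, hb₁⟩
  have hnn : ∀ {b' : M} (κ' : SemiflatChart pr gB gRef B₀ b'), b ∈ κ'.U →
      0 ≤ torusArea (κ'.h b) * ∫ θ in unitSquare, f (κ'.Ψ (b, θ)) := fun κ' h =>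
    mul_nonneg (κ'.torusArea_pos h).le (integral_nonneg fun θ => hf0 _)
  exact (ENNReal.ofReal_eq_ofReal_iff (hnn κ hb) (hnn κ₁ hb₁)).1 heq

/-- The case `f = 1`. The metric `g` only provides a measure on the total space in which the two
trivializations can be compared. -/
theorem torusArea_eq (g : Metric 4 X) (hpr : Continuous pr) {b : M} (hb : b ∈ κ.U)
    (hb₁ : b ∈ κ₁.U) : torusArea (κ.h b) = torusArea (κ₁.h b) := by
  have h := fiberIntegral_eq κ κ₁ g hpr (f := fun _ => 1) continuous_const (K := 1) (by simp)
    (by simp) hb hb₁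
  simpa using h

/-- Once the areas are cancelled, the two image measures agree on bounded continuous functions, and
these determine a finite Borel measure on the metrizable space `X`. -/
theorem map_Ψ_eq (g : Metric 4 X) (hpr : Continuous pr) {b : M} (hb : b ∈ κ.U)
    (hb₁ : b ∈ κ₁.U) :
    Measure.map (fun θ => κ.Ψ (b, θ)) (volume.restrict unitSquare) =
      Measure.map (fun θ => κ₁.Ψ (b, θ)) (volume.restrict unitSquare) := by
  have : LocallyCompactSpace X := ChartedSpace.locallyCompactSpace (Eu 4) X
  have : TopologicalSpace.MetrizableSpace X := TopologicalSpace.metrizableSpace_of_t3_secondCountable X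
  let _ : MetricSpace X := TopologicalSpace.metrizableSpaceMetric X
  have hc := κ.continuous_Ψ_fiber hb
  have hc₁ := κ₁.continuous_Ψ_fiber hb₁
  have : IsFiniteMeasure (Measure.map (fun θ => κ.Ψ (b, θ)) (volume.restrict unitSquare)) :=
    Measure.isFiniteMeasure_map _ _
  refine ext_of_forall_lintegral_eq_of_IsFiniteMeasure fun f => ?_
  have hfm : Measurable fun x => ((f x : NNReal) : ℝ≥0∞) :=
    (measurable_coe_nnreal_ennreal.comp f.continuous.measurable)
  rw [lintegral_map hfm hc.measurable, lintegral_map hfm hc₁.measurable]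
  have hK : ∀ x, |((f x : NNReal) : ℝ)| ≤ nndist f 0 := by
    intro x
    have h := f.dist_coe_le_dist (g := 0) x
    simpa [NNReal.dist_eq] using h
  have hfc : Continuous fun x => ((f x : NNReal) : ℝ) := NNReal.continuous_coe.comp f.continuous
  have h := fiberIntegral_eq κ κ₁ g hpr hfc hK (fun x => NNReal.coe_nonneg _) hb hb₁
  rw [κ.torusArea_eq κ₁ g hpr hb hb₁] at h
  have h2 := mul_left_cancel₀ (κ₁.torusArea_pos hb₁).ne' h
  have key : ∀ {Φ : Eu 2 → X}, Continuous Φ → ∫⁻ θ in unitSquare, ((f (Φ θ) : NNReal) : ℝ≥0∞) =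
      ENNReal.ofReal (∫ θ in unitSquare, ((f (Φ θ) : NNReal) : ℝ)) := by
    intro Φ hΦ
    rw [ofReal_integral_eq_lintegral_ofReal]
    · exact lintegral_congr fun θ => (ENNReal.ofReal_coe_nnreal).symm
    · exact Integrable.mono' (integrable_const _) (hfc.comp hΦ).aestronglyMeasurable
        (Eventually.of_forall fun θ => hK _)
    · exact Eventually.of_forall fun θ => NNReal.coe_nonneg _
  rw [key hc, key hc₁, h2]

end SemiflatChart

/-! ### Global disintegration with respect to the Haar measures of the fibres. -/

namespace SemiflatReference

variable {M : Type*} [TopologicalSpace M] [ChartedSpace (Eu 2) M] [IsManifold 𝓘(ℝ, Eu 2) ∞ M]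
  {X : Type*} [TopologicalSpace X] [ChartedSpace (Eu 4) X]
  [IsManifold 𝓘(ℝ, Eu 4) ∞ X] {pr : X → M} {gB : Metric 2 M} {B₀ : Set M}
  [T2Space M] [SecondCountableTopology M] [MeasurableSpace M] [BorelSpace M]
  [T2Space X] [SecondCountableTopology X] [MeasurableSpace X] [BorelSpace X]
  (R : SemiflatReference pr gB B₀) (g : Metric 4 X)

theorem mem_chart (b : B₀) : (b : M) ∈ (R.chart b).U := (R.chart b).mem

/-- By definition the area at `b` is taken in the trivialization chosen for `b`, which may change
erratically with `b`. Here one trivialization serves all nearby points, and this gives smoothness.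
-/
theorem fiberArea_eq (g : Metric 4 X) (hpr : Continuous pr) (b₀ : B₀) {b : M}
    (hb : b ∈ (R.chart b₀).U) : R.fiberArea b = torusArea ((R.chart b₀).h b) := by
  have hbB := (R.chart b₀).subset hb
  rw [fiberArea, dif_pos hbB]
  exact (R.chart ⟨b, hbB⟩).torusArea_eq (R.chart b₀) g hpr (R.mem_chart ⟨b, hbB⟩) hb

theorem fiberHaar_eq (g : Metric 4 X) (hpr : Continuous pr) (b₀ : B₀) {b : M}
    (hb : b ∈ (R.chart b₀).U) : R.fiberHaar b =
      Measure.map (fun θ => (R.chart b₀).Ψ (b, θ)) (volume.restrict unitSquare) := by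
  have hbB := (R.chart b₀).subset hb
  rw [fiberHaar, dif_pos hbB]
  exact (R.chart ⟨b, hbB⟩).map_Ψ_eq (R.chart b₀) g hpr (R.mem_chart ⟨b, hbB⟩) hb

theorem fiberArea_pos {b : M} (hb : b ∈ B₀) : 0 < R.fiberArea b := by
  rw [fiberArea, dif_pos hb]
  exact (R.chart ⟨b, hb⟩).torusArea_pos (R.mem_chart ⟨b, hb⟩)

theorem contMDiffAt_fiberArea (g : Metric 4 X) (hpr : Continuous pr) {b : M} (hb : b ∈ B₀) :
    ContMDiffAt 𝓘(ℝ, Eu 2) 𝓘(ℝ, ℝ) ∞ R.fiberArea b := by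
  have hU := (R.chart ⟨b, hb⟩).isOpen.mem_nhds (R.mem_chart ⟨b, hb⟩)
  refine ((R.chart ⟨b, hb⟩).contMDiffOn_torusArea.contMDiffAt hU).congr_of_eventuallyEq ?_
  filter_upwards [hU] with b' hb'
  exact R.fiberArea_eq g hpr ⟨b, hb⟩ hb'

theorem isProbabilityMeasure_fiberHaar {b : M} (hb : b ∈ B₀) :
    IsProbabilityMeasure (R.fiberHaar b) := by
  rw [fiberHaar, dif_pos hb]
  exact Measure.isProbabilityMeasure_map
    ((R.chart ⟨b, hb⟩).continuous_Ψ_fiber (R.mem_chart ⟨b, hb⟩)).measurable.aemeasurable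

theorem fiberHaar_of_notMem {b : M} (hb : b ∉ B₀) : R.fiberHaar b = 0 := by
  rw [fiberHaar, dif_neg hb]

theorem lintegral_fiberHaar (g : Metric 4 X) (hpr : Continuous pr) (b₀ : B₀) {b : M}
    (hb : b ∈ (R.chart b₀).U) {f : X → ℝ≥0∞} (hf : Measurable f) :
    ∫⁻ x, f x ∂(R.fiberHaar b) = ∫⁻ θ in unitSquare, f ((R.chart b₀).Ψ (b, θ)) := by
  rw [R.fiberHaar_eq g hpr b₀ hb, lintegral_map hf ((R.chart b₀).continuous_Ψ_fiber hb).measurable]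

theorem integral_fiberHaar (g : Metric 4 X) (hpr : Continuous pr) (b₀ : B₀) {b : M}
    (hb : b ∈ (R.chart b₀).U) {f : X → ℝ} (hf : Measurable f) :
    ∫ x, f x ∂(R.fiberHaar b) = ∫ θ in unitSquare, f ((R.chart b₀).Ψ (b, θ)) := by
  rw [R.fiberHaar_eq g hpr b₀ hb, integral_map
    ((R.chart b₀).continuous_Ψ_fiber hb).measurable.aemeasurable hf.aestronglyMeasurable]

theorem ae_fiberHaar_pr (hpr : Continuous pr) (b : M) : ∀ᵐ x ∂(R.fiberHaar b), pr x = b := by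
  by_cases hb : b ∈ B₀
  · rw [fiberHaar, dif_pos hb]
    have hU := R.mem_chart ⟨b, hb⟩
    exact (ae_map_iff (p := fun x => pr x = b)
      ((R.chart ⟨b, hb⟩).continuous_Ψ_fiber hU).measurable.aemeasurable
      (hpr.measurable (measurableSet_singleton b))).2
      (Eventually.of_forall fun θ => (R.chart ⟨b, hb⟩).proj b hU θ)
  · rw [R.fiberHaar_of_notMem hb]
    simp

theorem exists_countable_cover : ∃ s : Set B₀, s.Countable ∧ B₀ ⊆ ⋃ b ∈ s, (R.chart b).U := by
  obtain ⟨s, hs, h⟩ := TopologicalSpace.isOpen_biUnion_countable (univ : Set B₀)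
    (fun b => (R.chart b).U) (fun b _ => (R.chart b).isOpen)
  refine ⟨s, h.1, ?_⟩
  rw [h.2]
  intro b hb
  exact mem_biUnion (mem_univ (⟨b, hb⟩ : B₀)) (R.mem_chart ⟨b, hb⟩)

/-- Over one trivializing set, the measure of `s` is a parametric integral of an indicator,
measurable by Tonelli. Countably many such sets cover `B₀`, and the measure is zero elsewhere. -/
theorem measurable_fiberHaar (g : Metric 4 X) (hB₀ : IsOpen B₀) (hpr : Continuous pr) :
    Measurable R.fiberHaar := by
  refine Measure.measurable_of_measurable_coe _ fun s hs => ?_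
  obtain ⟨t, ht, hcov⟩ := R.exists_countable_cover
  intro T hT
  have hloc : ∀ b₀ : B₀, MeasurableSet ((R.chart b₀).U ∩ (fun b => R.fiberHaar b s) ⁻¹' T) := by
    intro b₀
    set κ := R.chart b₀
    have h1 : Measurable ((κ.U ×ˢ (univ : Set (Eu 2))).indicator
        ((fun x => s.indicator (1 : X → ℝ≥0∞) x) ∘ κ.Ψ)) := by
      have hm : MeasurableSet (κ.U ×ˢ (univ : Set (Eu 2))) :=
        (κ.isOpen.prod isOpen_univ).measurableSet
      intro T' hT'
      rw [indicator_preimage, Set.ite]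
      refine MeasurableSet.union ?_ (MeasurableSet.diff (measurable_const hT') hm)
      rw [inter_comm, preimage_comp]
      exact measurableSet_inter_preimage_of_continuousOn hm κ.smooth.continuousOn
        ((measurable_one.indicator hs) hT')
    have h2 : Measurable fun b => ∫⁻ θ in unitSquare, ((κ.U ×ˢ (univ : Set (Eu 2))).indicator
        ((fun x => s.indicator (1 : X → ℝ≥0∞) x) ∘ κ.Ψ)) (b, θ) := h1.lintegral_prod_right'
    have h3 : κ.U ∩ (fun b => R.fiberHaar b s) ⁻¹' T = κ.U ∩ (fun b => ∫⁻ θ in unitSquare,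
        ((κ.U ×ˢ (univ : Set (Eu 2))).indicator
          ((fun x => s.indicator (1 : X → ℝ≥0∞) x) ∘ κ.Ψ)) (b, θ)) ⁻¹' T := by
      ext b
      simp only [mem_inter_iff, mem_preimage]
      refine and_congr_right fun hb => ?_
      rw [← lintegral_indicator_one hs,
        R.lintegral_fiberHaar g hpr b₀ hb (measurable_one.indicator hs)]
      have : ∀ θ, ((κ.U ×ˢ (univ : Set (Eu 2))).indicator
          ((fun x => s.indicator (1 : X → ℝ≥0∞) x) ∘ κ.Ψ)) (b, θ) =
          s.indicator (1 : X → ℝ≥0∞) (κ.Ψ (b, θ)) := fun θ =>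
        indicator_of_mem (show (b, θ) ∈ κ.U ×ˢ (univ : Set (Eu 2)) from ⟨hb, trivial⟩) _
      simp only [this]
      rfl
    rw [h3]
    exact κ.isOpen.measurableSet.inter (h2 hT)
  have hsplit : (fun b => R.fiberHaar b s) ⁻¹' T =
      (⋃ b ∈ t, (R.chart b).U ∩ (fun b => R.fiberHaar b s) ⁻¹' T) ∪
        (B₀ᶜ ∩ (fun _ => (0 : ℝ≥0∞)) ⁻¹' T) := by
    ext b
    simp only [mem_union, mem_iUnion, mem_inter_iff, mem_preimage]
    constructor
    · intro h
      by_cases hb : b ∈ B₀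
      · obtain ⟨b₀, hb₀, hbU⟩ := mem_iUnion₂.1 (hcov hb)
        exact Or.inl ⟨b₀, hb₀, hbU, h⟩
      · rw [R.fiberHaar_of_notMem hb] at h
        exact Or.inr ⟨hb, h⟩
    · rintro (⟨b₀, -, -, h⟩ | ⟨hb, h⟩)
      · exact h
      · rw [R.fiberHaar_of_notMem hb]
        exact h
  rw [hsplit]
  exact (MeasurableSet.biUnion ht fun b _ => hloc b).union
    (hB₀.measurableSet.compl.inter (measurable_const hT))

/-- The density of the Riemannian measure with respect to the fibrewise Haar measures and the
measure of the base. -/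
def density (x : X) : ℝ :=
  (pr ⁻¹' B₀).indicator (fun x => volRatio g.inner R.gRef x * R.fiberArea (pr x)) x

theorem density_of_mem {x : X} (hx : pr x ∈ B₀) :
    R.density g x = volRatio g.inner R.gRef x * R.fiberArea (pr x) :=
  indicator_of_mem (show x ∈ pr ⁻¹' B₀ from hx) _

theorem density_pos {x : X} (hx : pr x ∈ B₀) : 0 < R.density g x := by
  rw [R.density_of_mem g hx]
  exact mul_pos ((R.chart ⟨pr x, hx⟩).volRatio_pos_of_mem g (R.mem_chart ⟨pr x, hx⟩))
    (R.fiberArea_pos hx)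

theorem density_nonneg (x : X) : 0 ≤ R.density g x := by
  by_cases hx : pr x ∈ B₀
  · exact (R.density_pos g hx).le
  · rw [density, indicator_of_notMem (show x ∉ pr ⁻¹' B₀ from hx)]

theorem measurable_density (hB₀ : IsOpen B₀) (hpr : Continuous pr) : Measurable (R.density g) := by
  refine measurable_indicator_of_continuousOn (hB₀.preimage hpr).measurableSet fun x hx => ?_
  refine ContinuousAt.continuousWithinAt (ContinuousAt.mul ?_ ?_)
  · exact (R.chart ⟨pr x, hx⟩).continuousAt_volRatio_of_mem g (R.mem_chart ⟨pr x, hx⟩)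
  · exact (R.contMDiffAt_fiberArea g hpr hx).continuousAt.comp hpr.continuousAt

theorem density_Ψ (hpr : Continuous pr) (b₀ : B₀) {b : M} (hb : b ∈ (R.chart b₀).U) (θ : Eu 2) :
    R.density g ((R.chart b₀).Ψ (b, θ)) =
      volRatio g.inner R.gRef ((R.chart b₀).Ψ (b, θ)) * torusArea ((R.chart b₀).h b) := by
  rw [R.density_of_mem g (by rw [(R.chart b₀).proj b hb]; exact (R.chart b₀).subset hb),
    (R.chart b₀).proj b hb, R.fiberArea_eq g hpr b₀ hb]

/-- The disintegration of the Riemannian measure. -/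
theorem setLIntegral_riemannianMeasure (hB₀ : IsOpen B₀) (hpr : Continuous pr)
    {f : X → ℝ≥0∞} (hf : Measurable f) :
    ∫⁻ x in pr ⁻¹' B₀, f x ∂(riemannianMeasure g) =
      ∫⁻ b in B₀, ∫⁻ x, f x * ENNReal.ofReal (R.density g x) ∂(R.fiberHaar b)
        ∂(riemannianMeasure gB) := by
  obtain ⟨s, hsc, hs⟩ := R.exists_countable_cover
  let _ : Countable s := hsc.to_subtype
  obtain ⟨T, hTm, hTd, hTE, hTs⟩ := exists_measurable_partition
    (fun b : s => (R.chart (b : B₀)).isOpen.measurableSet) hB₀.measurableSet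
    (by rw [← biUnion_eq_iUnion s fun b _ => (R.chart (b : B₀)).U]; exact hs)
  have hsum : ∀ F : M → ℝ≥0∞, ∫⁻ b in B₀, F b ∂(riemannianMeasure gB) =
      ∑' i, ∫⁻ b in T i, F b ∂(riemannianMeasure gB) := by
    intro F
    conv_lhs => rw [← hTE]
    exact lintegral_iUnion hTm hTd F
  have hsum' : ∫⁻ x in pr ⁻¹' B₀, f x ∂(riemannianMeasure g) =
      ∑' i, ∫⁻ x in pr ⁻¹' (T i), f x ∂(riemannianMeasure g) := by
    conv_lhs => rw [← hTE, preimage_iUnion]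
    exact lintegral_iUnion (fun i => hpr.measurable (hTm i))
      (fun i j hij => (hTd hij).preimage pr) f
  rw [hsum, hsum']
  refine tsum_congr fun i => ?_
  rw [(R.chart (i : B₀)).setLIntegral_preimage g hpr.measurable (hTm i) (hTs i) hf]
  refine setLIntegral_congr_fun (hTm i) fun b hb => ?_
  have hbU := hTs i hb
  refine Eq.trans ?_ (R.lintegral_fiberHaar g hpr i hbU
    (f := fun x => f x * ENNReal.ofReal (R.density g x))
    (hf.mul (R.measurable_density g hB₀ hpr).ennreal_ofReal)).symm
  exact lintegral_congr fun θ => by rw [R.density_Ψ g hpr i hbU]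

/-- The measure on the total space given by the measure of the base and the Haar probability
measures of the fibres. -/
def haarMeasure : Measure X := ((riemannianMeasure gB).restrict B₀).bind R.fiberHaar

theorem lintegral_haarMeasure (g : Metric 4 X) (hB₀ : IsOpen B₀) (hpr : Continuous pr)
    {f : X → ℝ≥0∞} (hf : Measurable f) :
    ∫⁻ x, f x ∂(R.haarMeasure) = ∫⁻ b in B₀, ∫⁻ x, f x ∂(R.fiberHaar b) ∂(riemannianMeasure gB) :=
  Measure.lintegral_bind (R.measurable_fiberHaar g hB₀ hpr).aemeasurable hf.aemeasurable

theorem isFiniteMeasure_haarMeasure (g : Metric 4 X) (hB₀ : IsOpen B₀)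
    (hB₀c : IsCompact (closure B₀)) (hpr : Continuous pr) : IsFiniteMeasure R.haarMeasure := by
  refine ⟨?_⟩
  have h := R.lintegral_haarMeasure g hB₀ hpr measurable_one
  simp only [Pi.one_apply, lintegral_one] at h
  rw [h, setLIntegral_congr_fun (g := fun _ => 1) hB₀.measurableSet
    (fun b hb => (R.isProbabilityMeasure_fiberHaar hb).measure_univ)]
  simp only [lintegral_one, Measure.restrict_apply_univ]
  exact (measure_mono subset_closure).trans_lt (riemannianMeasure_lt_top_of_isCompact gB hB₀c)

/-- In this form the disintegration is a density with respect to one fixed measure, so the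
uniqueness of `A` and `ρ` becomes uniqueness of densities. -/
theorem restrict_riemannianMeasure_eq (hB₀ : IsOpen B₀) (hpr : Continuous pr) :
    (riemannianMeasure g).restrict (pr ⁻¹' B₀) =
      R.haarMeasure.withDensity fun x => ENNReal.ofReal (R.density g x) := by
  have hd := (R.measurable_density g hB₀ hpr).ennreal_ofReal
  refine Measure.ext_of_lintegral _ fun f hf => ?_
  rw [R.setLIntegral_riemannianMeasure g hB₀ hpr hf, lintegral_withDensity_eq_lintegral_mul _ hd hf,
    R.lintegral_haarMeasure g hB₀ hpr (hd.mul hf)]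
  simp only [Pi.mul_apply, mul_comm]

end SemiflatReference

/-! ### Smoothness and gradient bounds read in the preferred chart. -/

section ChartForm

variable {n : ℕ} {M : Type*} [TopologicalSpace M] [ChartedSpace (Eu n) M]
  [IsManifold 𝓘(ℝ, Eu n) ∞ M]

theorem contMDiffAt_of_comp_chart_symm {φ : M → ℝ} {b : M}
    (h : ContDiffAt ℝ ∞ (φ ∘ (chartAt (Eu n) b).symm) (chartAt (Eu n) b b)) :
    ContMDiffAt 𝓘(ℝ, Eu n) 𝓘(ℝ, ℝ) ∞ φ b := by
  have hb := mem_chart_source (Eu n) b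
  have h1 : ContMDiffAt 𝓘(ℝ, Eu n) 𝓘(ℝ, ℝ) ∞
      ((φ ∘ (chartAt (Eu n) b).symm) ∘ chartAt (Eu n) b) b :=
    ContMDiffAt.comp b h.contMDiffAt (contMDiffAt_of_mem_maximalAtlas
      (IsManifold.chart_mem_maximalAtlas b) hb)
  refine h1.congr_of_eventuallyEq ?_
  filter_upwards [(chartAt (Eu n) b).open_source.mem_nhds hb] with z hz
  simp [(chartAt (Eu n) b).left_inv hz]

theorem contDiffAt_comp_chart_symm {φ : M → ℝ} {b : M}
    (h : ContMDiffAt 𝓘(ℝ, Eu n) 𝓘(ℝ, ℝ) ∞ φ b) :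
    ContDiffAt ℝ ∞ (φ ∘ (chartAt (Eu n) b).symm) (chartAt (Eu n) b b) := by
  have hb := mem_chart_source (Eu n) b
  have h1 : ContMDiffAt 𝓘(ℝ, Eu n) 𝓘(ℝ, Eu n) ∞ (chartAt (Eu n) b).symm (chartAt (Eu n) b b) :=
    (isLocalParam_chart b).smooth.contMDiffAt
      ((chartAt (Eu n) b).open_target.mem_nhds ((chartAt (Eu n) b).map_source hb))
  refine ContMDiffAt.contDiffAt ?_
  refine ContMDiffAt.comp _ ?_ h1
  rwa [(chartAt (Eu n) b).left_inv hb]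

end ChartForm

section BaseNorm

variable {M : Type*} [TopologicalSpace M] [ChartedSpace (Eu 2) M]
  [IsManifold 𝓘(ℝ, Eu 2) ∞ M] (gB : Metric 2 M)

theorem abs_fderiv_comp_chart_symm_le {φ : M → ℝ} {b : M} {K : ℝ}
    (hφ : MDifferentiableAt 𝓘(ℝ, Eu 2) 𝓘(ℝ, ℝ) φ b)
    (h : ∀ ξ : Tan 2 b, |differential φ b ξ| ≤ K * Real.sqrt (gB.inner b ξ ξ)) (e : Eu 2) :
    |fderiv ℝ (φ ∘ (chartAt (Eu 2) b).symm) (chartAt (Eu 2) b b) e| ≤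
      K * SemiflatChart.baseNorm gB b (chartAt (Eu 2) b b) e := by
  have hb := mem_chart_source (Eu 2) b
  set q := chartAt (Eu 2) b b with hq
  have hqb : (chartAt (Eu 2) b).symm q = b := (chartAt (Eu 2) b).left_inv hb
  have hφ' : MDifferentiableAt 𝓘(ℝ, Eu 2) 𝓘(ℝ, ℝ) φ ((chartAt (Eu 2) b).symm q) := by rwa [hqb]
  rw [differential_comp_param hφ' ((isLocalParam_chart b).mdifferentiableAt
    ((chartAt (Eu 2) b).map_source hb)) e]
  -- The point `(chartAt (Eu 2) b).symm q` equals `b` only propositionally, so the bound is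
  -- transported between the two tangent spaces.
  have h' : ∀ z, z = b → ∀ ξ : Tan 2 z, |differential φ z ξ| ≤ K * Real.sqrt (gB.inner z ξ ξ) := by
    rintro z rfl
    exact h
  exact h' _ hqb _

theorem gradSq_le_of_fderiv_comp_chart_symm {φ : M → ℝ} {b : M} {K : ℝ}
    (hφ : MDifferentiableAt 𝓘(ℝ, Eu 2) 𝓘(ℝ, ℝ) φ b)
    (h : ∀ e, |fderiv ℝ (φ ∘ (chartAt (Eu 2) b).symm) (chartAt (Eu 2) b b) e| ≤
      K * SemiflatChart.baseNorm gB b (chartAt (Eu 2) b b) e) : gradSq gB φ b ≤ K ^ 2 := by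
  have hb := mem_chart_source (Eu 2) b
  set q := chartAt (Eu 2) b b with hq
  have hqb : (chartAt (Eu 2) b).symm q = b := (chartAt (Eu 2) b).left_inv hb
  have hφ' : MDifferentiableAt 𝓘(ℝ, Eu 2) 𝓘(ℝ, ℝ) φ ((chartAt (Eu 2) b).symm q) := by rwa [hqb]
  have hqt : q ∈ (chartAt (Eu 2) b).target := (chartAt (Eu 2) b).map_source hb
  have hinj : Function.Injective (modelDeriv (chartAt (Eu 2) b).symm q) :=
    (isLocalParam_chart b).injective q hqt
  have hsurj : Function.Surjective (modelDeriv (chartAt (Eu 2) b).symm q) :=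
    (LinearMap.injective_iff_surjective
      (f := (modelDeriv (chartAt (Eu 2) b).symm q).toLinearMap)).1 hinj
  have key : gradSq gB φ ((chartAt (Eu 2) b).symm q) ≤ K ^ 2 := by
    refine gradSq_le_sq gB φ _ fun w => ?_
    obtain ⟨e, he⟩ := hsurj w
    have := h e
    rw [differential_comp_param hφ' ((isLocalParam_chart b).mdifferentiableAt hqt) e] at this
    rw [← he]
    exact this
  rwa [hqb] at key

theorem baseNorm_nonneg (b : M) (q e : Eu 2) : 0 ≤ SemiflatChart.baseNorm gB b q e :=
  Real.sqrt_nonneg _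

end BaseNorm

/-- The derivative of `f / √m` when the logarithmic derivative of `m` is small. -/
theorem abs_fderiv_inv_sqrt_mul_le {E : Type*} [NormedAddCommGroup E] [NormedSpace ℝ E]
    {m f : E → ℝ} {q : E} (hm : DifferentiableAt ℝ m q) (hf : DifferentiableAt ℝ f q)
    (hpos : 0 < m q) {e : E} {S N δ : ℝ} (h1 : |fderiv ℝ m q e| ≤ δ * m q * N)
    (h2 : |fderiv ℝ f q e| ≤ S * N) :
    |fderiv ℝ (fun z => (Real.sqrt (m z))⁻¹ * f z) q e| ≤
      (Real.sqrt (m q))⁻¹ * (S + δ / 2 * |f q|) * N := by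
  have hs := Real.sqrt_pos.2 hpos
  have hd : HasFDerivAt (fun z => (Real.sqrt (m z))⁻¹ * f z) _ q :=
    ((hasDerivAt_inv hs.ne').comp_hasFDerivAt q (hm.hasFDerivAt.sqrt hpos.ne')).mul
      hf.hasFDerivAt
  rw [hd.fderiv]
  set s := Real.sqrt (m q) with hsdef
  have hss : m q = s ^ 2 := (Real.sq_sqrt hpos.le).symm
  -- With `m = s²` the derivative of `m^(-1/2)` is `-m' / (2 s³)`; this is the source of `δ / 2` in
  -- the bound.
  have e1 : ((s⁻¹ • fderiv ℝ f q + f q • (-(s ^ 2)⁻¹ • (1 / (2 * s)) • fderiv ℝ m q)) : E →L[ℝ] ℝ) e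
      = s⁻¹ * fderiv ℝ f q e - f q * (fderiv ℝ m q e / (2 * s ^ 3)) := by
    simp only [_root_.add_apply, FunLike.coe_smul, Pi.smul_apply, smul_eq_mul]
    field_simp
    ring
  refine (congrArg abs e1).le.trans ?_
  have h3 : |s⁻¹ * fderiv ℝ f q e| ≤ s⁻¹ * (S * N) := by
    rw [abs_mul, abs_of_pos (inv_pos.2 hs)]
    exact mul_le_mul_of_nonneg_left h2 (inv_pos.2 hs).le
  have h4 : |f q * (fderiv ℝ m q e / (2 * s ^ 3))| ≤ s⁻¹ * (δ / 2 * |f q| * N) := by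
    rw [abs_mul, abs_div, abs_of_pos (show 0 < 2 * s ^ 3 by positivity)]
    have : |fderiv ℝ m q e| / (2 * s ^ 3) ≤ δ * m q * N / (2 * s ^ 3) := by gcongr
    calc _ ≤ |f q| * (δ * m q * N / (2 * s ^ 3)) := by gcongr
      _ = _ := by
        rw [hss]
        field_simp
  calc _ ≤ |s⁻¹ * fderiv ℝ f q e| + |f q * (fderiv ℝ m q e / (2 * s ^ 3))| := abs_sub _ _
    _ ≤ s⁻¹ * (S * N) + s⁻¹ * (δ / 2 * |f q| * N) := add_le_add h3 h4
    _ = _ := by ring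

/-- Cauchy-Schwarz with weight `J`, as nonnegativity of a variance: the integral of `(Z - t)² J` is
expanded at the weighted mean `t`. -/
theorem sq_integral_mul_le {α : Type*} [MeasurableSpace α] {μ : Measure α} {Z J : α → ℝ}
    (hJ : Integrable J μ) (hZJ : Integrable (fun x => Z x * J x) μ)
    (hZZJ : Integrable (fun x => Z x ^ 2 * J x) μ) (hJ0 : ∀ x, 0 ≤ J x) (hm : 0 < ∫ x, J x ∂μ) :
    (∫ x, J x ∂μ)⁻¹ * (∫ x, Z x * J x ∂μ) ^ 2 ≤ ∫ x, Z x ^ 2 * J x ∂μ := by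
  set m := ∫ x, J x ∂μ
  set t := m⁻¹ * ∫ x, Z x * J x ∂μ with ht
  have h0 : 0 ≤ ∫ x, (Z x - t) ^ 2 * J x ∂μ :=
    integral_nonneg fun x => mul_nonneg (sq_nonneg _) (hJ0 x)
  have h1 : ∫ x, (Z x - t) ^ 2 * J x ∂μ =
      ∫ x, Z x ^ 2 * J x ∂μ - 2 * t * (∫ x, Z x * J x ∂μ) + t ^ 2 * m := by
    rw [← integral_const_mul, ← integral_const_mul, ← integral_sub hZZJ (hZJ.const_mul _),
      ← integral_add (f := fun x => Z x ^ 2 * J x - 2 * t * (Z x * J x))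
        (hZZJ.sub (hZJ.const_mul _)) (hJ.const_mul _)]
    exact integral_congr_ae (Eventually.of_forall fun x => by simp only; ring)
  have h2 : ∫ x, Z x * J x ∂μ = m * t := by rw [ht]; field_simp
  rw [h1, h2] at h0
  rw [h2]
  have : m⁻¹ * (m * t) ^ 2 = m * t ^ 2 := by field_simp
  nlinarith

/-! ### Fibre integrals and fibre masses as smooth functions of the base point. -/

namespace SemiflatReference

variable {M : Type*} [TopologicalSpace M] [ChartedSpace (Eu 2) M] [IsManifold 𝓘(ℝ, Eu 2) ∞ M]
  {X : Type*} [TopologicalSpace X] [ChartedSpace (Eu 4) X]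
  [IsManifold 𝓘(ℝ, Eu 4) ∞ X] {pr : X → M} {gB : Metric 2 M} {B₀ : Set M}
  [T2Space M] [SecondCountableTopology M] [MeasurableSpace M] [BorelSpace M]
  [T2Space X] [SecondCountableTopology X] [MeasurableSpace X] [BorelSpace X]
  (R : SemiflatReference pr gB B₀) (g : Metric 4 X)

theorem integrable_fiberHaar {b : M} (hb : b ∈ B₀) {f : X → ℝ} (hf : Measurable f)
    (hc : ∀ x, pr x = b → ContinuousAt f x) : Integrable f (R.fiberHaar b) := by
  rw [fiberHaar, dif_pos hb]
  set κ := R.chart ⟨b, hb⟩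
  have hU : b ∈ κ.U := R.mem_chart ⟨b, hb⟩
  have hΨ := κ.continuous_Ψ_fiber hU
  refine (integrable_map_measure hf.aestronglyMeasurable hΨ.measurable.aemeasurable).2 ?_
  have hcont : Continuous (f ∘ fun θ => κ.Ψ (b, θ)) := continuous_iff_continuousAt.2 fun θ =>
    ContinuousAt.comp (hc _ (κ.proj b hU θ)) hΨ.continuousAt
  exact (hcont.continuousOn.integrableOn_compact isCompact_closure_unitSquare).mono_set
    subset_closure

theorem continuousAt_density (hB₀ : IsOpen B₀) (hpr : Continuous pr) {x : X} (hx : pr x ∈ B₀) :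
    ContinuousAt (R.density g) x := by
  refine (ContinuousAt.mul ((R.chart ⟨pr x, hx⟩).continuousAt_volRatio_of_mem g
    (R.mem_chart ⟨pr x, hx⟩)) ((R.contMDiffAt_fiberArea g hpr hx).continuousAt.comp
      hpr.continuousAt)).congr ?_
  filter_upwards [(hB₀.preimage hpr).mem_nhds hx] with z hz
  exact (R.density_of_mem g hz).symm

theorem integrable_mul_density (hB₀ : IsOpen B₀) (hpr : Continuous pr) {b : M} (hb : b ∈ B₀)
    {f : X → ℝ} (hf : Continuous f) :
    Integrable (fun x => f x * R.density g x) (R.fiberHaar b) :=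
  R.integrable_fiberHaar hb (hf.measurable.mul (R.measurable_density g hB₀ hpr)) fun x hx =>
    hf.continuousAt.mul (R.continuousAt_density g hB₀ hpr (by rwa [hx]))

theorem integrable_density (hB₀ : IsOpen B₀) (hpr : Continuous pr) {b : M} (hb : b ∈ B₀) :
    Integrable (R.density g) (R.fiberHaar b) := by
  simpa using R.integrable_mul_density g hB₀ hpr hb (continuous_const (y := (1 : ℝ)))

/-- The integral of a function over the fibre with respect to the disintegrated measure. -/
def fiberInt (w : X → ℝ) (b : M) : ℝ := ∫ x, w x * R.density g x ∂(R.fiberHaar b)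

/-- The mass of the fibre. -/
def fiberMass (b : M) : ℝ := ∫ x, R.density g x ∂(R.fiberHaar b)

theorem fiberInt_one : R.fiberInt g (fun _ => 1) = R.fiberMass g := by
  funext b
  simp [fiberInt, fiberMass]

theorem fiberMass_pos (hB₀ : IsOpen B₀) (hpr : Continuous pr) {b : M} (hb : b ∈ B₀) :
    0 < R.fiberMass g b := by
  have := R.isProbabilityMeasure_fiberHaar hb
  rw [fiberMass, integral_pos_iff_support_of_nonneg (R.density_nonneg g)
    (R.integrable_density g hB₀ hpr hb)]
  have h : ∀ᵐ x ∂(R.fiberHaar b), x ∈ Function.support (R.density g) := by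
    filter_upwards [R.ae_fiberHaar_pr hpr b] with x hx
    exact (R.density_pos g (by rwa [hx])).ne'
  have h1 : R.fiberHaar b (Function.support (R.density g)) = 1 := by
    rw [← measure_univ (μ := R.fiberHaar b)]
    exact measure_congr (eventuallyEq_univ.2 h)
  rw [h1]
  exact one_pos

theorem ofReal_fiberMass (hB₀ : IsOpen B₀) (hpr : Continuous pr) {b : M} (hb : b ∈ B₀) :
    ENNReal.ofReal (R.fiberMass g b) = ∫⁻ x, ENNReal.ofReal (R.density g x) ∂(R.fiberHaar b) :=
  ofReal_integral_eq_lintegral_ofReal (R.integrable_density g hB₀ hpr hb)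
    (Eventually.of_forall (R.density_nonneg g))

theorem measurable_fiberMass (hB₀ : IsOpen B₀) (hpr : Continuous pr) :
    Measurable (R.fiberMass g) := by
  have hd := R.measurable_density g hB₀ hpr
  have h : R.fiberMass g = fun b =>
      (∫⁻ x, ENNReal.ofReal (R.density g x) ∂(R.fiberHaar b)).toReal := funext fun b =>
    integral_eq_lintegral_of_nonneg_ae (Eventually.of_forall (R.density_nonneg g))
      hd.aestronglyMeasurable
  rw [h]
  exact ((Measure.measurable_lintegral hd.ennreal_ofReal).comp
    (R.measurable_fiberHaar g hB₀ hpr)).ennreal_toReal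

/-- The moving fibre is replaced by a fixed square with Lebesgue measure, so that the integral can
be differentiated under the sign. -/
theorem fiberInt_comp_chart_symm (hB₀ : IsOpen B₀) (hpr : Continuous pr) (b₀ : B₀) (x₀ : M)
    {w : X → ℝ} (hw : Measurable w) {q : Eu 2} (hq : q ∈ (R.chart b₀).baseSet x₀) :
    R.fiberInt g w ((chartAt (Eu 2) x₀).symm q) =
      torusArea ((R.chart b₀).h ((chartAt (Eu 2) x₀).symm q)) * ∫ θ in unitSquare,
        w ((R.chart b₀).prodParam x₀ (q, θ)) *
          volRatio g.inner R.gRef ((R.chart b₀).prodParam x₀ (q, θ)) := by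
  refine (R.integral_fiberHaar g hpr b₀ hq.2 (f := fun x => w x * R.density g x)
    (hw.mul (R.measurable_density g hB₀ hpr))).trans ?_
  rw [← integral_const_mul]
  refine integral_congr_ae (Eventually.of_forall fun θ => ?_)
  have h := R.density_Ψ g hpr b₀ hq.2 θ
  have h' : (R.chart b₀).prodParam x₀ (q, θ) =
    (R.chart b₀).Ψ ((chartAt (Eu 2) x₀).symm q, θ) := rfl
  simp only [h', h]
  ring

theorem contDiffOn_torusArea_comp (b₀ : B₀) (x₀ : M) :
    ContDiffOn ℝ ∞ (fun q => torusArea ((R.chart b₀).h ((chartAt (Eu 2) x₀).symm q)))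
      ((R.chart b₀).baseSet x₀) :=
  ContDiffOn.sqrt (contDiffOn_det ((R.chart b₀).contDiffOn_h x₀)) fun _ hq =>
    ((R.chart b₀).posDef_h _ hq.2).det_pos.ne'

theorem contDiffOn_mul_volRatio (b₀ : B₀) (x₀ : M) {w : X → ℝ}
    (hw : ContMDiff 𝓘(ℝ, Eu 4) 𝓘(ℝ, ℝ) ∞ w) :
    ContDiffOn ℝ ∞ (fun p => w ((R.chart b₀).prodParam x₀ p) *
      volRatio g.inner R.gRef ((R.chart b₀).prodParam x₀ p))
        ((R.chart b₀).baseSet x₀ ×ˢ univ) :=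
  ContDiffOn.mul (hw.comp_contMDiffOn ((R.chart b₀).contMDiffOn_prodParam x₀)).contDiffOn
    ((R.chart b₀).contDiffOn_volRatio x₀ g)

theorem contDiffOn_fiberInt (hB₀ : IsOpen B₀) (hpr : Continuous pr) (b₀ : B₀) (x₀ : M)
    {w : X → ℝ} (hw : ContMDiff 𝓘(ℝ, Eu 4) 𝓘(ℝ, ℝ) ∞ w) :
    ContDiffOn ℝ ∞ (R.fiberInt g w ∘ (chartAt (Eu 2) x₀).symm) ((R.chart b₀).baseSet x₀) := by
  refine ((R.contDiffOn_torusArea_comp b₀ x₀).mul (contDiffOn_setIntegral_param (μ := volume)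
    ((R.chart b₀).isOpen_baseSet x₀) measurableSet_unitSquare isCompact_closure_unitSquare
      (R.contDiffOn_mul_volRatio g b₀ x₀ hw))).congr fun q hq => ?_
  exact R.fiberInt_comp_chart_symm g hB₀ hpr b₀ x₀ hw.continuous.measurable hq

theorem contMDiffAt_fiberInt (hB₀ : IsOpen B₀) (hpr : Continuous pr) {b : M} (hb : b ∈ B₀)
    {w : X → ℝ} (hw : ContMDiff 𝓘(ℝ, Eu 4) 𝓘(ℝ, ℝ) ∞ w) :
    ContMDiffAt 𝓘(ℝ, Eu 2) 𝓘(ℝ, ℝ) ∞ (R.fiberInt g w) b :=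
  contMDiffAt_of_comp_chart_symm ((R.contDiffOn_fiberInt g hB₀ hpr ⟨b, hb⟩ b hw).contDiffAt
    (((R.chart ⟨b, hb⟩).isOpen_baseSet b).mem_nhds
      ((R.chart ⟨b, hb⟩).chart_mem_baseSet b (R.mem_chart ⟨b, hb⟩) (mem_chart_source _ b))))

theorem contMDiffAt_fiberMass (hB₀ : IsOpen B₀) (hpr : Continuous pr) {b : M} (hb : b ∈ B₀) :
    ContMDiffAt 𝓘(ℝ, Eu 2) 𝓘(ℝ, ℝ) ∞ (R.fiberMass g) b :=
  R.fiberInt_one g ▸ R.contMDiffAt_fiberInt g hB₀ hpr hb contMDiff_const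

end SemiflatReference

section L2Norm

variable {n : ℕ} {X : Type*} [TopologicalSpace X] [ChartedSpace (Eu n) X]
  [IsManifold 𝓘(ℝ, Eu n) ∞ X] [MeasurableSpace X]

theorem l2Norm_sq (g : Metric n X) (Ω : Set X) (u : X → ℝ) :
    l2Norm g Ω u ^ 2 = ∫⁻ x in Ω, ENNReal.ofReal (u x ^ 2) ∂(riemannianMeasure g) := by
  rw [l2Norm, eLpNorm_eq_lintegral_rpow_enorm_toReal (by norm_num) (by norm_num)]
  simp only [ENNReal.toReal_ofNat, ENNReal.rpow_ofNat]
  rw [← ENNReal.rpow_natCast, ← ENNReal.rpow_mul]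
  norm_num
  refine lintegral_congr fun x => ?_
  rw [Real.enorm_eq_ofReal_abs, ← ENNReal.ofReal_pow (abs_nonneg _), sq_abs]

end L2Norm

/-! ### Horizontal derivatives of fibre integrals. -/

namespace SemiflatReference

variable {M : Type*} [TopologicalSpace M] [ChartedSpace (Eu 2) M] [IsManifold 𝓘(ℝ, Eu 2) ∞ M]
  {X : Type*} [TopologicalSpace X] [ChartedSpace (Eu 4) X]
  [IsManifold 𝓘(ℝ, Eu 4) ∞ X] {pr : X → M} {gB : Metric 2 M} {B₀ : Set M}

/-- The metric `g` is `ε`-close to the reference metric in `C¹`, and the areas of the fibres vary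
slowly. -/
structure IsControlled (R : SemiflatReference pr gB B₀) (g : Metric 4 X) (ε C : ℝ) : Prop where
  isOpen_base : IsOpen B₀
  isCompact_closure : IsCompact (closure B₀)
  smooth : ContMDiff 𝓘(ℝ, Eu 4) 𝓘(ℝ, Eu 2) ∞ pr
  nonneg : 0 ≤ ε
  lt_one : ε < 1
  c1Norm_le : C1NormLE R.gRef (fun x => g.inner x - R.gRef x) (pr ⁻¹' B₀) ε
  area : ∀ b ∈ B₀, ∀ ξ : Tan 2 b, |differential (fun b' => Real.log (R.fiberArea b')) b ξ|
    ≤ C * ε * Real.sqrt (gB.inner b ξ ξ)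

/-- The error in the logarithmic derivatives. -/
def logError (ε C : ℝ) : ℝ := 64 * (ε / (1 - ε)) + |C| * ε

variable [T2Space M] [SecondCountableTopology M] [MeasurableSpace M] [BorelSpace M]
  [T2Space X] [SecondCountableTopology X] [MeasurableSpace X] [BorelSpace X]
  {R : SemiflatReference pr gB B₀} {g : Metric 4 X} {ε C : ℝ}

namespace IsControlled

variable (H : R.IsControlled g ε C)
include H

theorem logError_nonneg : 0 ≤ logError ε C := by
  have h1 := H.nonneg
  have h2 : 0 < 1 - ε := by linarith [H.lt_one]
  unfold logError
  positivity

theorem continuous_pr : Continuous pr := H.smooth.continuous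

theorem abs_fderiv_fiberArea_le {b : M} (hb : b ∈ B₀) (e : Eu 2) :
    |fderiv ℝ (R.fiberArea ∘ (chartAt (Eu 2) b).symm) (chartAt (Eu 2) b b) e| ≤
      |C| * ε * R.fiberArea b * SemiflatChart.baseNorm gB b (chartAt (Eu 2) b b) e := by
  have hpos := R.fiberArea_pos hb
  have hsm := R.contMDiffAt_fiberArea g H.continuous_pr hb
  have hd : MDifferentiableAt 𝓘(ℝ, Eu 2) 𝓘(ℝ, ℝ) (fun b' => Real.log (R.fiberArea b')) b :=
    ContMDiffAt.mdifferentiableAt (n := ∞)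
      ((Real.contDiffAt_log.2 hpos.ne').contMDiffAt.comp b hsm) (by simp)
  have h := abs_fderiv_comp_chart_symm_le gB hd (H.area b hb) e
  set q := chartAt (Eu 2) b b with hq
  have hqb : (chartAt (Eu 2) b).symm q = b := (chartAt (Eu 2) b).left_inv (mem_chart_source _ b)
  have hda : DifferentiableAt ℝ (R.fiberArea ∘ (chartAt (Eu 2) b).symm) q :=
    (contDiffAt_comp_chart_symm hsm).differentiableAt (by simp)
  have hqa : (R.fiberArea ∘ (chartAt (Eu 2) b).symm) q = R.fiberArea b := congrArg R.fiberArea hqb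
  have h1 : fderiv ℝ ((fun b' => Real.log (R.fiberArea b')) ∘ (chartAt (Eu 2) b).symm) q e =
      (R.fiberArea b)⁻¹ * fderiv ℝ (R.fiberArea ∘ (chartAt (Eu 2) b).symm) q e := by
    have := (hda.hasFDerivAt.log (by rw [hqa]; exact hpos.ne')).fderiv
    rw [hqa] at this
    exact congrArg (fun l : Eu 2 →L[ℝ] ℝ => l e) this
  rw [h1, abs_mul, abs_of_pos (inv_pos.2 hpos), inv_mul_le_iff₀ hpos] at h
  refine h.trans ?_
  have h2 : C * ε ≤ |C| * ε := mul_le_mul_of_nonneg_right (le_abs_self C) H.nonneg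
  have h3 := baseNorm_nonneg gB b q e
  calc _ ≤ R.fiberArea b * (|C| * ε * SemiflatChart.baseNorm gB b q e) := by gcongr
    _ = _ := by ring

/-- The fibre integral is the area times the integral over the square of `w` times the volume ratio,
and the product rule has three contributions: `|C| ε` from the area, `64 ε / (1 - ε)` from the
volume ratio, and `√(1+ε) |∇w|` from `w`. The two relative errors add up to `logError`. -/
theorem abs_fderiv_fiberInt_le {w : X → ℝ} (hw : ContMDiff 𝓘(ℝ, Eu 4) 𝓘(ℝ, ℝ) ∞ w)
    {b : M} (hb : b ∈ B₀) (e : Eu 2) :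
    |fderiv ℝ (R.fiberInt g w ∘ (chartAt (Eu 2) b).symm) (chartAt (Eu 2) b b) e| ≤
      (∫ x, (Real.sqrt (1 + ε) * Real.sqrt (gradSq g w x) + logError ε C * |w x|) *
        R.density g x ∂(R.fiberHaar b)) *
          SemiflatChart.baseNorm gB b (chartAt (Eu 2) b b) e := by
  have hpr := H.continuous_pr
  set κ := R.chart ⟨b, hb⟩ with hκ
  set q := chartAt (Eu 2) b b with hqdef
  have hbU : b ∈ κ.U := R.mem_chart ⟨b, hb⟩
  have hq : q ∈ κ.baseSet b := κ.chart_mem_baseSet b hbU (mem_chart_source _ b)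
  have hqb : (chartAt (Eu 2) b).symm q = b := (chartAt (Eu 2) b).left_inv (mem_chart_source _ b)
  have hnhds := (κ.isOpen_baseSet b).mem_nhds hq
  set N := SemiflatChart.baseNorm gB b q e with hN
  have hN0 : 0 ≤ N := baseNorm_nonneg gB b q e
  set r : Eu 2 × Eu 2 → ℝ := fun p => volRatio g.inner R.gRef (κ.prodParam b p) with hr
  set f : Eu 2 × Eu 2 → ℝ := fun p => w (κ.prodParam b p) with hf
  set a : Eu 2 → ℝ := fun q => torusArea (κ.h ((chartAt (Eu 2) b).symm q)) with ha
  have hfr := R.contDiffOn_mul_volRatio g ⟨b, hb⟩ b hw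
  have hfs : ContDiffOn ℝ ∞ f (κ.baseSet b ×ˢ univ) :=
    (hw.comp_contMDiffOn (κ.contMDiffOn_prodParam b)).contDiffOn
  have hrs : ContDiffOn ℝ ∞ r (κ.baseSet b ×ˢ univ) := κ.contDiffOn_volRatio b g
  have hVo : IsOpen (κ.baseSet b ×ˢ (univ : Set (Eu 2))) := (κ.isOpen_baseSet b).prod isOpen_univ
  have hev : R.fiberInt g w ∘ (chartAt (Eu 2) b).symm =ᶠ[𝓝 q]
      fun q => a q * ∫ θ in unitSquare, f (q, θ) * r (q, θ) := by
    filter_upwards [hnhds] with z hz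
    exact R.fiberInt_comp_chart_symm g H.isOpen_base hpr ⟨b, hb⟩ b hw.continuous.measurable hz
  have hda : DifferentiableAt ℝ a q :=
    ((R.contDiffOn_torusArea_comp ⟨b, hb⟩ b).contDiffAt hnhds).differentiableAt (by simp)
  have hdI : DifferentiableAt ℝ (fun q => ∫ θ in unitSquare, f (q, θ) * r (q, θ)) q :=
    ((contDiffOn_setIntegral_param (μ := volume) (κ.isOpen_baseSet b) measurableSet_unitSquare
      isCompact_closure_unitSquare hfr).contDiffAt hnhds).differentiableAt (by simp)
  have haq : a q = R.fiberArea b := by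
    rw [ha]
    simp only [hqb]
    exact (R.fiberArea_eq g hpr ⟨b, hb⟩ hbU).symm
  have ha0 : 0 < a q := haq ▸ R.fiberArea_pos hb
  have hDa : |fderiv ℝ a q e| ≤ |C| * ε * a q * N := by
    have hev' : R.fiberArea ∘ (chartAt (Eu 2) b).symm =ᶠ[𝓝 q] a := by
      filter_upwards [hnhds] with z hz
      exact R.fiberArea_eq g hpr ⟨b, hb⟩ hz.2
    rw [← hev'.fderiv_eq, haq]
    exact H.abs_fderiv_fiberArea_le hb e
  have hDI : fderiv ℝ (fun q => ∫ θ in unitSquare, f (q, θ) * r (q, θ)) q e =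
      ∫ θ in unitSquare, fderiv ℝ (fun p => f p * r p) (q, θ) (e, 0) :=
    fderiv_setIntegral_param (μ := volume) (κ.isOpen_baseSet b) measurableSet_unitSquare
      isCompact_closure_unitSquare hfr hq e
  have hmul : fderiv ℝ (fun q => a q * ∫ θ in unitSquare, f (q, θ) * r (q, θ)) q e =
      a q * (∫ θ in unitSquare, fderiv ℝ (fun p => f p * r p) (q, θ) (e, 0)) +
        (∫ θ in unitSquare, f (q, θ) * r (q, θ)) * fderiv ℝ a q e := by
    rw [← hDI]
    have := (hda.hasFDerivAt.mul hdI.hasFDerivAt).fderiv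
    exact congrArg (fun l : Eu 2 →L[ℝ] ℝ => l e) this
  rw [hev.fderiv_eq, hmul]
  set Z : X → ℝ := fun x => Real.sqrt (1 + ε) * Real.sqrt (gradSq g w x) + logError ε C * |w x|
    with hZ
  have hZc : Continuous Z := ((continuous_gradSq g hw).sqrt.const_mul _).add
    (hw.continuous.abs.const_mul _)
  have hslice : ∀ {F : Eu 2 × Eu 2 → ℝ}, ContinuousOn F (κ.baseSet b ×ˢ univ) →
      Integrable (fun θ => F (q, θ)) (volume.restrict unitSquare) := by
    intro F hF
    have : Continuous fun θ => F (q, θ) := continuousOn_univ.1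
      (hF.comp (by fun_prop : ContinuousOn (fun θ : Eu 2 => (q, θ)) univ) fun θ _ => ⟨hq, trivial⟩)
    exact (this.continuousOn.integrableOn_compact isCompact_closure_unitSquare).mono_set
      subset_closure
  have hPc : ContinuousOn (κ.prodParam b) (κ.baseSet b ×ˢ univ) :=
    (κ.contMDiffOn_prodParam b).continuousOn
  have hrc := hrs.continuousOn
  have hI1 := hslice ((hfr.continuousOn_fderiv_of_isOpen hVo (by simp)).clm_apply
    (continuousOn_const (c := ((e, 0) : Eu 2 × Eu 2))))
  have hI2 : Integrable (fun θ => |f (q, θ)| * r (q, θ)) (volume.restrict unitSquare) :=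
    hslice (F := fun p => |f p| * r p) (hfs.continuousOn.abs.mul hrc)
  have hI3 : Integrable (fun θ => Real.sqrt (gradSq g w (κ.prodParam b (q, θ))) * r (q, θ))
      (volume.restrict unitSquare) :=
    hslice (F := fun p => Real.sqrt (gradSq g w (κ.prodParam b p)) * r p)
      (((continuous_gradSq g hw).sqrt.comp_continuousOn hPc).mul hrc)
  have hrpos : ∀ θ, 0 < r (q, θ) := fun θ => κ.volRatio_pos b g (p := (q, θ)) hq
  have hRHS : ∫ x, Z x * R.density g x ∂(R.fiberHaar b) =
      a q * ∫ θ in unitSquare, Z (κ.prodParam b (q, θ)) * r (q, θ) := by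
    have := R.fiberInt_comp_chart_symm g H.isOpen_base hpr ⟨b, hb⟩ b hZc.measurable hq
    rw [hqb] at this
    rw [ha]
    simp only [hqb]
    exact this
  rw [hRHS]
  -- The square does not move with `q`, so only derivatives in the horizontal direction `(e, 0)`
  -- occur.
  have hb1 : |∫ θ in unitSquare, fderiv ℝ (fun p => f p * r p) (q, θ) (e, 0)| ≤
      ∫ θ in unitSquare, (Real.sqrt (1 + ε) * (Real.sqrt (gradSq g w (κ.prodParam b (q, θ))) *
        r (q, θ)) + 64 * (ε / (1 - ε)) * (|f (q, θ)| * r (q, θ))) * N := by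
    refine abs_integral_le_integral_abs.trans (integral_mono hI1.abs
      (((hI3.const_mul _).add (hI2.const_mul _)).mul_const N) fun θ => ?_)
    have hp : (q, θ).1 ∈ κ.baseSet b := hq
    have hpn := hVo.mem_nhds (⟨hq, trivial⟩ : (q, θ) ∈ κ.baseSet b ×ˢ univ)
    have hdf := ((hfs.contDiffAt hpn).differentiableAt (by simp)).hasFDerivAt
    have hdr := ((hrs.contDiffAt hpn).differentiableAt (by simp)).hasFDerivAt
    have h1 : fderiv ℝ (fun p => f p * r p) (q, θ) (e, 0) =
        f (q, θ) * fderiv ℝ r (q, θ) (e, 0) + r (q, θ) * fderiv ℝ f (q, θ) (e, 0) :=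
      congrArg (fun l : Eu 2 × Eu 2 →L[ℝ] ℝ => l (e, 0)) (hdf.mul hdr).fderiv
    have h2 : |fderiv ℝ r (q, θ) (e, 0)| ≤ 64 * (ε / (1 - ε)) * r (q, θ) * N :=
      κ.abs_fderiv_volRatio_le b g H.lt_one H.c1Norm_le hp e
    have h3 : |fderiv ℝ f (q, θ) (e, 0)| ≤
        Real.sqrt (gradSq g w (κ.prodParam b (q, θ))) * (Real.sqrt (1 + ε) * N) :=
      κ.abs_fderiv_comp_prodParam_le b g H.c1Norm_le hw hp e
    simp only [h1]
    calc _ ≤ |f (q, θ)| * |fderiv ℝ r (q, θ) (e, 0)| + r (q, θ) * |fderiv ℝ f (q, θ) (e, 0)| := by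
          refine (abs_add_le _ _).trans_eq ?_
          rw [abs_mul, abs_mul, abs_of_pos (hrpos θ)]
      _ ≤ |f (q, θ)| * (64 * (ε / (1 - ε)) * r (q, θ) * N) + r (q, θ) *
          (Real.sqrt (gradSq g w (κ.prodParam b (q, θ))) * (Real.sqrt (1 + ε) * N)) :=
        add_le_add (mul_le_mul_of_nonneg_left h2 (abs_nonneg _))
          (mul_le_mul_of_nonneg_left h3 (hrpos θ).le)
      _ = _ := by ring
  have hb2 : |∫ θ in unitSquare, f (q, θ) * r (q, θ)| ≤ ∫ θ in unitSquare, |f (q, θ)| * r (q, θ) := by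
    refine abs_integral_le_integral_abs.trans_eq (integral_congr_ae (Eventually.of_forall fun θ => ?_))
    simp only [abs_mul, abs_of_pos (hrpos θ)]
  have hI20 : 0 ≤ ∫ θ in unitSquare, |f (q, θ)| * r (q, θ) :=
    integral_nonneg fun θ => mul_nonneg (abs_nonneg _) (hrpos θ).le
  have hsplit : ∫ θ in unitSquare, Z (κ.prodParam b (q, θ)) * r (q, θ) =
      (∫ θ in unitSquare, (Real.sqrt (1 + ε) * (Real.sqrt (gradSq g w (κ.prodParam b (q, θ))) *
        r (q, θ)) + 64 * (ε / (1 - ε)) * (|f (q, θ)| * r (q, θ)))) +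
      |C| * ε * ∫ θ in unitSquare, |f (q, θ)| * r (q, θ) := by
    rw [← integral_const_mul, ← integral_add (f := fun θ => Real.sqrt (1 + ε) *
      (Real.sqrt (gradSq g w (κ.prodParam b (q, θ))) * r (q, θ)) +
        64 * (ε / (1 - ε)) * (|f (q, θ)| * r (q, θ)))
      ((hI3.const_mul _).add (hI2.const_mul _)) (hI2.const_mul _)]
    refine integral_congr_ae (Eventually.of_forall fun θ => ?_)
    simp only [hZ, hf, logError]
    ring
  rw [integral_mul_const] at hb1
  rw [hsplit]
  calc _ ≤ a q * |∫ θ in unitSquare, fderiv ℝ (fun p => f p * r p) (q, θ) (e, 0)| +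
        |∫ θ in unitSquare, f (q, θ) * r (q, θ)| * |fderiv ℝ a q e| := by
        refine (abs_add_le _ _).trans_eq ?_
        rw [abs_mul, abs_mul, abs_of_pos ha0]
    _ ≤ a q * ((∫ θ in unitSquare, (Real.sqrt (1 + ε) *
          (Real.sqrt (gradSq g w (κ.prodParam b (q, θ))) *
        r (q, θ)) + 64 * (ε / (1 - ε)) * (|f (q, θ)| * r (q, θ)))) * N) +
        (∫ θ in unitSquare, |f (q, θ)| * r (q, θ)) * (|C| * ε * a q * N) :=
      add_le_add (mul_le_mul_of_nonneg_left hb1 ha0.le)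
        (mul_le_mul hb2 hDa (abs_nonneg _) hI20)
    _ = _ := by ring

/-- The case `w = 1`, where the gradient term vanishes and only the logarithmic error remains. -/
theorem abs_fderiv_fiberMass_le {b : M} (hb : b ∈ B₀) (e : Eu 2) :
    |fderiv ℝ (R.fiberMass g ∘ (chartAt (Eu 2) b).symm) (chartAt (Eu 2) b b) e| ≤
      logError ε C * R.fiberMass g b * SemiflatChart.baseNorm gB b (chartAt (Eu 2) b b) e := by
  have h := H.abs_fderiv_fiberInt_le (w := fun _ => 1) contMDiff_const hb e
  have h0 : ∀ x, gradSq g (fun _ => (1 : ℝ)) x = 0 := fun x => by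
    refine le_antisymm ?_ (gradSq_nonneg g _ x)
    have : gradSq g (fun _ => (1 : ℝ)) x ≤ 0 ^ 2 := gradSq_le_sq g _ x fun w => by
      have : differential (fun _ : X => (1 : ℝ)) x w = 0 := by
        rw [differential, mfderiv_const]
        rfl
      simp [this]
    simpa using this
  rw [R.fiberInt_one g] at h
  simpa [h0, integral_const_mul, fiberMass] using h

end IsControlled

end SemiflatReference

/-- The cross term is split by `2ab ≤ a² + b²` without rebalancing, so that the coefficient of `b²`
tends to zero with `δ` while that of `a²` tends to one. -/
theorem sq_add_mul_le {a b δ : ℝ} (hδ : 0 ≤ δ) :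
    (a + δ * b) ^ 2 ≤ (1 + δ) * a ^ 2 + (δ + δ ^ 2) * b ^ 2 := by
  nlinarith [mul_nonneg hδ (sq_nonneg (a - b))]

/-! ### Energy inequalities for averages and lifts of test functions. -/

namespace SemiflatReference

variable {M : Type*} [TopologicalSpace M] [ChartedSpace (Eu 2) M] [IsManifold 𝓘(ℝ, Eu 2) ∞ M]
  {X : Type*} [TopologicalSpace X] [ChartedSpace (Eu 4) X]
  [IsManifold 𝓘(ℝ, Eu 4) ∞ X] {pr : X → M} {gB : Metric 2 M} {B₀ : Set M}
  [T2Space M] [SecondCountableTopology M] [MeasurableSpace M] [BorelSpace M]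
  [T2Space X] [SecondCountableTopology X] [MeasurableSpace X] [BorelSpace X]

/-- The projection is proper over `B₀`: over a compact trivializing neighbourhood the total space is
covered by the image of a compact product with the closed square, and finitely many such
neighbourhoods cover `K`. Lifts thereby keep compact support. -/
theorem isCompact_preimage (R : SemiflatReference pr gB B₀) (hpr : Continuous pr) {K : Set M}
    (hK : IsCompact K) (hKB : K ⊆ B₀) : IsCompact (pr ⁻¹' K) := by
  have : LocallyCompactSpace M := ChartedSpace.locallyCompactSpace (Eu 2) M
  have hex : ∀ b : M, ∃ S ∈ 𝓝 b, b ∈ K → IsCompact (pr ⁻¹' (K ∩ S)) := by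
    intro b
    by_cases hb : b ∈ K
    · set κ := R.chart ⟨b, hKB hb⟩
      obtain ⟨S, hS, hSU, hSc⟩ := local_compact_nhds
        (κ.isOpen.mem_nhds (R.mem_chart ⟨b, hKB hb⟩ : b ∈ κ.U))
      refine ⟨S, hS, fun _ => ?_⟩
      have hc : IsCompact (κ.Ψ '' (S ×ˢ closure unitSquare)) :=
        (hSc.prod isCompact_closure_unitSquare).image_of_continuousOn
          (κ.smooth.continuousOn.mono (prod_mono hSU (subset_univ _)))
      refine hc.of_isClosed_subset ((hK.inter hSc).isClosed.preimage hpr) ?_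
      rintro x ⟨-, hxS⟩
      obtain ⟨θ, hθ⟩ := κ.surj x (hSU hxS)
      obtain ⟨k, hk⟩ := exists_add_latticeVec_mem θ
      refine ⟨(pr x, θ + latticeVec k), ⟨hxS, subset_closure hk⟩, ?_⟩
      rw [← hθ, κ.proj _ (hSU hxS)]
      exact ((κ.periodic _ (hSU hxS) _ _).2 ⟨k, rfl⟩).symm
    · exact ⟨univ, univ_mem, fun h => absurd h hb⟩
  choose S hS hSc using hex
  obtain ⟨t, htK, ht⟩ := hK.elim_nhds_subcover S fun b _ => hS b
  have h : pr ⁻¹' K = ⋃ b ∈ t, pr ⁻¹' (K ∩ S b) := by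
    ext x
    simp only [mem_preimage, mem_iUnion, mem_inter_iff, exists_prop]
    constructor
    · intro hx
      obtain ⟨b, hb, hxb⟩ := mem_iUnion₂.1 (ht hx)
      exact ⟨b, hb, hx, hxb⟩
    · rintro ⟨b, -, hx, -⟩
      exact hx
  rw [h]
  exact t.isCompact_biUnion fun b hb => hSc b (htK b hb)

variable (R : SemiflatReference pr gB B₀) (g : Metric 4 X)

theorem setLIntegral_comp_pr (hB₀ : IsOpen B₀) (hpr : Continuous pr) {f : M → ℝ≥0∞}
    (hf : Measurable f) : ∫⁻ x in pr ⁻¹' B₀, f (pr x) ∂(riemannianMeasure g) =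
      ∫⁻ b in B₀, f b * ENNReal.ofReal (R.fiberMass g b) ∂(riemannianMeasure gB) := by
  rw [R.setLIntegral_riemannianMeasure g hB₀ hpr (f := fun x => f (pr x)) (hf.comp hpr.measurable)]
  refine setLIntegral_congr_fun hB₀.measurableSet fun b hb => ?_
  rw [R.ofReal_fiberMass g hB₀ hpr hb,
    ← lintegral_const_mul _ (R.measurable_density g hB₀ hpr).ennreal_ofReal]
  refine lintegral_congr_ae ?_
  filter_upwards [R.ae_fiberHaar_pr hpr b] with x hx
  rw [hx]

/-- The fibre average normalized by the mass of the fibre. -/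
def stdAverage (w : X → ℝ) (b : M) : ℝ := (Real.sqrt (R.fiberMass g b))⁻¹ * R.fiberInt g w b

variable {R g} {ε C : ℝ}

namespace IsControlled

variable (H : R.IsControlled g ε C)
include H

/-- The average vanishes off the projection of the support of `w`, a compact subset of `B₀`.
Smoothness of the mass is available only inside `B₀`; at other points the average is locally zero.
-/
theorem isTestFunction_stdAverage {w : X → ℝ} (hw : IsTestFunction (n := 4) (pr ⁻¹' B₀) w) :
    IsTestFunction (n := 2) B₀ (R.stdAverage g w) := by
  obtain ⟨hws, hwc, hwt⟩ := hw
  have hpr := H.continuous_pr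
  have hKc : IsCompact (pr '' tsupport w) := hwc.isCompact.image hpr
  have hKB : pr '' tsupport w ⊆ B₀ := by
    rintro _ ⟨x, hx, rfl⟩
    exact hwt hx
  have hzero : ∀ b, b ∉ pr '' tsupport w → R.stdAverage g w b = 0 := by
    intro b hb
    have : R.fiberInt g w b = 0 := by
      refine integral_eq_zero_of_ae ?_
      filter_upwards [R.ae_fiberHaar_pr hpr b] with x hx
      have hx' : x ∉ tsupport w := fun h => hb ⟨x, h, hx⟩
      simp [image_eq_zero_of_notMem_tsupport hx']
    simp [stdAverage, this]
  have hts : tsupport (R.stdAverage g w) ⊆ pr '' tsupport w :=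
    closure_minimal (fun b hb => by
      by_contra h
      exact hb (hzero b h)) hKc.isClosed
  refine ⟨fun b => ?_, hKc.of_isClosed_subset (isClosed_tsupport _) hts, hts.trans hKB⟩
  by_cases hb : b ∈ B₀
  · have hpos := R.fiberMass_pos g H.isOpen_base hpr hb
    have h1 := R.contMDiffAt_fiberMass g H.isOpen_base hpr hb
    have h2 : ContDiffAt ℝ ∞ (fun m : ℝ => (Real.sqrt m)⁻¹) (R.fiberMass g b) :=
      (Real.contDiffAt_sqrt hpos.ne').inv (Real.sqrt_pos.2 hpos).ne'
    exact (h2.contMDiffAt.comp b h1).mul (R.contMDiffAt_fiberInt g H.isOpen_base hpr hb hws)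
  · refine contMDiffAt_const.congr_of_eventuallyEq (f := fun _ => (0 : ℝ)) ?_
    filter_upwards [hKc.isClosed.isOpen_compl.mem_nhds (fun h => hb (hKB h))] with z hz
    exact hzero z hz

/-- The factor `3 / 2` collects one `logError` from the fibre integral and one half from the power
`m^(-1/2)`. Cauchy-Schwarz on the fibre absorbs the factor `m⁻¹` produced by squaring. -/
theorem gradSq_stdAverage_le {w : X → ℝ} (hw : ContMDiff 𝓘(ℝ, Eu 4) 𝓘(ℝ, ℝ) ∞ w)
    {b : M} (hb : b ∈ B₀) {δ : ℝ} (hδ : δ = 3 / 2 * logError ε C) :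
    gradSq gB (R.stdAverage g w) b ≤ ∫ x, ((1 + δ) * (1 + ε) * gradSq g w x +
      (δ + δ ^ 2) * w x ^ 2) * R.density g x ∂(R.fiberHaar b) := by
  have hpr := H.continuous_pr
  have hB₀ := H.isOpen_base
  have hl := H.logError_nonneg
  have hδ0 : 0 ≤ δ := by rw [hδ]; positivity
  have hpos := R.fiberMass_pos g hB₀ hpr hb
  have hm := R.contMDiffAt_fiberMass g hB₀ hpr hb
  have hI := R.contMDiffAt_fiberInt g hB₀ hpr hb hw
  have hqb : (chartAt (Eu 2) b).symm (chartAt (Eu 2) b b) = b :=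
    (chartAt (Eu 2) b).left_inv (mem_chart_source _ b)
  have hGc := continuous_gradSq g hw
  have hsgc := hGc.sqrt
  set Z : X → ℝ := fun x => Real.sqrt (1 + ε) * Real.sqrt (gradSq g w x) + δ * |w x| with hZ
  have hZc : Continuous Z := (hsgc.const_mul _).add (hw.continuous.abs.const_mul _)
  have hint := fun {f : X → ℝ} (hf : Continuous f) => R.integrable_mul_density g hB₀ hpr hb hf
  have hIw := hint hw.continuous.abs
  have hJ0 := R.density_nonneg g
  have hbound : ∀ e, |fderiv ℝ (R.stdAverage g w ∘ (chartAt (Eu 2) b).symm) (chartAt (Eu 2) b b) e| ≤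
      ((Real.sqrt (R.fiberMass g b))⁻¹ * ∫ x, Z x * R.density g x ∂(R.fiberHaar b)) *
        SemiflatChart.baseNorm gB b (chartAt (Eu 2) b b) e := by
    intro e
    have h1 := H.abs_fderiv_fiberMass_le hb e
    have h2 := H.abs_fderiv_fiberInt_le hw hb e
    have hmq : (R.fiberMass g ∘ (chartAt (Eu 2) b).symm) (chartAt (Eu 2) b b) =
      R.fiberMass g b := congrArg (R.fiberMass g) hqb
    have hIq : (R.fiberInt g w ∘ (chartAt (Eu 2) b).symm) (chartAt (Eu 2) b b) =
      R.fiberInt g w b := congrArg (R.fiberInt g w) hqb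
    have h3 := abs_fderiv_inv_sqrt_mul_le
      ((contDiffAt_comp_chart_symm hm).differentiableAt (by simp))
      ((contDiffAt_comp_chart_symm hI).differentiableAt (by simp)) (by rw [hmq]; exact hpos)
      (by rw [hmq]; exact h1) h2
    rw [hmq, hIq] at h3
    refine h3.trans ?_
    have hN := baseNorm_nonneg gB b (chartAt (Eu 2) b b) e
    refine mul_le_mul_of_nonneg_right (mul_le_mul_of_nonneg_left ?_
      (inv_nonneg.2 (Real.sqrt_nonneg _))) hN
    have h4 : |R.fiberInt g w b| ≤ ∫ x, |w x| * R.density g x ∂(R.fiberHaar b) := by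
      refine abs_integral_le_integral_abs.trans_eq
        (integral_congr_ae (Eventually.of_forall fun x => ?_))
      simp only [abs_mul, abs_of_nonneg (hJ0 x)]
    have h5 : ∫ x, Z x * R.density g x ∂(R.fiberHaar b) =
        (∫ x, (Real.sqrt (1 + ε) * Real.sqrt (gradSq g w x) + logError ε C * |w x|) *
          R.density g x ∂(R.fiberHaar b)) +
        logError ε C / 2 * ∫ x, |w x| * R.density g x ∂(R.fiberHaar b) := by
      rw [← integral_const_mul, ← integral_add (hint
        (f := fun x => Real.sqrt (1 + ε) * Real.sqrt (gradSq g w x) + logError ε C * |w x|)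
        ((hsgc.const_mul _).add (hw.continuous.abs.const_mul _))) (hIw.const_mul _)]
      refine integral_congr_ae (Eventually.of_forall fun x => ?_)
      simp only [hZ, hδ]
      ring
    rw [h5]
    gcongr
  have hmd : MDifferentiableAt 𝓘(ℝ, Eu 2) 𝓘(ℝ, ℝ) (R.stdAverage g w) b := by
    have h2 : ContDiffAt ℝ ∞ (fun m : ℝ => (Real.sqrt m)⁻¹) (R.fiberMass g b) :=
      (Real.contDiffAt_sqrt hpos.ne').inv (Real.sqrt_pos.2 hpos).ne'
    exact ContMDiffAt.mdifferentiableAt (n := ∞) ((h2.contMDiffAt.comp b hm).mul hI) (by simp)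
  refine (gradSq_le_of_fderiv_comp_chart_symm gB hmd hbound).trans ?_
  rw [mul_pow, inv_pow, Real.sq_sqrt hpos.le]
  have hZZ := hint (hZc.pow 2)
  refine (sq_integral_mul_le (R.integrable_density g hB₀ hpr hb) (hint hZc) hZZ hJ0 hpos).trans ?_
  refine integral_mono hZZ (hint ((hGc.const_mul _).add ((hw.continuous.pow 2).const_mul _)))
    fun x => ?_
  refine mul_le_mul_of_nonneg_right ((sq_add_mul_le hδ0).trans_eq ?_) (hJ0 x)
  rw [mul_pow, Real.sq_sqrt (by linarith [H.nonneg]), Real.sq_sqrt (gradSq_nonneg g w x), sq_abs]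
  ring

theorem smoothEnergy_stdAverage_le {w : X → ℝ} (hw : ContMDiff 𝓘(ℝ, Eu 4) 𝓘(ℝ, ℝ) ∞ w)
    {δ : ℝ} (hδ : δ = 3 / 2 * logError ε C) :
    smoothEnergy gB B₀ (R.stdAverage g w) ≤
      ENNReal.ofReal ((1 + δ) * (1 + ε)) * smoothEnergy g (pr ⁻¹' B₀) w +
        ENNReal.ofReal (δ + δ ^ 2) * l2Norm g (pr ⁻¹' B₀) w ^ 2 := by
  have hpr := H.continuous_pr
  have hB₀ := H.isOpen_base
  have hδ0 : 0 ≤ δ := by rw [hδ]; have := H.logError_nonneg; positivity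
  have hε := H.nonneg
  have hG := continuous_gradSq g hw
  set G : X → ℝ := fun x => (1 + δ) * (1 + ε) * gradSq g w x + (δ + δ ^ 2) * w x ^ 2 with hGdef
  have hGc : Continuous G := (hG.const_mul _).add ((hw.continuous.pow 2).const_mul _)
  have hG0 : ∀ x, 0 ≤ G x := fun x => by
    have := gradSq_nonneg g w x
    simp only [hGdef]
    positivity
  have hR : ENNReal.ofReal ((1 + δ) * (1 + ε)) * smoothEnergy g (pr ⁻¹' B₀) w +
        ENNReal.ofReal (δ + δ ^ 2) * l2Norm g (pr ⁻¹' B₀) w ^ 2 =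
      ∫⁻ x in pr ⁻¹' B₀, ENNReal.ofReal (G x) ∂(riemannianMeasure g) := by
    rw [l2Norm_sq, smoothEnergy, ← lintegral_const_mul _ hG.measurable.ennreal_ofReal,
      ← lintegral_const_mul _ (hw.continuous.fun_pow 2).measurable.ennreal_ofReal,
      ← lintegral_add_left (hG.measurable.ennreal_ofReal.const_mul _)]
    refine lintegral_congr fun x => ?_
    have := gradSq_nonneg g w x
    rw [← ENNReal.ofReal_mul (by positivity), ← ENNReal.ofReal_mul (by positivity),
      ← ENNReal.ofReal_add (by positivity) (by positivity)]
  rw [hR, R.setLIntegral_riemannianMeasure g hB₀ hpr hGc.measurable.ennreal_ofReal]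
  refine setLIntegral_mono' hB₀.measurableSet fun b hb => ?_
  refine (ENNReal.ofReal_le_ofReal (H.gradSq_stdAverage_le hw hb hδ)).trans_eq ?_
  rw [ofReal_integral_eq_lintegral_ofReal (R.integrable_mul_density g hB₀ hpr hb hGc)
    (Eventually.of_forall fun x => mul_nonneg (hG0 x) (R.density_nonneg g x))]
  exact lintegral_congr fun x => ENNReal.ofReal_mul (hG0 x)

theorem contMDiffAt_inv_sqrt_fiberMass_mul {φ : M → ℝ} {b : M} (hb : b ∈ B₀)
    (hφ : ContMDiffAt 𝓘(ℝ, Eu 2) 𝓘(ℝ, ℝ) ∞ φ b) :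
    ContMDiffAt 𝓘(ℝ, Eu 2) 𝓘(ℝ, ℝ) ∞ (fun b => (Real.sqrt (R.fiberMass g b))⁻¹ * φ b) b := by
  have hpos := R.fiberMass_pos g H.isOpen_base H.continuous_pr hb
  have h2 : ContDiffAt ℝ ∞ (fun m : ℝ => (Real.sqrt m)⁻¹) (R.fiberMass g b) :=
    (Real.contDiffAt_sqrt hpos.ne').inv (Real.sqrt_pos.2 hpos).ne'
  exact (h2.contMDiffAt.comp b
    (R.contMDiffAt_fiberMass g H.isOpen_base H.continuous_pr hb)).mul hφ

theorem contMDiff_inv_sqrt_fiberMass_mul {φ : M → ℝ} (hφ : IsTestFunction (n := 2) B₀ φ) :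
    ContMDiff 𝓘(ℝ, Eu 2) 𝓘(ℝ, ℝ) ∞ (fun b => (Real.sqrt (R.fiberMass g b))⁻¹ * φ b) := by
  intro b
  by_cases hb : b ∈ B₀
  · exact H.contMDiffAt_inv_sqrt_fiberMass_mul hb (hφ.1 b)
  · refine contMDiffAt_const.congr_of_eventuallyEq (f := fun _ => (0 : ℝ)) ?_
    filter_upwards [(isClosed_tsupport φ).isOpen_compl.mem_nhds (fun h => hb (hφ.2.2 h))] with z hz
    rw [image_eq_zero_of_notMem_tsupport hz, mul_zero]

theorem isTestFunction_lift {φ : M → ℝ} (hφ : IsTestFunction (n := 2) B₀ φ) :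
    IsTestFunction (n := 4) (pr ⁻¹' B₀) (lift pr (R.fiberMass g) φ) := by
  have hpr := H.continuous_pr
  have hts : tsupport (lift pr (R.fiberMass g) φ) ⊆ pr ⁻¹' tsupport φ := by
    refine closure_minimal (fun x hx => ?_) ((isClosed_tsupport φ).preimage hpr)
    by_contra h
    refine hx ?_
    rw [lift, image_eq_zero_of_notMem_tsupport h, mul_zero]
  refine ⟨(H.contMDiff_inv_sqrt_fiberMass_mul hφ).comp H.smooth, ?_,
    hts.trans (preimage_mono hφ.2.2)⟩
  exact (R.isCompact_preimage hpr hφ.2.1.isCompact hφ.2.2).of_isClosed_subset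
    (isClosed_tsupport _) hts

theorem gradSq_comp_pr_le {ψ : M → ℝ} (hψ : ContMDiff 𝓘(ℝ, Eu 2) 𝓘(ℝ, ℝ) ∞ ψ) {x : X}
    (hx : pr x ∈ B₀) : gradSq g (ψ ∘ pr) x ≤ (1 - ε)⁻¹ * gradSq gB ψ (pr x) := by
  set κ := R.chart ⟨pr x, hx⟩
  have hU : pr x ∈ κ.U := R.mem_chart ⟨pr x, hx⟩
  obtain ⟨θ, hθ⟩ := κ.surj x hU
  have hs := mem_chart_source (Eu 2) (pr x)
  have h := κ.gradSq_comp_pr_le (pr x) g H.lt_one H.smooth H.c1Norm_le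
    (p := (chartAt (Eu 2) (pr x) (pr x), θ)) (κ.chart_mem_baseSet _ hU hs)
    (hψ.mdifferentiableAt (by simp))
  rwa [κ.prodParam_chart (pr x) hs, hθ] at h

theorem gradSq_inv_sqrt_fiberMass_mul_le {φ : M → ℝ} (hφ : ContMDiff 𝓘(ℝ, Eu 2) 𝓘(ℝ, ℝ) ∞ φ)
    {b : M} (hb : b ∈ B₀) {δ : ℝ} (hδ : δ = 3 / 2 * logError ε C) :
    gradSq gB (fun b => (Real.sqrt (R.fiberMass g b))⁻¹ * φ b) b ≤
      (R.fiberMass g b)⁻¹ * ((1 + δ) * gradSq gB φ b + (δ + δ ^ 2) * φ b ^ 2) := by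
  have hpr := H.continuous_pr
  have hB₀ := H.isOpen_base
  have hl := H.logError_nonneg
  have hδ0 : 0 ≤ δ := by rw [hδ]; positivity
  have hpos := R.fiberMass_pos g hB₀ hpr hb
  have hm := R.contMDiffAt_fiberMass g hB₀ hpr hb
  have hqb : (chartAt (Eu 2) b).symm (chartAt (Eu 2) b b) = b :=
    (chartAt (Eu 2) b).left_inv (mem_chart_source _ b)
  have hmd : MDifferentiableAt 𝓘(ℝ, Eu 2) 𝓘(ℝ, ℝ)
      (fun b => (Real.sqrt (R.fiberMass g b))⁻¹ * φ b) b :=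
    (H.contMDiffAt_inv_sqrt_fiberMass_mul hb (hφ b)).mdifferentiableAt (by simp)
  refine (gradSq_le_of_fderiv_comp_chart_symm gB hmd
    (K := (Real.sqrt (R.fiberMass g b))⁻¹ * (Real.sqrt (gradSq gB φ b) + δ * |φ b|))
    fun e => ?_).trans ?_
  · have hmq : (R.fiberMass g ∘ (chartAt (Eu 2) b).symm) (chartAt (Eu 2) b b) =
      R.fiberMass g b := congrArg (R.fiberMass g) hqb
    have hφq : (φ ∘ (chartAt (Eu 2) b).symm) (chartAt (Eu 2) b b) = φ b := congrArg φ hqb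
    have h3 := abs_fderiv_inv_sqrt_mul_le
      ((contDiffAt_comp_chart_symm hm).differentiableAt (by simp))
      ((contDiffAt_comp_chart_symm (hφ b)).differentiableAt (by simp)) (by rw [hmq]; exact hpos)
      (by rw [hmq]; exact H.abs_fderiv_fiberMass_le hb e)
      (abs_fderiv_comp_chart_symm_le gB (hφ.mdifferentiableAt (by simp))
        (abs_differential_le gB φ b) e)
    rw [hmq, hφq] at h3
    refine h3.trans (mul_le_mul_of_nonneg_right (mul_le_mul_of_nonneg_left ?_
      (inv_nonneg.2 (Real.sqrt_nonneg _))) (baseNorm_nonneg gB b _ e))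
    -- Only the power of the mass contributes here; the larger `δ` is kept to have one parameter for
    -- both energy inequalities.
    have : logError ε C / 2 ≤ δ := by rw [hδ]; linarith
    gcongr
  · rw [mul_pow, inv_pow, Real.sq_sqrt hpos.le]
    refine mul_le_mul_of_nonneg_left ((sq_add_mul_le hδ0).trans_eq ?_) (inv_nonneg.2 hpos.le)
    rw [Real.sq_sqrt (gradSq_nonneg gB φ b), sq_abs]

/-- The pointwise bound is a function on the base carrying the factor `m⁻¹`, which cancels the mass
of the fibre upon integration. -/
theorem smoothEnergy_lift_le {φ : M → ℝ} (hφ : IsTestFunction (n := 2) B₀ φ)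
    {δ : ℝ} (hδ : δ = 3 / 2 * logError ε C) :
    smoothEnergy g (pr ⁻¹' B₀) (lift pr (R.fiberMass g) φ) ≤ ENNReal.ofReal (1 - ε)⁻¹ *
      (ENNReal.ofReal (1 + δ) * smoothEnergy gB B₀ φ +
        ENNReal.ofReal (δ + δ ^ 2) * l2Norm gB B₀ φ ^ 2) := by
  have hpr := H.continuous_pr
  have hB₀ := H.isOpen_base
  have hδ0 : 0 ≤ δ := by rw [hδ]; have := H.logError_nonneg; positivity
  have hε : 0 < (1 - ε)⁻¹ := inv_pos.2 (by linarith [H.lt_one])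
  have hG := continuous_gradSq gB hφ.1
  have hψ := H.contMDiff_inv_sqrt_fiberMass_mul hφ
  set Q : M → ℝ := fun b => (1 + δ) * gradSq gB φ b + (δ + δ ^ 2) * φ b ^ 2 with hQ
  have hQc : Continuous Q := (hG.const_mul _).add ((hφ.1.continuous.pow 2).const_mul _)
  have hQ0 : ∀ b, 0 ≤ Q b := fun b => by
    have := gradSq_nonneg gB φ b
    simp only [hQ]
    positivity
  have hR : ENNReal.ofReal (1 - ε)⁻¹ * (ENNReal.ofReal (1 + δ) * smoothEnergy gB B₀ φ +
        ENNReal.ofReal (δ + δ ^ 2) * l2Norm gB B₀ φ ^ 2) =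
      ∫⁻ b in B₀, ENNReal.ofReal ((1 - ε)⁻¹ * Q b) ∂(riemannianMeasure gB) := by
    rw [l2Norm_sq, smoothEnergy, ← lintegral_const_mul _ hG.measurable.ennreal_ofReal,
      ← lintegral_const_mul _ (hφ.1.continuous.fun_pow 2).measurable.ennreal_ofReal,
      ← lintegral_add_left (hG.measurable.ennreal_ofReal.const_mul _), 
      ← lintegral_const_mul' _ _ ENNReal.ofReal_ne_top]
    refine lintegral_congr fun b => ?_
    have := gradSq_nonneg gB φ b
    rw [← ENNReal.ofReal_mul (by positivity), ← ENNReal.ofReal_mul (by positivity),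
      ← ENNReal.ofReal_add (by positivity) (by positivity), ← ENNReal.ofReal_mul hε.le]
  rw [hR]
  have hmeas : Measurable fun b => ENNReal.ofReal ((1 - ε)⁻¹ * ((R.fiberMass g b)⁻¹ * Q b)) :=
    (((R.measurable_fiberMass g hB₀ hpr).inv.mul hQc.measurable).const_mul _).ennreal_ofReal
  calc _ ≤ ∫⁻ x in pr ⁻¹' B₀, ENNReal.ofReal
        ((1 - ε)⁻¹ * ((R.fiberMass g (pr x))⁻¹ * Q (pr x))) ∂(riemannianMeasure g) := by
        refine setLIntegral_mono' (hB₀.preimage hpr).measurableSet fun x hx => ?_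
        refine ENNReal.ofReal_le_ofReal ((H.gradSq_comp_pr_le hψ hx).trans ?_)
        exact mul_le_mul_of_nonneg_left (H.gradSq_inv_sqrt_fiberMass_mul_le hφ.1 hx hδ) hε.le
    _ = _ := by
        rw [R.setLIntegral_comp_pr g hB₀ hpr hmeas]
        refine setLIntegral_congr_fun hB₀.measurableSet fun b hb => ?_
        have hpos := R.fiberMass_pos g hB₀ hpr hb
        rw [← ENNReal.ofReal_mul' hpos.le]
        congr 1
        field_simp

end IsControlled

end SemiflatReference

/-! ### Existence and uniqueness of the normalized disintegration; `L²` bounds. -/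

namespace SemiflatReference

variable {M : Type*} [TopologicalSpace M] [ChartedSpace (Eu 2) M] [IsManifold 𝓘(ℝ, Eu 2) ∞ M]
  {X : Type*} [TopologicalSpace X] [ChartedSpace (Eu 4) X]
  [IsManifold 𝓘(ℝ, Eu 4) ∞ X] {pr : X → M} {gB : Metric 2 M} {B₀ : Set M}
  [T2Space M] [SecondCountableTopology M] [MeasurableSpace M] [BorelSpace M]
  [T2Space X] [SecondCountableTopology X] [MeasurableSpace X] [BorelSpace X]
  (R : SemiflatReference pr gB B₀) (g : Metric 4 X)

/-- The normalized disintegration of the Riemannian measure. -/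
theorem isNormalizedDisintegration (hB₀ : IsOpen B₀) (hpr : Continuous pr) :
    IsNormalizedDisintegration pr B₀ (riemannianMeasure g) (riemannianMeasure gB) R.fiberHaar
      (R.fiberMass g) (fun x => (R.fiberMass g (pr x))⁻¹ * R.density g x) := by
  have hd := R.measurable_density g hB₀ hpr
  have hm := R.measurable_fiberMass g hB₀ hpr
  refine ⟨hm, (hm.comp hpr.measurable).inv.mul hd,
    fun b hb => R.fiberMass_pos g hB₀ hpr hb,
    fun x hx => mul_pos (inv_pos.2 (R.fiberMass_pos g hB₀ hpr hx)) (R.density_pos g hx), ?_, ?_⟩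
  · intro b hb
    have hpos := R.fiberMass_pos g hB₀ hpr hb
    have h1 : ∫⁻ x, ENNReal.ofReal ((R.fiberMass g (pr x))⁻¹ * R.density g x) ∂(R.fiberHaar b) =
        ∫⁻ x, ENNReal.ofReal (R.fiberMass g b)⁻¹ * ENNReal.ofReal (R.density g x)
          ∂(R.fiberHaar b) := by
      refine lintegral_congr_ae ?_
      filter_upwards [R.ae_fiberHaar_pr hpr b] with x hx
      rw [hx, ENNReal.ofReal_mul (inv_pos.2 hpos).le]
    rw [h1, lintegral_const_mul _ hd.ennreal_ofReal, ← R.ofReal_fiberMass g hB₀ hpr hb,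
      ← ENNReal.ofReal_mul (inv_pos.2 hpos).le, inv_mul_cancel₀ hpos.ne', ENNReal.ofReal_one]
  · intro f hf
    rw [R.setLIntegral_riemannianMeasure g hB₀ hpr hf]
    refine setLIntegral_congr_fun hB₀.measurableSet fun b hb => ?_
    have hpos := R.fiberMass_pos g hB₀ hpr hb
    rw [← lintegral_const_mul' _ _ ENNReal.ofReal_ne_top]
    refine lintegral_congr_ae ?_
    filter_upwards [R.ae_fiberHaar_pr hpr b] with x hx
    rw [hx, mul_left_comm, ← ENNReal.ofReal_mul hpos.le, mul_inv_cancel_left₀ hpos.ne']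

theorem ae_fiberHaar_of_ae_haarMeasure (g : Metric 4 X) (hB₀ : IsOpen B₀) (hpr : Continuous pr) {p : X → Prop}
    (h : ∀ᵐ x ∂(R.haarMeasure), p x) :
    ∀ᵐ b ∂((riemannianMeasure gB).restrict B₀), ∀ᵐ x ∂(R.fiberHaar b), p x :=
  Measure.ae_ae_of_ae_bind (R.measurable_fiberHaar g hB₀ hpr).aemeasurable h

/-- The density is positive over `B₀`, and `haarMeasure` lives there, so null sets of the Riemannian
measure are null for it too. Exceptional sets can then be examined fibre by fibre. -/
theorem ae_haarMeasure_of_ae (hB₀ : IsOpen B₀) (hpr : Continuous pr) {p : X → Prop}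
    (h : ∀ᵐ x ∂((riemannianMeasure g).restrict (pr ⁻¹' B₀)), p x) : ∀ᵐ x ∂(R.haarMeasure), p x := by
  have hd := (R.measurable_density g hB₀ hpr).ennreal_ofReal
  rw [R.restrict_riemannianMeasure_eq g hB₀ hpr, ae_withDensity_iff hd] at h
  have h2 : ∀ᵐ x ∂(R.haarMeasure), pr x ∈ B₀ := by
    have hms : MeasurableSet (pr ⁻¹' B₀)ᶜ := (hB₀.preimage hpr).measurableSet.compl
    have : R.haarMeasure (pr ⁻¹' B₀)ᶜ = 0 := by
      rw [haarMeasure, Measure.bind_apply hms (R.measurable_fiberHaar g hB₀ hpr).aemeasurable,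
        lintegral_eq_zero_iff (f := fun b => R.fiberHaar b (pr ⁻¹' B₀)ᶜ)
          ((Measure.measurable_coe hms).comp (R.measurable_fiberHaar g hB₀ hpr))]
      filter_upwards [ae_restrict_mem hB₀.measurableSet] with b hb
      refine (ae_iff (p := fun x => pr x ∈ B₀)).1 ?_
      filter_upwards [R.ae_fiberHaar_pr hpr b] with x hx
      rwa [hx]
    exact (ae_iff (p := fun x => pr x ∈ B₀)).2 this
  filter_upwards [h, h2] with x hx hx2
  exact hx (by simpa using R.density_pos g hx2)

theorem ae_fiberHaar_of_ae (hB₀ : IsOpen B₀) (hpr : Continuous pr) {p : X → Prop}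
    (h : ∀ᵐ x ∂((riemannianMeasure g).restrict (pr ⁻¹' B₀)), p x) :
    ∀ᵐ b ∂((riemannianMeasure gB).restrict B₀), ∀ᵐ x ∂(R.fiberHaar b), p x :=
  R.ae_fiberHaar_of_ae_haarMeasure g hB₀ hpr (R.ae_haarMeasure_of_ae g hB₀ hpr h)

theorem quasiMeasurePreserving_pr (R : SemiflatReference pr gB B₀) (hB₀ : IsOpen B₀) (hpr : Continuous pr) :
    Measure.QuasiMeasurePreserving pr ((riemannianMeasure g).restrict (pr ⁻¹' B₀))
      ((riemannianMeasure gB).restrict B₀) := by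
  refine ⟨hpr.measurable, Measure.AbsolutelyContinuous.mk fun s hs h => ?_⟩
  rw [Measure.map_apply hpr.measurable hs]
  have h1 := R.setLIntegral_comp_pr g hB₀ hpr (f := s.indicator 1) (measurable_one.indicator hs)
  have h2 : ∀ x, s.indicator (1 : M → ℝ≥0∞) (pr x) = (pr ⁻¹' s).indicator 1 x := fun x => rfl
  simp only [h2] at h1
  rw [lintegral_indicator_one (hpr.measurable hs)] at h1
  rw [h1]
  refine (lintegral_eq_zero_iff ((measurable_one.indicator hs).mul
    (R.measurable_fiberMass g hB₀ hpr).ennreal_ofReal)).2 ?_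
  filter_upwards [measure_eq_zero_iff_ae_notMem.1 h] with b hb
  simp [hb]

section Uniqueness

variable {R g} {A : M → ℝ} {ρ : X → ℝ}

/-- Another disintegration gives a second density `A(pr x) ρ(x)` with respect to the finite measure
`haarMeasure`. Densities agree almost everywhere, hence on almost every fibre, and integrating over
the fibre identifies `A` through the normalization of `ρ`. -/
theorem ae_eq_of_isNormalizedDisintegration (hB₀ : IsOpen B₀) (hB₀c : IsCompact (closure B₀))
    (hpr : Continuous pr) (hD : IsNormalizedDisintegration pr B₀ (riemannianMeasure g)
      (riemannianMeasure gB) R.fiberHaar A ρ) :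
    ∀ᵐ b ∂((riemannianMeasure gB).restrict B₀), A b = R.fiberMass g b ∧
      ∀ᵐ x ∂(R.fiberHaar b), R.fiberMass g b * ρ x = R.density g x := by
  have hfin := R.isFiniteMeasure_haarMeasure g hB₀ hB₀c hpr
  have hd := R.measurable_density g hB₀ hpr
  have hAρ : Measurable fun x => ENNReal.ofReal (A (pr x)) * ENNReal.ofReal (ρ x) :=
    (hD.measurable_A.comp hpr.measurable).ennreal_ofReal.mul hD.measurable_ρ.ennreal_ofReal
  have h1 : R.haarMeasure.withDensity (fun x => ENNReal.ofReal (R.density g x)) =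
      R.haarMeasure.withDensity fun x => ENNReal.ofReal (A (pr x)) * ENNReal.ofReal (ρ x) := by
    rw [← R.restrict_riemannianMeasure_eq g hB₀ hpr]
    refine Measure.ext_of_lintegral _ fun f hf => ?_
    rw [hD.disintegration f hf, lintegral_withDensity_eq_lintegral_mul _ hAρ hf,
      R.lintegral_haarMeasure g hB₀ hpr (hAρ.mul hf)]
    refine lintegral_congr fun b => ?_
    rw [← lintegral_const_mul' _ _ ENNReal.ofReal_ne_top]
    refine lintegral_congr_ae ?_
    filter_upwards [R.ae_fiberHaar_pr hpr b] with x hx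
    simp only [Pi.mul_apply, hx]
    ring
  have h2 := (withDensity_eq_iff_of_sigmaFinite hd.ennreal_ofReal.aemeasurable hAρ.aemeasurable).1 h1
  filter_upwards [R.ae_fiberHaar_of_ae_haarMeasure g hB₀ hpr h2,
    ae_restrict_mem hB₀.measurableSet] with b hb hbB
  have hpos := R.fiberMass_pos g hB₀ hpr hbB
  have hA : A b = R.fiberMass g b := by
    have h3 : ENNReal.ofReal (R.fiberMass g b) = ENNReal.ofReal (A b) := by
      rw [R.ofReal_fiberMass g hB₀ hpr hbB, lintegral_congr_ae hb]
      have : ∫⁻ x, ENNReal.ofReal (A (pr x)) * ENNReal.ofReal (ρ x) ∂(R.fiberHaar b) =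
          ∫⁻ x, ENNReal.ofReal (A b) * ENNReal.ofReal (ρ x) ∂(R.fiberHaar b) := by
        refine lintegral_congr_ae ?_
        filter_upwards [R.ae_fiberHaar_pr hpr b] with x hx
        rw [hx]
      rw [this, lintegral_const_mul' _ _ ENNReal.ofReal_ne_top, hD.normalized b hbB, mul_one]
    exact ((ENNReal.ofReal_eq_ofReal_iff hpos.le (hD.pos_A b hbB).le).1 h3).symm
  refine ⟨hA, ?_⟩
  filter_upwards [hb, R.ae_fiberHaar_pr hpr b] with x hx hxb
  have hρ := hD.pos_ρ x (by rwa [hxb])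
  rw [hxb, hA, ← ENNReal.ofReal_mul hpos.le] at hx
  exact ((ENNReal.ofReal_eq_ofReal_iff (R.density_nonneg g x) (mul_nonneg hpos.le hρ.le)).1 hx).symm

theorem average_ae_eq (hB₀ : IsOpen B₀) (hB₀c : IsCompact (closure B₀))
    (hpr : Continuous pr) (hD : IsNormalizedDisintegration pr B₀ (riemannianMeasure g)
      (riemannianMeasure gB) R.fiberHaar A ρ) (u : X → ℝ) :
    average R.fiberHaar A ρ u =ᵐ[(riemannianMeasure gB).restrict B₀] R.stdAverage g u := by
  filter_upwards [ae_eq_of_isNormalizedDisintegration hB₀ hB₀c hpr hD,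
    ae_restrict_mem hB₀.measurableSet] with b hb hbB
  have hpos := R.fiberMass_pos g hB₀ hpr hbB
  have h1 : R.fiberInt g u b = R.fiberMass g b * ∫ x, u x * ρ x ∂(R.fiberHaar b) := by
    rw [fiberInt, ← integral_const_mul]
    refine integral_congr_ae ?_
    filter_upwards [hb.2] with x hx
    rw [← hx]
    ring
  rw [average, stdAverage, hb.1, h1, ← mul_assoc]
  congr 1
  rw [inv_mul_eq_div, Real.div_sqrt]

theorem lift_ae_eq (hB₀ : IsOpen B₀) (hB₀c : IsCompact (closure B₀))
    (hpr : Continuous pr) (hD : IsNormalizedDisintegration pr B₀ (riemannianMeasure g)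
      (riemannianMeasure gB) R.fiberHaar A ρ) (v : M → ℝ) :
    lift pr A v =ᵐ[(riemannianMeasure g).restrict (pr ⁻¹' B₀)] lift pr (R.fiberMass g) v := by
  have h := (R.quasiMeasurePreserving_pr g hB₀ hpr).ae
    (ae_eq_of_isNormalizedDisintegration hB₀ hB₀c hpr hD)
  filter_upwards [h] with x hx
  rw [lift, lift, hx.1]

theorem average_lift (hpr : Continuous pr) {μ : Measure X} {μB : Measure M}
    (hD : IsNormalizedDisintegration pr B₀ μ μB R.fiberHaar A ρ) (v : M → ℝ) {b : M} (hb : b ∈ B₀) :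
    average R.fiberHaar A ρ (lift pr A v) b = v b := by
  have hs := Real.sqrt_pos.2 (hD.pos_A b hb)
  have h1 : ∫ x, ρ x ∂(R.fiberHaar b) = 1 := by
    rw [integral_eq_lintegral_of_nonneg_ae _ hD.measurable_ρ.aestronglyMeasurable,
      hD.normalized b hb, ENNReal.toReal_one]
    filter_upwards [R.ae_fiberHaar_pr hpr b] with x hx
    exact (hD.pos_ρ x (by rwa [hx])).le
  have h2 : ∫ x, lift pr A v x * ρ x ∂(R.fiberHaar b) = (Real.sqrt (A b))⁻¹ * v b := by
    rw [← mul_one ((Real.sqrt (A b))⁻¹ * v b), ← h1, ← integral_const_mul]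
    refine integral_congr_ae ?_
    filter_upwards [R.ae_fiberHaar_pr hpr b] with x hx
    rw [lift, hx]
  rw [average, h2, mul_inv_cancel_left₀ hs.ne']

end Uniqueness

section L2

theorem measurable_lintegral_fiberHaar (g : Metric 4 X) (hB₀ : IsOpen B₀) (hpr : Continuous pr) {f : X → ℝ≥0∞}
    (hf : Measurable f) : Measurable fun b => ∫⁻ x, f x ∂(R.fiberHaar b) :=
  (Measure.measurable_lintegral hf).comp (R.measurable_fiberHaar g hB₀ hpr)

theorem l2Norm_sq_eq (hB₀ : IsOpen B₀) (hpr : Continuous pr) {h : X → ℝ} (hh : Measurable h) :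
    l2Norm g (pr ⁻¹' B₀) h ^ 2 =
      ∫⁻ b in B₀, ∫⁻ x, ENNReal.ofReal (h x ^ 2) * ENNReal.ofReal (R.density g x) ∂(R.fiberHaar b)
        ∂(riemannianMeasure gB) := by
  rw [l2Norm_sq, R.setLIntegral_riemannianMeasure g hB₀ hpr (hh.pow_const 2).ennreal_ofReal]

theorem integrable_sq_mul_density (hB₀ : IsOpen B₀) (hpr : Continuous pr) {b : M}
    {h : X → ℝ} (hh : Measurable h)
    (hfin : ∫⁻ x, ENNReal.ofReal (h x ^ 2) * ENNReal.ofReal (R.density g x) ∂(R.fiberHaar b) ≠ ⊤) :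
    Integrable (fun x => h x ^ 2 * R.density g x) (R.fiberHaar b) := by
  have hd := R.measurable_density g hB₀ hpr
  refine (lintegral_ofReal_ne_top_iff_integrable
    ((hh.pow_const 2).mul hd).aestronglyMeasurable
    (Eventually.of_forall fun x => mul_nonneg (sq_nonneg _) (R.density_nonneg g x))).1 ?_
  refine (lintegral_congr fun x => ?_).trans_ne hfin
  exact ENNReal.ofReal_mul (sq_nonneg _)

theorem integrable_mul_density_of_sq (hB₀ : IsOpen B₀) (hpr : Continuous pr) {b : M} (hb : b ∈ B₀)
    {h : X → ℝ} (hh : Measurable h)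
    (hI : Integrable (fun x => h x ^ 2 * R.density g x) (R.fiberHaar b)) :
    Integrable (fun x => h x * R.density g x) (R.fiberHaar b) := by
  have hd := R.measurable_density g hB₀ hpr
  refine (hI.add (R.integrable_density g hB₀ hpr hb)).mono' (hh.mul hd).aestronglyMeasurable
    (Eventually.of_forall fun x => ?_)
  have hJ := R.density_nonneg g x
  rw [Real.norm_eq_abs, abs_mul, abs_of_nonneg hJ]
  have h1 : |h x| ≤ h x ^ 2 + 1 := by
    rw [← sq_abs]
    nlinarith [sq_nonneg (|h x| - 1), abs_nonneg (h x)]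
  calc |h x| * R.density g x ≤ (h x ^ 2 + 1) * R.density g x := by gcongr
    _ = _ := by simp only [Pi.add_apply]; ring

/-- Cauchy-Schwarz on the fibre, once the right side is finite and the integrals are genuine.
Integrated over the base, it makes the average an `L²` contraction. -/
theorem ofReal_sq_stdAverage_le (hB₀ : IsOpen B₀) (hpr : Continuous pr) {b : M} (hb : b ∈ B₀)
    {h : X → ℝ} (hh : Measurable h) :
    ENNReal.ofReal (R.stdAverage g h b ^ 2) ≤
      ∫⁻ x, ENNReal.ofReal (h x ^ 2) * ENNReal.ofReal (R.density g x) ∂(R.fiberHaar b) := by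
  by_cases hfin : ∫⁻ x, ENNReal.ofReal (h x ^ 2) * ENNReal.ofReal (R.density g x)
      ∂(R.fiberHaar b) = ⊤
  · rw [hfin]
    exact le_top
  have hI := R.integrable_sq_mul_density g hB₀ hpr hh hfin
  have hpos := R.fiberMass_pos g hB₀ hpr hb
  have h1 := sq_integral_mul_le (R.integrable_density g hB₀ hpr hb)
    (R.integrable_mul_density_of_sq g hB₀ hpr hb hh hI) hI (R.density_nonneg g) hpos
  have h2 : R.stdAverage g h b ^ 2 =
      (∫ x, R.density g x ∂(R.fiberHaar b))⁻¹ * (∫ x, h x * R.density g x ∂(R.fiberHaar b)) ^ 2 := by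
    rw [stdAverage, mul_pow, inv_pow, Real.sq_sqrt hpos.le]
    rfl
  rw [h2]
  refine (ENNReal.ofReal_le_ofReal h1).trans_eq ?_
  rw [ofReal_integral_eq_lintegral_ofReal hI (Eventually.of_forall fun x =>
    mul_nonneg (sq_nonneg _) (R.density_nonneg g x))]
  exact lintegral_congr fun x => ENNReal.ofReal_mul (sq_nonneg _)

theorem stdAverage_congr_ae (hB₀ : IsOpen B₀) (hpr : Continuous pr) {u u' : X → ℝ}
    (h : u =ᵐ[(riemannianMeasure g).restrict (pr ⁻¹' B₀)] u') :
    R.stdAverage g u =ᵐ[(riemannianMeasure gB).restrict B₀] R.stdAverage g u' := by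
  filter_upwards [R.ae_fiberHaar_of_ae g hB₀ hpr h] with b hb
  rw [stdAverage, stdAverage, fiberInt, fiberInt]
  congr 1
  refine integral_congr_ae ?_
  filter_upwards [hb] with x hx
  rw [hx]

theorem l2Norm_stdAverage_le (hB₀ : IsOpen B₀) (hpr : Continuous pr) {u : X → ℝ}
    (hu : AEStronglyMeasurable u ((riemannianMeasure g).restrict (pr ⁻¹' B₀))) :
    l2Norm gB B₀ (R.stdAverage g u) ≤ l2Norm g (pr ⁻¹' B₀) u := by
  have hm := hu.stronglyMeasurable_mk.measurable
  rw [l2Norm, l2Norm, eLpNorm_congr_ae (R.stdAverage_congr_ae g hB₀ hpr hu.ae_eq_mk),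
    eLpNorm_congr_ae hu.ae_eq_mk]
  refine (ENNReal.pow_le_pow_left_iff two_ne_zero).1 ?_
  change l2Norm gB B₀ _ ^ 2 ≤ l2Norm g (pr ⁻¹' B₀) _ ^ 2
  rw [R.l2Norm_sq_eq g hB₀ hpr hm, l2Norm_sq]
  exact setLIntegral_mono' hB₀.measurableSet fun b hb =>
    R.ofReal_sq_stdAverage_le g hB₀ hpr hb hm

theorem measurable_stdAverage (hB₀ : IsOpen B₀) (hpr : Continuous pr) {u : X → ℝ}
    (hu : Measurable u) : Measurable (R.stdAverage g u) := by
  let κ : ProbabilityTheory.Kernel M X := ⟨R.fiberHaar, R.measurable_fiberHaar g hB₀ hpr⟩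
  have h : StronglyMeasurable fun b => ∫ x, u x * R.density g x ∂(κ b) :=
    StronglyMeasurable.integral_kernel
      (hu.mul (R.measurable_density g hB₀ hpr)).stronglyMeasurable
  exact (R.measurable_fiberMass g hB₀ hpr).sqrt.inv.mul h.measurable

theorem aestronglyMeasurable_stdAverage (hB₀ : IsOpen B₀) (hpr : Continuous pr) {u : X → ℝ}
    (hu : AEStronglyMeasurable u ((riemannianMeasure g).restrict (pr ⁻¹' B₀))) :
    AEStronglyMeasurable (R.stdAverage g u) ((riemannianMeasure gB).restrict B₀) :=
  (R.measurable_stdAverage g hB₀ hpr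
    hu.stronglyMeasurable_mk.measurable).aestronglyMeasurable.congr
      (R.stdAverage_congr_ae g hB₀ hpr hu.ae_eq_mk).symm

/-- For `u` in `L²` the fibre integrals converge only for almost every `b`, and additivity of the
average is available only there. -/
theorem ae_integrable_mul_density (hB₀ : IsOpen B₀) (hpr : Continuous pr) {u : X → ℝ}
    (hu : InL2 g (pr ⁻¹' B₀) u) : ∀ᵐ b ∂((riemannianMeasure gB).restrict B₀),
      Integrable (fun x => u x * R.density g x) (R.fiberHaar b) := by
  have hm := hu.1.stronglyMeasurable_mk.measurable
  have h1 : l2Norm g (pr ⁻¹' B₀) (hu.1.mk u) ^ 2 ≠ ⊤ := by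
    rw [l2Norm, ← eLpNorm_congr_ae hu.1.ae_eq_mk]
    exact ENNReal.pow_ne_top hu.2.ne
  rw [R.l2Norm_sq_eq g hB₀ hpr hm] at h1
  filter_upwards [ae_lt_top (R.measurable_lintegral_fiberHaar g hB₀ hpr
    ((hm.pow_const 2).ennreal_ofReal.mul (R.measurable_density g hB₀ hpr).ennreal_ofReal)) h1,
    ae_restrict_mem hB₀.measurableSet, R.ae_fiberHaar_of_ae g hB₀ hpr hu.1.ae_eq_mk]
    with b hb hbB hbu
  refine (R.integrable_mul_density_of_sq g hB₀ hpr hbB hm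
    (R.integrable_sq_mul_density g hB₀ hpr hm hb.ne)).congr ?_
  filter_upwards [hbu] with x hx
  rw [hx]

theorem stdAverage_sub_ae_eq (hB₀ : IsOpen B₀) (hpr : Continuous pr) {u w : X → ℝ}
    (hu : InL2 g (pr ⁻¹' B₀) u) (hw : InL2 g (pr ⁻¹' B₀) w) :
    R.stdAverage g (w - u) =ᵐ[(riemannianMeasure gB).restrict B₀]
      R.stdAverage g w - R.stdAverage g u := by
  filter_upwards [R.ae_integrable_mul_density g hB₀ hpr hu,
    R.ae_integrable_mul_density g hB₀ hpr hw] with b h1 h2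
  simp only [stdAverage, fiberInt, Pi.sub_apply, sub_mul]
  rw [integral_sub h2 h1, mul_sub]

/-- The normalized fibre average is a contraction. -/
theorem l2Norm_stdAverage_sub_le (hB₀ : IsOpen B₀) (hpr : Continuous pr) {u w : X → ℝ} {v : M → ℝ}
    (hu : InL2 g (pr ⁻¹' B₀) u) (hw : InL2 g (pr ⁻¹' B₀) w) (hv : InL2 gB B₀ v) :
    l2Norm gB B₀ (R.stdAverage g w - v) ≤
      l2Norm gB B₀ (R.stdAverage g u - v) + l2Norm g (pr ⁻¹' B₀) (w - u) := by
  have h1 : R.stdAverage g w - v =ᵐ[(riemannianMeasure gB).restrict B₀]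
      (R.stdAverage g u - v) + R.stdAverage g (w - u) := by
    filter_upwards [R.stdAverage_sub_ae_eq g hB₀ hpr hu hw] with b hb
    simp only [Pi.sub_apply, Pi.add_apply] at hb ⊢
    rw [hb]
    ring
  rw [l2Norm, eLpNorm_congr_ae h1]
  refine (eLpNorm_add_le ((R.aestronglyMeasurable_stdAverage g hB₀ hpr hu.1).sub hv.1)
    (R.aestronglyMeasurable_stdAverage g hB₀ hpr (hw.1.sub hu.1)) (by norm_num)).trans ?_
  exact add_le_add le_rfl (R.l2Norm_stdAverage_le g hB₀ hpr (hw.1.sub hu.1))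

theorem aestronglyMeasurable_lift (hB₀ : IsOpen B₀) (hpr : Continuous pr) {v : M → ℝ}
    (hv : AEStronglyMeasurable v ((riemannianMeasure gB).restrict B₀)) :
    AEStronglyMeasurable (lift pr (R.fiberMass g) v)
      ((riemannianMeasure g).restrict (pr ⁻¹' B₀)) :=
  (((R.measurable_fiberMass g hB₀ hpr).comp
    hpr.measurable).sqrt.inv.aestronglyMeasurable).mul
      (hv.comp_quasiMeasurePreserving (R.quasiMeasurePreserving_pr g hB₀ hpr))

/-- The square of the normalizing factor is `m⁻¹`, which cancels the mass of the fibre. -/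
theorem l2Norm_lift (hB₀ : IsOpen B₀) (hpr : Continuous pr) {v : M → ℝ}
    (hv : AEStronglyMeasurable v ((riemannianMeasure gB).restrict B₀)) :
    l2Norm g (pr ⁻¹' B₀) (lift pr (R.fiberMass g) v) = l2Norm gB B₀ v := by
  have hm := hv.stronglyMeasurable_mk.measurable
  have h1 : lift pr (R.fiberMass g) v =ᵐ[(riemannianMeasure g).restrict (pr ⁻¹' B₀)]
      lift pr (R.fiberMass g) (hv.mk v) := by
    filter_upwards [(R.quasiMeasurePreserving_pr g hB₀ hpr).ae hv.ae_eq_mk] with x hx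
    rw [lift, lift, hx]
  rw [l2Norm, l2Norm, eLpNorm_congr_ae h1, eLpNorm_congr_ae hv.ae_eq_mk]
  refine (ENNReal.pow_right_strictMono two_ne_zero).injective ?_
  change l2Norm g (pr ⁻¹' B₀) _ ^ 2 = l2Norm gB B₀ _ ^ 2
  rw [l2Norm_sq, l2Norm_sq]
  have hmeas : Measurable fun b => ENNReal.ofReal
      (((Real.sqrt (R.fiberMass g b))⁻¹ * hv.mk v b) ^ 2) :=
    (((R.measurable_fiberMass g hB₀ hpr).sqrt.inv.mul hm).pow_const 2).ennreal_ofReal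
  refine (R.setLIntegral_comp_pr g hB₀ hpr hmeas).trans ?_
  refine setLIntegral_congr_fun hB₀.measurableSet fun b hb => ?_
  have hpos := R.fiberMass_pos g hB₀ hpr hb
  rw [← ENNReal.ofReal_mul' hpos.le, mul_pow, inv_pow, Real.sq_sqrt hpos.le]
  congr 1
  field_simp

end L2

end SemiflatReference

/-! ### Quadratic structure of the Dirichlet energy. -/

section Gradient

variable {n : ℕ} {X : Type*} [TopologicalSpace X] [ChartedSpace (Eu n) X]
  [IsManifold 𝓘(ℝ, Eu n) ∞ X] (g : Metric n X)

theorem eq_of_inner_eq {x : X} {v v' : Tan n x} (h : ∀ w, g.inner x v w = g.inner x v' w) :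
    v = v' := by
  by_contra hne
  have h1 : 0 < g.inner x (v - v') (v - v') := g.pos x _ (sub_ne_zero.2 hne)
  have h2 : g.inner x (v - v') = g.inner x v - g.inner x v' := map_sub (g.inner x) v v'
  rw [h2] at h1
  exact h1.ne' (sub_eq_zero.2 (h (v - v')))

theorem gradSq_of_differential {φ : X → ℝ} {x : X} {v : Tan n x}
    (h : ∀ w, g.inner x v w = differential φ x w) : gradSq g φ x = g.inner x v v := by
  have : gradient g φ x = v := eq_of_inner_eq g fun w => by rw [gradient_spec, h]
  rw [gradSq, this]

theorem gradSq_eq_zero_of_eventuallyEq {φ : X → ℝ} {x : X} (h : φ =ᶠ[𝓝 x] fun _ => 0) :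
    gradSq g φ x = 0 := by
  refine le_antisymm ?_ (gradSq_nonneg g φ x)
  have h1 : gradSq g φ x ≤ 0 ^ 2 := gradSq_le_sq g φ x fun w => by
    have : differential φ x w = 0 := by
      rw [differential, h.mfderiv_eq, mfderiv_const]
      rfl
    simp [this]
  simpa using h1

variable {φ ψ : X → ℝ} {x : X}

theorem gradSq_parallelogram (hφ : MDifferentiableAt 𝓘(ℝ, Eu n) 𝓘(ℝ, ℝ) φ x)
    (hψ : MDifferentiableAt 𝓘(ℝ, Eu n) 𝓘(ℝ, ℝ) ψ x) :
    gradSq g (φ - ψ) x + gradSq g (φ + ψ) x = 2 * gradSq g φ x + 2 * gradSq g ψ x := by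
  set G : Eu n →L[ℝ] Eu n →L[ℝ] ℝ := modelForm g.inner x with hG
  set v : Eu n := gradient g φ x with hv
  set v' : Eu n := gradient g ψ x with hv'
  have h1 : ∀ w : Eu n, G v w = differential φ x w := gradient_spec g φ x
  have h2 : ∀ w : Eu n, G v' w = differential ψ x w := gradient_spec g ψ x
  have h3 : gradSq g (φ + ψ) x = G (v + v') (v + v') := by
    refine gradSq_of_differential g (v := v + v') fun w => ?_
    have hd : differential (n := n) (φ + ψ) x = differential φ x + differential ψ x := by
      rw [differential, mfderiv_add hφ hψ]
      rfl
    rw [hd]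
    have : G (v + v') w = G v w + G v' w := by rw [map_add]; rfl
    exact this.trans (congrArg₂ (· + ·) (h1 w) (h2 w))
  have h4 : gradSq g (φ - ψ) x = G (v - v') (v - v') := by
    refine gradSq_of_differential g (v := v - v') fun w => ?_
    have hd : differential (n := n) (φ - ψ) x = differential φ x - differential ψ x := by
      rw [differential, mfderiv_sub hφ hψ]
      rfl
    rw [hd]
    have : G (v - v') w = G v w - G v' w := by rw [map_sub]; rfl
    exact this.trans (congrArg₂ (· - ·) (h1 w) (h2 w))
  have h5 : gradSq g φ x = G v v := rfl
  have h6 : gradSq g ψ x = G v' v' := rfl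
  rw [h3, h4, h5, h6]
  simp only [map_add, map_sub, _root_.add_apply, _root_.sub_apply]
  ring

theorem gradSq_const_smul (c : ℝ) (hφ : MDifferentiableAt 𝓘(ℝ, Eu n) 𝓘(ℝ, ℝ) φ x) :
    gradSq g (c • φ) x = c ^ 2 * gradSq g φ x := by
  set G : Eu n →L[ℝ] Eu n →L[ℝ] ℝ := modelForm g.inner x with hG
  set v : Eu n := gradient g φ x with hv
  have h1 : ∀ w : Eu n, G v w = differential φ x w := gradient_spec g φ x
  have h3 : gradSq g (c • φ) x = G (c • v) (c • v) := by
    refine gradSq_of_differential g (v := c • v) fun w => ?_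
    have hd : differential (n := n) (c • φ) x = c • differential φ x := by
      rw [differential, const_smul_mfderiv hφ]
      rfl
    rw [hd]
    have : G (c • v) w = c * G v w := by rw [map_smul]; rfl
    exact this.trans (congrArg (c * ·) (h1 w))
  have h5 : gradSq g φ x = G v v := rfl
  rw [h3, h5, map_smul, map_smul]
  simp only [FunLike.coe_smul, Pi.smul_apply, smul_eq_mul]
  ring

end Gradient

section TestFunction

variable {n : ℕ} {X : Type*} [TopologicalSpace X] [ChartedSpace (Eu n) X] {Ω : Set X} {φ ψ : X → ℝ}

theorem contMDiff_sub (hφ : ContMDiff 𝓘(ℝ, Eu n) 𝓘(ℝ, ℝ) ∞ φ)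
    (hψ : ContMDiff 𝓘(ℝ, Eu n) 𝓘(ℝ, ℝ) ∞ ψ) : ContMDiff 𝓘(ℝ, Eu n) 𝓘(ℝ, ℝ) ∞ (φ - ψ) :=
  hφ.sub hψ

theorem IsTestFunction.add (hφ : IsTestFunction (n := n) Ω φ) (hψ : IsTestFunction (n := n) Ω ψ) :
    IsTestFunction (n := n) Ω (φ + ψ) :=
  ⟨hφ.1.add hψ.1, hφ.2.1.add hψ.2.1, (tsupport_add φ ψ).trans (union_subset hφ.2.2 hψ.2.2)⟩

theorem IsTestFunction.const_smul (c : ℝ) (hφ : IsTestFunction (n := n) Ω φ) :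
    IsTestFunction (n := n) Ω (c • φ) :=
  ⟨(contMDiff_const.mul hφ.1 : ContMDiff 𝓘(ℝ, Eu n) 𝓘(ℝ, ℝ) ∞ fun x => c * φ x), hφ.2.1.mono (Function.support_const_smul_subset c φ),
    (closure_mono (Function.support_const_smul_subset c φ)).trans hφ.2.2⟩

end TestFunction

/-! ### Finiteness and lower semicontinuity of the Dirichlet form. -/

section Forms

variable {n : ℕ} {X : Type*} [TopologicalSpace X] [ChartedSpace (Eu n) X]
  [IsManifold 𝓘(ℝ, Eu n) ∞ X] [T2Space X] [SecondCountableTopology X]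
  [MeasurableSpace X] [BorelSpace X] (g : Metric n X) {Ω : Set X} {φ ψ : X → ℝ}

theorem smoothEnergy_parallelogram (hφ : ContMDiff 𝓘(ℝ, Eu n) 𝓘(ℝ, ℝ) ∞ φ)
    (hψ : ContMDiff 𝓘(ℝ, Eu n) 𝓘(ℝ, ℝ) ∞ ψ) :
    smoothEnergy g Ω (φ - ψ) + smoothEnergy g Ω (φ + ψ) =
      2 * smoothEnergy g Ω φ + 2 * smoothEnergy g Ω ψ := by
  have hm := fun {φ : X → ℝ} (hφ : ContMDiff 𝓘(ℝ, Eu n) 𝓘(ℝ, ℝ) ∞ φ) =>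
    (continuous_gradSq g hφ).measurable.ennreal_ofReal
  simp only [smoothEnergy]
  rw [← lintegral_add_left (hm (contMDiff_sub hφ hψ)), ← lintegral_const_mul _ (hm hφ),
    ← lintegral_const_mul _ (hm hψ), ← lintegral_add_left ((hm hφ).const_mul _)]
  refine lintegral_congr fun x => ?_
  have h := gradSq_parallelogram g (hφ.mdifferentiableAt (x := x) (by simp))
    (hψ.mdifferentiableAt (x := x) (by simp))
  have h1 := gradSq_nonneg g φ x
  have h2 := gradSq_nonneg g ψ x
  rw [← ENNReal.ofReal_add (gradSq_nonneg _ _ _) (gradSq_nonneg _ _ _), h,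
    ENNReal.ofReal_add (by positivity) (by positivity), ENNReal.ofReal_mul two_pos.le,
    ENNReal.ofReal_mul two_pos.le, ENNReal.ofReal_ofNat]

theorem smoothEnergy_const_smul (c : ℝ) (hφ : ContMDiff 𝓘(ℝ, Eu n) 𝓘(ℝ, ℝ) ∞ φ) :
    smoothEnergy g Ω (c • φ) = ENNReal.ofReal (c ^ 2) * smoothEnergy g Ω φ := by
  simp only [smoothEnergy]
  rw [← lintegral_const_mul' _ _ ENNReal.ofReal_ne_top]
  refine lintegral_congr fun x => ?_
  rw [gradSq_const_smul g c (hφ.mdifferentiableAt (x := x) (by simp)),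
    ENNReal.ofReal_mul (sq_nonneg c)]

theorem IsTestFunction.smoothEnergy_lt_top (hφ : IsTestFunction (n := n) Ω φ) :
    smoothEnergy g Ω φ < ⊤ := by
  have := isLocallyFiniteMeasure_riemannianMeasure g
  have hc := continuous_gradSq g hφ.1
  have hs : HasCompactSupport (gradSq g φ) := hφ.2.1.of_isClosed_subset (isClosed_tsupport _)
    (closure_minimal (fun x hx => by
      by_contra h
      refine hx (gradSq_eq_zero_of_eventuallyEq g ?_)
      filter_upwards [(isClosed_tsupport φ).isOpen_compl.mem_nhds h] with z hz
      exact image_eq_zero_of_notMem_tsupport hz) (isClosed_tsupport φ))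
  have hi : Integrable (gradSq g φ) (riemannianMeasure g) := hc.integrable_of_hasCompactSupport hs
  exact (setLIntegral_le_lintegral Ω _).trans_lt hi.lintegral_lt_top

theorem IsTestFunction.inL2 (hφ : IsTestFunction (n := n) Ω φ) : InL2 g Ω φ := by
  have := isLocallyFiniteMeasure_riemannianMeasure g
  exact (hφ.1.continuous.memLp_of_hasCompactSupport hφ.2.1).restrict Ω

/-- The form is an infimum of lower limits, so a single member of one approximating sequence already
does. Later arguments need only this one test function. -/
theorem exists_isTestFunction_of_dirichletForm_lt {u : X → ℝ} {c : ℝ≥0∞}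
    (h : dirichletForm g Ω u < c) {η : ℝ≥0∞} (hη : 0 < η) :
    ∃ φ, IsTestFunction (n := n) Ω φ ∧ l2Norm g Ω (φ - u) < η ∧ smoothEnergy g Ω φ < c := by
  obtain ⟨φ, hφ⟩ := iInf_lt_iff.1 h
  obtain ⟨hφ, hlt⟩ := iInf_lt_iff.1 hφ
  obtain ⟨k, hk, hk'⟩ := ((frequently_lt_of_liminf_lt (by isBoundedDefault) hlt).and_eventually
    (hφ.tendsto.eventually (gt_mem_nhds hη))).exists
  exact ⟨φ k, hφ.test k, hk', hk⟩

theorem smoothEnergy_le_of_sub (hφ : ContMDiff 𝓘(ℝ, Eu n) 𝓘(ℝ, ℝ) ∞ φ)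
    (hψ : ContMDiff 𝓘(ℝ, Eu n) 𝓘(ℝ, ℝ) ∞ ψ) :
    smoothEnergy g Ω φ ≤ 2 * smoothEnergy g Ω (φ - ψ) + 2 * smoothEnergy g Ω ψ := by
  have h := smoothEnergy_parallelogram g (Ω := Ω) (contMDiff_sub hφ hψ) hψ
  have h2 : φ - ψ + ψ = φ := sub_add_cancel φ ψ
  rw [h2] at h
  rw [← h]
  exact le_add_self

/-- A Cauchy sequence for the energy seminorm is eventually bounded, by comparison with one fixed
member. -/
theorem dirichletForm_lt_top {u : X → ℝ} (hu : u ∈ H10 g Ω) : dirichletForm g Ω u < ⊤ := by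
  obtain ⟨φ, hφ⟩ := hu
  obtain ⟨N, hN⟩ := eventually_atTop.1 (hφ.cauchy.eventually (gt_mem_nhds one_pos))
  have hfin := (hφ.test N.2).smoothEnergy_lt_top g
  refine (iInf₂_le φ hφ).trans_lt ((liminf_le_of_frequently_le' (Eventually.frequently ?_)).trans_lt
    (b := 2 * 1 + 2 * smoothEnergy g Ω (φ N.2))
    (ENNReal.add_lt_top.2 ⟨ENNReal.mul_lt_top ENNReal.ofNat_lt_top ENNReal.one_lt_top,
      ENNReal.mul_lt_top ENNReal.ofNat_lt_top hfin⟩))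
  filter_upwards [eventually_ge_atTop N.1] with k hk
  refine (smoothEnergy_le_of_sub g (hφ.test k).1 (hφ.test N.2).1).trans ?_
  gcongr
  exact (hN (k, N.2) ⟨hk, le_rfl⟩).le

/-- Lower semicontinuity of the Dirichlet form: a function which can be approximated in `L²` by test
functions of bounded energy belongs to `H¹₀`. -/
theorem mem_H10_and_dirichletForm_le {v : X → ℝ} (hv : InL2 g Ω v) {L : ℝ≥0∞} (hL : L < ⊤)
    (h : ∀ η : ℝ≥0∞, 0 < η → ∃ φ, IsTestFunction (n := n) Ω φ ∧ l2Norm g Ω (φ - v) ≤ η ∧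
      smoothEnergy g Ω φ ≤ L + η) :
    v ∈ H10 g Ω ∧ dirichletForm g Ω v ≤ L := by
  let r : ℕ → ℝ≥0∞ := fun k => ((k : ℝ≥0∞) + 1)⁻¹
  have hr0 : ∀ k, 0 < r k := fun k => ENNReal.inv_pos.2 (by finiteness)
  have hrt : ∀ k, r k ≠ ⊤ := fun k => ENNReal.inv_ne_top.2 (by positivity)
  have hra : Antitone r := fun k l hkl => ENNReal.inv_le_inv.2 (by gcongr)
  have hrl : Tendsto r atTop (𝓝 0) := by
    have := (tendsto_add_atTop_iff_nat 1).2 ENNReal.tendsto_inv_nat_nhds_zero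
    simpa [r] using this
  let S : ℕ → Set (X → ℝ) := fun k => {φ | IsTestFunction (n := n) Ω φ ∧ l2Norm g Ω (φ - v) ≤ r k}
  have hSa : ∀ {k l}, k ≤ l → S l ⊆ S k := fun hkl φ hφ => ⟨hφ.1, hφ.2.trans (hra hkl)⟩
  -- `m k` is the least energy in the convex set of test functions within `r k` of `v`. As in the
  -- projection theorem, near-minimizers of these nested problems form a Cauchy sequence, so no weak
  -- compactness is needed.
  let m : ℕ → ℝ≥0∞ := fun k => ⨅ φ ∈ S k, smoothEnergy g Ω φ
  have hmL : ∀ k, m k ≤ L := by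
    intro k
    refine le_of_forall_gt fun c hc => ?_
    obtain ⟨d, hd0, hd⟩ := ENNReal.lt_iff_exists_add_pos_lt.1 hc
    obtain ⟨φ, h1, h2, h3⟩ := h (min (r k) d) (lt_min (hr0 k) (by exact_mod_cast hd0))
    refine (iInf₂_le φ ⟨h1, h2.trans (min_le_left _ _)⟩).trans_lt ((h3.trans ?_).trans_lt hd)
    gcongr
    exact min_le_right _ _
  have hmm : Monotone m := fun k l hkl => biInf_mono (hSa hkl)
  have hmt : ∀ k, m k ≠ ⊤ := fun k => ((hmL k).trans_lt hL).ne
  have hex : ∀ k, ∃ φ ∈ S k, smoothEnergy g Ω φ ≤ m k + r k := by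
    intro k
    have : m k < m k + r k := ENNReal.lt_add_right (hmt k) (hr0 k).ne'
    obtain ⟨φ, hφ⟩ := iInf_lt_iff.1 this
    obtain ⟨hφS, hlt⟩ := iInf_lt_iff.1 hφ
    exact ⟨φ, hφS, hlt.le⟩
  choose f hfS hfq using hex
  -- The midpoint of `f k` and `f l` stays in `S k`, hence has energy at least `m k`.
  have hmid : ∀ {k l}, k ≤ l → 4 * m k ≤ smoothEnergy g Ω (f k + f l) := by
    intro k l hkl
    have hl := hSa hkl (hfS l)
    have hk := hfS k
    have hS : (2⁻¹ : ℝ) • (f k + f l) ∈ S k := by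
      refine ⟨(hk.1.add hl.1).const_smul _, ?_⟩
      have e : (2⁻¹ : ℝ) • (f k + f l) - v = (2⁻¹ : ℝ) • ((f k - v) + (f l - v)) := by
        funext x
        simp only [Pi.sub_apply, Pi.smul_apply, Pi.add_apply, smul_eq_mul]
        ring
      rw [e, l2Norm, eLpNorm_const_smul]
      have h1 : l2Norm g Ω ((f k - v) + (f l - v)) ≤ r k + r k :=
        (eLpNorm_add_le ((hk.1.inL2 g).1.sub hv.1) ((hl.1.inL2 g).1.sub hv.1) (by norm_num)).trans
          (add_le_add hk.2 hl.2)
      have h2 : ‖(2⁻¹ : ℝ)‖ₑ = 2⁻¹ := by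
        rw [enorm_inv two_ne_zero]
        simp [Real.enorm_eq_ofReal]
      rw [h2]
      calc _ ≤ 2⁻¹ * (r k + r k) := mul_le_mul_right h1 _
        _ = r k := by
          rw [← two_mul, ← mul_assoc, ENNReal.inv_mul_cancel two_ne_zero ENNReal.ofNat_ne_top,
            one_mul]
    have h3 : m k ≤ smoothEnergy g Ω ((2⁻¹ : ℝ) • (f k + f l)) := iInf₂_le _ hS
    rw [smoothEnergy_const_smul g _ (hk.1.add hl.1).1] at h3
    have h4 : ENNReal.ofReal ((2⁻¹ : ℝ) ^ 2) = 4⁻¹ := by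
      rw [← ENNReal.ofReal_ofNat 4, ← ENNReal.ofReal_inv_of_pos (by norm_num)]
      norm_num
    rw [h4] at h3
    calc 4 * m k ≤ 4 * (4⁻¹ * smoothEnergy g Ω (f k + f l)) := by gcongr
      _ = _ := by
        rw [← mul_assoc, ENNReal.mul_inv_cancel (by norm_num) ENNReal.ofNat_ne_top, one_mul]
  -- By the parallelogram law the difference is controlled by the gap between the minima, which is
  -- small because `m` is monotone and bounded by `L`. The term `4 * m k` is finite and can be
  -- cancelled.
  have hdiff : ∀ {k l}, k ≤ l → smoothEnergy g Ω (f k - f l) ≤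
      2 * (m l - m k) + 4 * r k := by
    intro k l hkl
    have hp := smoothEnergy_parallelogram g (Ω := Ω) (hfS k).1.1 (hfS l).1.1
    have h1 : smoothEnergy g Ω (f k - f l) + 4 * m k ≤ (2 * (m l - m k) + 4 * r k) + 4 * m k := by
      calc _ ≤ smoothEnergy g Ω (f k - f l) + smoothEnergy g Ω (f k + f l) := by
            gcongr
            exact hmid hkl
        _ = 2 * smoothEnergy g Ω (f k) + 2 * smoothEnergy g Ω (f l) := hp
        _ ≤ 2 * (m k + r k) + 2 * (m l + r k) := by
            gcongr
            · exact hfq k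
            · refine (hfq l).trans ?_
              gcongr
              exact hra hkl
        _ = 2 * (m k + r k) + 2 * ((m l - m k) + m k + r k) := by
            rw [tsub_add_cancel_of_le (hmm hkl)]
        _ = _ := by ring
    exact ENNReal.le_of_add_le_add_right (ENNReal.mul_ne_top ENNReal.ofNat_ne_top (hmt k)) h1
  have hA : H1Approximates g Ω f v := by
    refine ⟨hv, fun k => (hfS k).1, ?_, ?_⟩
    · exact tendsto_of_tendsto_of_tendsto_of_le_of_le tendsto_const_nhds hrl (fun _ => zero_le)
        fun k => (hfS k).2
    · set s := ⨆ k, m k with hs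
      have hst : s ≠ ⊤ := ((iSup_le hmL).trans_lt hL).ne
      have hms : Tendsto m atTop (𝓝 s) := tendsto_atTop_iSup hmm
      have hbd : Tendsto (fun k => 2 * (s - m k) + 4 * r k) atTop (𝓝 0) := by
        have h1 : Tendsto (fun k => s - m k) atTop (𝓝 (s - s)) :=
          ENNReal.Tendsto.sub tendsto_const_nhds hms (Or.inl hst)
        rw [tsub_self] at h1
        have h2 := ENNReal.Tendsto.const_mul (a := 2) h1 (Or.inr ENNReal.ofNat_ne_top)
        have h3 := ENNReal.Tendsto.const_mul (a := 4) hrl (Or.inr ENNReal.ofNat_ne_top)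
        simpa using h2.add h3
      refine ENNReal.tendsto_nhds_zero.2 fun η hη => ?_
      obtain ⟨N, hN⟩ := eventually_atTop.1 (ENNReal.tendsto_nhds_zero.1 hbd η hη)
      refine eventually_atTop.2 ⟨(N, N), fun p hp => ?_⟩
      have key : ∀ {k l}, N ≤ k → k ≤ l → smoothEnergy g Ω (f k - f l) ≤ η := by
        intro k l hk hkl
        refine (hdiff hkl).trans (le_trans ?_ (hN k hk))
        gcongr
        exact le_iSup m l
      rcases le_total p.1 p.2 with hle | hle
      · exact key hp.1 hle
      · have e : f p.1 - f p.2 = (-1 : ℝ) • (f p.2 - f p.1) := by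
          rw [neg_one_smul, neg_sub]
        rw [e, smoothEnergy_const_smul g _ (contMDiff_sub (hfS _).1.1 (hfS _).1.1)]
        simpa using key hp.2 hle
  refine ⟨⟨f, hA⟩, (iInf₂_le f hA).trans ?_⟩
  have h1 : Tendsto (fun k => L + r k) atTop (𝓝 L) := by
    simpa using hrl.const_add L
  rw [← h1.liminf_eq]
  exact liminf_le_liminf (Eventually.of_forall fun k => (hfq k).trans (by gcongr; exact hmL k))

end Forms

/-! ### From test functions to `H¹₀`, and the limit along the filter. -/

namespace SemiflatReference

theorem tendsto_logError (C : ℝ) : Tendsto (fun ε => logError ε C) (𝓝 0) (𝓝 0) := by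
  have h : ContinuousAt (fun ε : ℝ => 64 * (ε / (1 - ε)) + |C| * ε) 0 := by
    refine ContinuousAt.add (continuousAt_const.mul (continuousAt_id.div ?_ (by simp))) ?_ <;>
      fun_prop
  simpa [ContinuousAt, logError] using h

variable {M : Type*} [TopologicalSpace M] [ChartedSpace (Eu 2) M] [IsManifold 𝓘(ℝ, Eu 2) ∞ M]
  [T2Space M] [SecondCountableTopology M] [MeasurableSpace M] [BorelSpace M]
  {gB : Metric 2 M} {B₀ : Set M}

theorem IsControlled.lift_mem_H10 {X : Type*} [TopologicalSpace X] [ChartedSpace (Eu 4) X]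
    [IsManifold 𝓘(ℝ, Eu 4) ∞ X] [T2Space X] [SecondCountableTopology X] [MeasurableSpace X]
    [BorelSpace X] {pr : X → M} {R : SemiflatReference pr gB B₀} {g : Metric 4 X} {ε C : ℝ}
    (H : R.IsControlled g ε C) {A : M → ℝ} {ρ : X → ℝ}
    (hD : IsNormalizedDisintegration pr B₀ (riemannianMeasure g) (riemannianMeasure gB)
      R.fiberHaar A ρ) {v : M → ℝ} (hv : v ∈ H10 gB B₀) {δ : ℝ} (hδ : δ = 3 / 2 * logError ε C) :
    lift pr A v ∈ H10 g (pr ⁻¹' B₀) ∧ dirichletForm g (pr ⁻¹' B₀) (lift pr A v) ≤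
      ENNReal.ofReal (1 - ε)⁻¹ * (ENNReal.ofReal (1 + δ) * dirichletForm gB B₀ v +
        ENNReal.ofReal (δ + δ ^ 2) * l2Norm gB B₀ v ^ 2) := by
  have hB₀ := H.isOpen_base
  have hpr := H.continuous_pr
  have hv2 : InL2 gB B₀ v := hv.choose_spec.inL2
  have hE := dirichletForm_lt_top gB hv
  have hlift := lift_ae_eq hB₀ H.isCompact_closure hpr hD v
  -- `Φ η` bounds the energy of the lift of a test function that is within `η` of `v` in norm and
  -- exceeds its energy by at most `η`. Continuity at zero lets `η` be removed.
  let Φ : ℝ≥0∞ → ℝ≥0∞ := fun η => ENNReal.ofReal (1 - ε)⁻¹ *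
    (ENNReal.ofReal (1 + δ) * (dirichletForm gB B₀ v + η) +
      ENNReal.ofReal (δ + δ ^ 2) * (l2Norm gB B₀ v + η) ^ 2)
  have hΦ : Continuous Φ := (ENNReal.continuous_const_mul ENNReal.ofReal_ne_top).comp
    (((ENNReal.continuous_const_mul ENNReal.ofReal_ne_top).comp
      (continuous_const.add continuous_id)).add
    ((ENNReal.continuous_const_mul ENNReal.ofReal_ne_top).comp
      ((ENNReal.continuous_pow 2).comp (continuous_const.add continuous_id))))
  have hΦ0 : Φ 0 < ⊤ := by
    have h1 : l2Norm gB B₀ v < ⊤ := hv2.2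
    simp only [Φ, add_zero]
    finiteness
  have hL : Φ 0 = ENNReal.ofReal (1 - ε)⁻¹ * (ENNReal.ofReal (1 + δ) * dirichletForm gB B₀ v +
        ENNReal.ofReal (δ + δ ^ 2) * l2Norm gB B₀ v ^ 2) := by simp only [Φ, add_zero]
  rw [← hL]
  have hlm : MemLp (lift pr (R.fiberMass g) v) 2 ((riemannianMeasure g).restrict (pr ⁻¹' B₀)) :=
    ⟨R.aestronglyMeasurable_lift g hB₀ hpr hv2.1,
      (R.l2Norm_lift g hB₀ hpr hv2.1).trans_lt hv2.2⟩
  refine mem_H10_and_dirichletForm_le g (hlm.ae_eq hlift.symm) hΦ0 fun η hη => ?_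
  have h1 : ∀ᶠ η' in 𝓝[>] (0 : ℝ≥0∞), Φ η' < Φ 0 + η :=
    (hΦ.continuousAt.eventually_lt continuousAt_const
      (ENNReal.lt_add_right hΦ0.ne hη.ne')).filter_mono nhdsWithin_le_nhds
  have h2 : ∀ᶠ η' in 𝓝[>] (0 : ℝ≥0∞), η' < η := (gt_mem_nhds hη).filter_mono nhdsWithin_le_nhds
  obtain ⟨η', ⟨h1, h2⟩, hη'⟩ := ((h1.and h2).and self_mem_nhdsWithin).exists
  have hη'0 : (0 : ℝ≥0∞) < η' := hη'
  obtain ⟨φ, hφ, hφ2, hφE⟩ := exists_isTestFunction_of_dirichletForm_lt gB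
    (ENNReal.lt_add_right hE.ne hη'0.ne') hη'0
  -- The approximants are lifted with the smooth `fiberMass`, because `A` is merely measurable; the
  -- two lifts of `v` agree almost everywhere.
  refine ⟨lift pr (R.fiberMass g) φ, H.isTestFunction_lift hφ, ?_, ?_⟩
  · have h3 : lift pr (R.fiberMass g) φ - lift pr A v
        =ᵐ[(riemannianMeasure g).restrict (pr ⁻¹' B₀)] lift pr (R.fiberMass g) (φ - v) := by
      filter_upwards [hlift] with x hx
      rw [Pi.sub_apply, hx]
      simp only [lift, Pi.sub_apply]
      ring
    rw [l2Norm, eLpNorm_congr_ae h3]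
    refine (R.l2Norm_lift g hB₀ hpr ((hφ.inL2 gB).1.sub hv2.1)).trans_le (hφ2.le.trans h2.le)
  · refine (H.smoothEnergy_lift_le hφ hδ).trans (le_trans ?_ h1.le)
    have h4 : l2Norm gB B₀ φ ≤ l2Norm gB B₀ v + η' := by
      have h5 : φ = v + (φ - v) := by abel
      calc l2Norm gB B₀ φ = eLpNorm (v + (φ - v)) 2 _ := by rw [← h5]; rfl
        _ ≤ l2Norm gB B₀ v + l2Norm gB B₀ (φ - v) :=
          eLpNorm_add_le hv2.1 ((hφ.inL2 gB).1.sub hv2.1) (by norm_num)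
        _ ≤ _ := by gcongr
    simp only [Φ]
    gcongr

variable {ι : Type*} {F : Filter ι} {X : ι → Type*} [∀ t, TopologicalSpace (X t)]
  [∀ t, ChartedSpace (Eu 4) (X t)] [∀ t, IsManifold 𝓘(ℝ, Eu 4) ∞ (X t)] [∀ t, T2Space (X t)]
  [∀ t, SecondCountableTopology (X t)] [∀ t, MeasurableSpace (X t)] [∀ t, BorelSpace (X t)]
  {pr : ∀ t, X t → M} {R : ∀ t, SemiflatReference (pr t) gB B₀} {g : ∀ t, Metric 4 (X t)}
  {ε : ι → ℝ} {C : ℝ} {A : ι → M → ℝ} {ρ : ∀ t, X t → ℝ}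

theorem limsup_dirichletForm_lift_le (H : ∀ t, ε t < 1 → (R t).IsControlled (g t) (ε t) C)
    (hε : Tendsto ε F (𝓝 0))
    (hD : ∀ t, IsNormalizedDisintegration (pr t) B₀ (riemannianMeasure (g t))
      (riemannianMeasure gB) (R t).fiberHaar (A t) (ρ t)) {v : M → ℝ} (hv : v ∈ H10 gB B₀) :
    limsup (fun t => dirichletForm (g t) (pr t ⁻¹' B₀) (lift (pr t) (A t) v)) F ≤
      dirichletForm gB B₀ v := by
  have hE := dirichletForm_lt_top gB hv
  have hv2 : InL2 gB B₀ v := hv.choose_spec.inL2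
  have hl : Tendsto (fun t => 3 / 2 * logError (ε t) C) F (𝓝 0) := by
    simpa using ((tendsto_logError C).comp hε).const_mul (3 / 2)
  have h1 : Tendsto (fun t => ENNReal.ofReal (1 - ε t)⁻¹) F (𝓝 1) := by
    have : Tendsto (fun t => (1 - ε t)⁻¹) F (𝓝 1) := by
      simpa using (hε.const_sub 1).inv₀ (by simp)
    simpa using ENNReal.tendsto_ofReal this
  have h2 : Tendsto (fun t => ENNReal.ofReal (1 + 3 / 2 * logError (ε t) C)) F (𝓝 1) := by
    simpa using ENNReal.tendsto_ofReal (hl.const_add 1)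
  have h3 : Tendsto (fun t => ENNReal.ofReal (3 / 2 * logError (ε t) C +
      (3 / 2 * logError (ε t) C) ^ 2)) F (𝓝 0) := by
    simpa using ENNReal.tendsto_ofReal (hl.add (hl.pow 2))
  have h4 := ENNReal.Tendsto.mul h1 (Or.inl one_ne_zero)
    ((ENNReal.Tendsto.mul_const h2 (Or.inr hE.ne)).add
      (ENNReal.Tendsto.mul_const h3 (Or.inr (ENNReal.pow_ne_top (n := 2) hv2.2.ne))))
    (Or.inr ENNReal.one_ne_top)
  simp only [one_mul, zero_mul, add_zero] at h4
  refine le_of_forall_gt fun c hc => ?_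
  obtain ⟨d, hd, hdc⟩ := exists_between hc
  refine lt_of_le_of_lt (limsup_le_of_le (by isBoundedDefault) ?_) hdc
  filter_upwards [h4.eventually (gt_mem_nhds hd), hε.eventually (gt_mem_nhds one_pos)] with t ht ht1
  exact ((H t ht1).lift_mem_H10 (hD t) hv rfl).2.trans ht.le

/-- For every tolerance one index suffices: the average of a test function close to `u t` is a test
function on the base, close to `v`, with energy barely above the lower limit. Lower semicontinuity
on the fixed base concludes. -/
theorem dirichletForm_le_liminf (H : ∀ t, ε t < 1 → (R t).IsControlled (g t) (ε t) C)
    (hε : Tendsto ε F (𝓝 0))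
    (hD : ∀ t, IsNormalizedDisintegration (pr t) B₀ (riemannianMeasure (g t))
      (riemannianMeasure gB) (R t).fiberHaar (A t) (ρ t))
    {u : ∀ t, X t → ℝ} {v : M → ℝ} (hu : ∀ t, u t ∈ H10 (g t) (pr t ⁻¹' B₀)) {K : ℝ≥0∞}
    (hK : K ≠ ⊤) (huK : ∀ t, l2Norm (g t) (pr t ⁻¹' B₀) (u t) ≤ K) (hv : InL2 gB B₀ v)
    (huv : Tendsto (fun t => l2Norm gB B₀
      (average (R t).fiberHaar (A t) (ρ t) (u t) - v)) F (𝓝 0))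
    (hL : liminf (fun t => dirichletForm (g t) (pr t ⁻¹' B₀) (u t)) F < ⊤) :
    v ∈ H10 gB B₀ ∧ dirichletForm gB B₀ v ≤
      liminf (fun t => dirichletForm (g t) (pr t ⁻¹' B₀) (u t)) F := by
  set L := liminf (fun t => dirichletForm (g t) (pr t ⁻¹' B₀) (u t)) F with hLdef
  refine mem_H10_and_dirichletForm_le gB hv hL fun η hη => ?_
  -- Two errors of size `d` occur both in the norm and in the energy, hence `η / 2`; the cap at one
  -- bounds the norm of `w` by `K + 1`.
  set d := min (η / 2) 1 with hd
  have hd0 : 0 < d := lt_min (ENNReal.half_pos hη.ne') one_pos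
  have hd1 : d ≤ 1 := min_le_right _ _
  have hdt : d ≠ ⊤ := (hd1.trans_lt ENNReal.one_lt_top).ne
  have hdd : d + d ≤ η := (add_le_add (min_le_left _ _) (min_le_left _ _)).trans
    (ENNReal.add_halves η).le
  have hl : Tendsto (fun t => 3 / 2 * logError (ε t) C) F (𝓝 0) := by
    simpa using ((tendsto_logError C).comp hε).const_mul (3 / 2)
  have h2 : Tendsto (fun t => ENNReal.ofReal ((1 + 3 / 2 * logError (ε t) C) * (1 + ε t)))
      F (𝓝 1) := by
    simpa using ENNReal.tendsto_ofReal ((hl.const_add 1).mul (hε.const_add 1))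
  have h3 : Tendsto (fun t => ENNReal.ofReal (3 / 2 * logError (ε t) C +
      (3 / 2 * logError (ε t) C) ^ 2)) F (𝓝 0) := by
    simpa using ENNReal.tendsto_ofReal (hl.add (hl.pow 2))
  have hLd : L + d ≠ ⊤ := ENNReal.add_ne_top.2 ⟨hL.ne, hdt⟩
  have h4 := (ENNReal.Tendsto.mul_const h2 (Or.inr hLd)).add
    (ENNReal.Tendsto.mul_const h3 (Or.inr (ENNReal.pow_ne_top (n := 2)
      (ENNReal.add_ne_top.2 ⟨hK, ENNReal.one_ne_top⟩))))
  simp only [one_mul, zero_mul, add_zero] at h4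
  have hfr := frequently_lt_of_liminf_lt (by isBoundedDefault) (ENNReal.lt_add_right hL.ne hd0.ne')
  -- A value below the lower limit plus `d` is attained frequently, and the smallness conditions
  -- hold eventually, so some index satisfies them all.
  obtain ⟨t, hut, ⟨ht1, ht2⟩, ht3⟩ := (hfr.and_eventually
    (((hε.eventually (gt_mem_nhds one_pos)).and (h4.eventually (gt_mem_nhds
      (ENNReal.lt_add_right hLd hd0.ne')))).and (huv.eventually (gt_mem_nhds hd0)))).exists
  have Ht := H t ht1
  have hB₀ := Ht.isOpen_base
  have hpr := Ht.continuous_pr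
  obtain ⟨w, hw, hwu, hwE⟩ := exists_isTestFunction_of_dirichletForm_lt (g t) hut hd0
  have hu2 : InL2 (g t) (pr t ⁻¹' B₀) (u t) := (hu t).choose_spec.inL2
  have hw2 := hw.inL2 (g t)
  refine ⟨(R t).stdAverage (g t) w, Ht.isTestFunction_stdAverage hw, ?_, ?_⟩
  · refine ((R t).l2Norm_stdAverage_sub_le (g t) hB₀ hpr hu2 hw2 hv).trans (le_trans ?_ hdd)
    refine add_le_add ?_ hwu.le
    have h5 : (R t).stdAverage (g t) (u t) - v =ᵐ[(riemannianMeasure gB).restrict B₀]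
        average (R t).fiberHaar (A t) (ρ t) (u t) - v :=
      ((average_ae_eq hB₀ Ht.isCompact_closure hpr (hD t) (u t)).sub EventuallyEq.rfl).symm
    rw [l2Norm, eLpNorm_congr_ae h5]
    exact ht3.le
  · refine (Ht.smoothEnergy_stdAverage_le hw.1 rfl).trans ?_
    have h6 : l2Norm (g t) (pr t ⁻¹' B₀) w ≤ K + 1 := by
      have h5 : w = u t + (w - u t) := by abel
      calc l2Norm (g t) (pr t ⁻¹' B₀) w = eLpNorm (u t + (w - u t)) 2 _ := by rw [← h5]; rfl
        _ ≤ l2Norm (g t) (pr t ⁻¹' B₀) (u t) + l2Norm (g t) (pr t ⁻¹' B₀) (w - u t) :=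
          eLpNorm_add_le hu2.1 (hw2.1.sub hu2.1) (by norm_num)
        _ ≤ _ := add_le_add (huK t) (hwu.le.trans hd1)
    refine le_trans ?_ (ht2.le.trans ?_)
    · gcongr
    · rw [add_assoc]
      gcongr

end SemiflatReference

end Collapse

end

theorem mainTheorem4
    -- the base surface, the finite set `D`, the base metric and the domain `B₀ ⋐ B_reg`
    {B : Type*} [TopologicalSpace B] [T2Space B] [SecondCountableTopology B]
    [ChartedSpace (Collapse.Eu 2) B] [IsManifold 𝓘(ℝ, Collapse.Eu 2) ∞ B]
    [MeasurableSpace B] [BorelSpace B] (D : Finset B)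
    (gB : Collapse.Metric 2 (Collapse.regularLocus D))
    (B₀ : Set (Collapse.regularLocus D)) (hB₀_open : IsOpen B₀)
    (hB₀_compact : IsCompact (closure B₀))
    -- the total spaces, the projections and the metrics `g(t)`, for `t ∈ (0, t₀]`
    (t₀ : ℝ) (ht₀ : 0 < t₀)
    {X : Set.Ioc (0 : ℝ) t₀ → Type*} [∀ t, TopologicalSpace (X t)] [∀ t, T2Space (X t)]
    [∀ t, SecondCountableTopology (X t)] [∀ t, ChartedSpace (Collapse.Eu 4) (X t)]
    [∀ t, IsManifold 𝓘(ℝ, Collapse.Eu 4) ∞ (X t)]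
    [∀ t, MeasurableSpace (X t)] [∀ t, BorelSpace (X t)]
    (proj : ∀ t, X t → Collapse.regularLocus D)
    (hproj_smooth : ∀ t, ContMDiff 𝓘(ℝ, Collapse.Eu 4) 𝓘(ℝ, Collapse.Eu 2) ∞ (proj t))
    (hproj_surj : ∀ t, Function.Surjective (proj t))
    (hproj_subm : ∀ t x, Function.Surjective
      (mfderiv 𝓘(ℝ, Collapse.Eu 4) 𝓘(ℝ, Collapse.Eu 2) (proj t) x))
    (g : ∀ t, Collapse.Metric 4 (X t))
    -- the product reference metrics, the collapse scale and the error gauge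
    (R : ∀ t, Collapse.SemiflatReference (proj t) gB B₀)
    (s ε : Set.Ioc (0 : ℝ) t₀ → ℝ)
    (hs_pos : ∀ t, 0 < s t) (hs_lim : Tendsto s (Collapse.downToZero t₀) (𝓝 0))
    (hε_nonneg : ∀ t, 0 ≤ ε t) (hε_lim : Tendsto ε (Collapse.downToZero t₀) (𝓝 0))
    -- semi-flat `C¹` control, slow variation of the reference fibre areas, fibre diameters
    (hC1 : ∀ t, Collapse.C1NormLE (R t).gRef (fun x => (g t).inner x - (R t).gRef x)
      (proj t ⁻¹' B₀) (ε t))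
    (C : ℝ)
    (harea : ∀ t, ∀ b ∈ B₀, ∀ ξ : Collapse.Tan 2 b,
      |Collapse.differential (fun b' => Real.log ((R t).fiberArea b')) b ξ|
        ≤ C * ε t * Real.sqrt (gB.inner b ξ ξ))
    (hdiam : ∀ t, ∀ b : B₀, Collapse.torusDiam ((R t).fiberMetric b) ≤ s t)
    -- uniform vertical spectral gap
    (cgap : ℝ) (hcgap : 0 < cgap)
    (hgap : ∀ t, ∀ b : B₀, cgap * (s t ^ 2)⁻¹ ≤ Collapse.torusLambda1 ((R t).fiberMetric b)) :
    -- the normalized disintegration exists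
    (∀ t, ∃ (A : Collapse.regularLocus D → ℝ) (ρ : X t → ℝ),
      Collapse.IsNormalizedDisintegration (proj t) B₀ (Collapse.riemannianMeasure (g t))
        (Collapse.riemannianMeasure gB) (R t).fiberHaar A ρ) ∧
    -- and for the lift and average operators which it defines:
    ∀ (A : Set.Ioc (0 : ℝ) t₀ → Collapse.regularLocus D → ℝ) (ρ : ∀ t, X t → ℝ),
      (∀ t, Collapse.IsNormalizedDisintegration (proj t) B₀ (Collapse.riemannianMeasure (g t))
        (Collapse.riemannianMeasure gB) (R t).fiberHaar (A t) (ρ t)) →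
      -- liminf inequality
      (∀ (u : ∀ t, X t → ℝ) (v : Collapse.regularLocus D → ℝ),
        (∀ t, u t ∈ Collapse.H10 (g t) (proj t ⁻¹' B₀)) →
        (∃ K : ℝ, ∀ t, Collapse.l2Norm (g t) (proj t ⁻¹' B₀) (u t) ≤ ENNReal.ofReal K) →
        Collapse.InL2 gB B₀ v →
        Tendsto (fun t => Collapse.l2Norm gB B₀
          (Collapse.average (R t).fiberHaar (A t) (ρ t) (u t) - v))
          (Collapse.downToZero t₀) (𝓝 0) →
        (liminf (fun t => Collapse.dirichletForm (g t) (proj t ⁻¹' B₀) (u t))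
            (Collapse.downToZero t₀) < ⊤ → v ∈ Collapse.H10 gB B₀) ∧
        Collapse.dirichletForm gB B₀ v
          ≤ liminf (fun t => Collapse.dirichletForm (g t) (proj t ⁻¹' B₀) (u t))
              (Collapse.downToZero t₀)) ∧
      -- recovery sequence `u_t = I_t v`
      (∀ v ∈ Collapse.H10 gB B₀,
        (∀ t, ε t < 1 →
          Collapse.lift (proj t) (A t) v ∈ Collapse.H10 (g t) (proj t ⁻¹' B₀)) ∧
        (∀ t, Collapse.average (R t).fiberHaar (A t) (ρ t) (Collapse.lift (proj t) (A t) v)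
          =ᵐ[(Collapse.riemannianMeasure gB).restrict B₀] v) ∧
        limsup (fun t => Collapse.dirichletForm (g t) (proj t ⁻¹' B₀)
            (Collapse.lift (proj t) (A t) v)) (Collapse.downToZero t₀)
          ≤ Collapse.dirichletForm gB B₀ v) := by
  have hctrl : ∀ t, ε t < 1 → (R t).IsControlled (g t) (ε t) C := fun t ht =>
    ⟨hB₀_open, hB₀_compact, hproj_smooth t, hε_nonneg t, ht, hC1 t, harea t⟩
  refine ⟨fun t => ⟨_, _, (R t).isNormalizedDisintegration (g t) hB₀_open
    (hproj_smooth t).continuous⟩, fun A ρ hD => ⟨?_, ?_⟩⟩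
  · rintro u v hu ⟨K, hK⟩ hv huv
    have key := Collapse.SemiflatReference.dirichletForm_le_liminf hctrl hε_lim hD hu
      ENNReal.ofReal_ne_top hK hv huv
    refine ⟨fun hL => (key hL).1, ?_⟩
    -- With an infinite lower limit `v` need not lie in `H¹₀`, and the inequality is trivial.
    by_cases hL : liminf (fun t => Collapse.dirichletForm (g t) (proj t ⁻¹' B₀) (u t))
        (Collapse.downToZero t₀) < ⊤
    · exact (key hL).2
    · rw [not_lt_top_iff.1 hL]
      exact le_top
  · intro v hv
    refine ⟨fun t ht => ((hctrl t ht).lift_mem_H10 (hD t) hv rfl).1, fun t => ?_,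
      Collapse.SemiflatReference.limsup_dirichletForm_lift_le hctrl hε_lim hD hv⟩
    filter_upwards [ae_restrict_mem hB₀_open.measurableSet] with b hb
    exact Collapse.SemiflatReference.average_lift (hproj_smooth t).continuous (hD t) v hb
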